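/- Let $n\ge 1$, let $\mathbb B_n=\{z\in\mathbb C^n:|z|<1\}$, $\langle z,w\rangle=z_1\overline w_1+\cdots+z_n\overline w_n$, and let $dv$ be volume measure on $\mathbb B_n$. For a complex parameter $\gamma$ write $dv_\gamma(z)=c_\gamma(1-|z|^2)^\gamma\,dv(z)$, where $c_\gamma>0$ is chosen so that the total variation of $dv_\gamma$ is $1$ if $\operatorname{Re}\gamma>-1$, and $c_\gamma=1$ otherwise; $L^p(dv_\lambda)$ means $L^p(\mathbb B_n,dv_{\operatorname{Re}\lambda})$. For $p>0$ and real $\alpha$, the space $A^p_\alpha$ consists of the holomorphic functions $f$ in $\mathbb B_n$ such that, for some nonnegative integer $k$ with $pk+\alpha>-1$, the function $(1-|z|^2)^kR^kf(z)$ belongs to $L^p(dv_\alpha)$, where $Rf(z)=\sum_{j=1}^n z_j\,\partial f/\partial z_j(z)$. Powers $(1-\langle z,w\rangle)^c$ are taken with the principal branch. **Theorem.** Let $1\le p<\infty$, let $\alpha$ be real and let $\gamma,\lambda$ be complex. Consider the conditions (a) $p(\operatorname{Re}\gamma+1)>\operatorname{Re}\lambda+1$, (b) $n+\gamma+(\alpha-\lambda)/p$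 is not a negative integer, and the integral representation $$f(z)=\int_{\mathbb B_n}\frac{g(w)\,dv_\gamma(w)}{(1-\langle z,w\rangle)^{n+1+\gamma+(\alpha-\lambda)/p}},\qquad z\in\mathbb B_n,\tag{$*$}$$ where the integral is required to converge absolutely for every $z\in\mathbb B_n$. 1. If (a) and (b) hold, then the integral in $(*)$ converges absolutely for every $g\in L^p(dv_\lambda)$ and $z\in\mathbb B_n$, and a holomorphic function $f$ in $\mathbb B_n$ belongs to $A^p_\alpha$ if and only if $(*)$ holds for some $g\in L^p(dv_\lambda)$. 2. Condition (b) is sharp: if (b) fails, then some $f\in A^p_\alpha$ is not of the form $(*)$ for any $g\in L^p(dv_\lambda)$. 3. Condition (a) is sharp: if (b) holds, and if for every $g\in L^p(dv_\lambda)$ the integral in $(*)$ converges absolutely for every $z\in\mathbb B_n$ and defines a function in $A^p_\alpha$, then (a) holds. -/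

import Mathlib

open MeasureTheory Metric

noncomputable section

namespace BergmanBall

/-- Complex Euclidean space `ℂⁿ`, with the norm `|z| = (|z₁|² + ⋯ + |zₙ|²)^{1/2}`. -/
abbrev Cn (n : ℕ) : Type := EuclideanSpace ℂ (Fin n)

/-- The open unit ball of `ℂⁿ`. -/
def unitBall (n : ℕ) : Set (Cn n) := ball 0 1

/-- The pairing `⟨z, w⟩ = z₁ w̄₁ + ⋯ + zₙ w̄ₙ`. -/
def pairing {n : ℕ} (z w : Cn n) : ℂ := ∑ i, z i * starRingEnd ℂ (w i)

/-- The radial derivative `Rf(z) = ∑ₖ zₖ ∂f/∂zₖ (z)`. -/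
def radialDeriv {n : ℕ} (f : Cn n → ℂ) : Cn n → ℂ :=
  fun z => ∑ k, z k * fderiv ℂ f z (EuclideanSpace.single k 1)

/-- The constant that makes `(1 - |z|²)^α dv` a probability measure on the unit ball when
`α > -1`; there is no normalization when `α ≤ -1` (the total mass is then infinite). -/
def normConst (n : ℕ) (α : ℝ) : ℝ :=
  if -1 < α then (∫ z in unitBall n, (1 - ‖z‖ ^ 2) ^ α)⁻¹ else 1

/-- The positive measure `dv_α(z) = (1 - |z|²)^α dv(z)` on the unit ball, for real `α`, normalized
to be a probability measure when `α > -1`. -/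
def weightedMeasure (n : ℕ) (α : ℝ) : Measure (Cn n) :=
  ENNReal.ofReal (normConst n α) •
    (volume.restrict (unitBall n)).withDensity (fun z => ENNReal.ofReal ((1 - ‖z‖ ^ 2) ^ α))

/-- `f` belongs to `L^p(dv_lam)` for a complex parameter `lam`: as
`|(1 - |z|²)^lam| = (1 - |z|²)^(Re lam)`, only the real part of `lam` matters. -/
def MemLpWeighted {n : ℕ} (p : ℝ) (lam : ℂ) (f : Cn n → ℂ) : Prop :=
  MemLp f (ENNReal.ofReal p) (weightedMeasure n lam.re)

/-- The weighted Bergman space `A^p_α` for arbitrary real `α`: the functions `f` holomorphic in the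
unit ball such that `(1 - |z|²)^k R^k f(z)` is in `L^p(dv_α)` for some nonnegative integer `k`
with `p k + α > -1`. -/
def MemBergman {n : ℕ} (p α : ℝ) (f : Cn n → ℂ) : Prop :=
  DifferentiableOn ℂ f (unitBall n) ∧
    ∃ k : ℕ, -1 < p * k + α ∧
      MemLpWeighted p (α : ℂ)
        (fun z => (((1 - ‖z‖ ^ 2) ^ k : ℝ) : ℂ) * (radialDeriv^[k] f) z)

/-- The function `g(w) (1 - |w|²)^γ / (1 - ⟨z, w⟩)^c` of `w`. For `z, w` in the unit ball
`1 - ⟨z, w⟩` has positive real part, and the power is the principal one. -/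
def kernelIntegrand {n : ℕ} (γ c : ℂ) (g : Cn n → ℂ) (z w : Cn n) : ℂ :=
  g w / (1 - pairing z w) ^ c * (((1 - ‖w‖ ^ 2 : ℝ) : ℂ) ^ γ)

/-- The integral `∫ g(w) dv_γ(w) / (1 - ⟨z, w⟩)^c` over the unit ball converges absolutely. -/
def KernelConverges {n : ℕ} (γ c : ℂ) (g : Cn n → ℂ) (z : Cn n) : Prop :=
  IntegrableOn (kernelIntegrand γ c g z) (unitBall n)

/-- The value of `∫ g(w) dv_γ(w) / (1 - ⟨z, w⟩)^c` over the unit ball, for complex `γ`. -/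
def kernelIntegral {n : ℕ} (γ c : ℂ) (g : Cn n → ℂ) (z : Cn n) : ℂ :=
  (normConst n γ.re : ℂ) * ∫ w in unitBall n, kernelIntegrand γ c g z w

/-- `f(z) = ∫ g(w) dv_γ(w) / (1 - ⟨z, w⟩)^c` for every `z` in the unit ball, the integral being
absolutely convergent. -/
def Represents {n : ℕ} (γ c : ℂ) (g f : Cn n → ℂ) : Prop :=
  ∀ z ∈ unitBall n, KernelConverges γ c g z ∧ f z = kernelIntegral γ c g z

/-- The complex number `a` is a negative integer. -/
def IsNegInt (a : ℂ) : Prop := ∃ m : ℤ, m < 0 ∧ a = m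

end BergmanBall

end

noncomputable section

namespace BergmanBall

open Set Filter
open scoped Topology ENNReal Pointwise

section

variable {n : ℕ}

/-! ### The pairing and the kernel -/

/-! Put ψ(w) = 1 - |w|², c = n + 1 + γ + (α - λ)/p and B = Re γ - Re λ/p. Condition (a) reads B > -1
+ 1/p, and (b) says that c is none of 0, -1, -2, …. Up to a nonzero constant, g ∈ L^p(dv_λ)
corresponds to a density H = gψ^γ with ψ^{-B}H ∈ L^p(dv), and the representation becomes f = `kerInt
c H`, where Re c = n + 1 + α/p + B. The algebra is governed by R(1 - ⟨z,w⟩)^{-c} = c((1 -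
⟨z,w⟩)^{-c-1} - (1 - ⟨z,w⟩)^{-c}), so 1 + R/c raises the exponent of the kernel by one
(`radialDeriv_kerInt`).

Kernel integrals lie in A^p_α: R^k of `kerInt c H` is a combination of `kerInt (c + i) H` with i ≤
k, and Schur's test (`schur_test`), fed by the Forelli-Rudin estimate, bounds ψ^A times these in L^p
for A = α/p + k > -1/p, exactly when B > -1 + 1/p is available.

Conversely, for f in A^p_α and M large, let h = ∏_{i<M}(1 + R/(c + i)) f, which (b) makes
meaningful. Then ψ^{α/p+M}h ∈ L^p (`MemBergman.exists_wlp`), and the reproducing formula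
`kerInt_reproducing` writes h as a multiple of `kerInt (c + M) H₂` with H₂ = hψ^{c+M-n-1}. The same
operator carries `kerInt c H₂` to `kerInt (c + M) H₂` and is injective on holomorphic functions
(`shiftDeriv_injective`), so f is a multiple of `kerInt c H₂`.

Sharpness of (b): if c = -m, the kernel is a polynomial of degree m in z, so z₁^{m+1} is not
represented (`coord_pow_eq_kerInt_neg`).

Sharpness of (a): convergence at z = 0 makes gψ^γ integrable for every g ∈ L^p(dv_λ), and explicit
radial g force (a) unless p = 1 and Re γ = Re λ (`lt_or_eq_of_forall_integrableOn`). In that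
remaining case H runs over all of L¹. Membership in A^1_α would put `kerInt (c + k) H` in L¹(ψ^t
dv), t = α + k, for all H. Uniform boundedness, tested on approximate point masses at a, would bound
∫ψ(z)^t|1 - ⟨z,a⟩|^{-(n+1+t)}dv(z) uniformly in a, but these integrals diverge as a tends to the
sphere (`not_forall_wlp_one_kerInt`). -/

theorem pairing_eq_inner (z w : Cn n) : pairing z w = inner ℂ w z := by
  simp [pairing, PiLp.inner_apply]

theorem norm_pairing_le (z w : Cn n) : ‖pairing z w‖ ≤ ‖z‖ * ‖w‖ := by
  rw [pairing_eq_inner, mul_comm]; exact norm_inner_le_norm w z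

theorem conj_pairing (z w : Cn n) : starRingEnd ℂ (pairing z w) = pairing w z := by
  rw [pairing_eq_inner, pairing_eq_inner, inner_conj_symm]

@[simp] theorem pairing_zero_left (w : Cn n) : pairing 0 w = 0 := by simp [pairing]

theorem mem_unitBall {z : Cn n} : z ∈ unitBall n ↔ ‖z‖ < 1 := by simp [unitBall]

theorem isOpen_unitBall : IsOpen (unitBall n) := isOpen_ball

theorem measurableSet_unitBall : MeasurableSet (unitBall n) := measurableSet_ball

theorem zero_mem_unitBall : (0 : Cn n) ∈ unitBall n := by simp [mem_unitBall]

/-- The defining function `1 - |w|²` of the unit ball. -/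
abbrev psi {E : Type*} [NormedAddCommGroup E] (w : E) : ℝ := 1 - ‖w‖ ^ 2

theorem psi_pos {E : Type*} [NormedAddCommGroup E] {w : E} (hw : ‖w‖ < 1) : 0 < psi w := by
  have := norm_nonneg w
  simp only [psi]; nlinarith

theorem psi_le_one {E : Type*} [NormedAddCommGroup E] (w : E) : psi w ≤ 1 := by
  simp only [psi]; nlinarith [sq_nonneg ‖w‖]

theorem one_sub_norm_le_norm_one_sub_pairing {z w : Cn n} (hw : w ∈ unitBall n) :
    1 - ‖z‖ ≤ ‖1 - pairing z w‖ := by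
  have h1 : ‖pairing z w‖ ≤ ‖z‖ := (norm_pairing_le z w).trans
    (mul_le_of_le_one_right (norm_nonneg _) (mem_unitBall.1 hw).le)
  have h2 := norm_sub_norm_le (1 : ℂ) (pairing z w)
  rw [norm_one] at h2
  linarith

theorem norm_one_sub_pairing_le {z w : Cn n} (hz : z ∈ unitBall n) (hw : w ∈ unitBall n) :
    ‖1 - pairing z w‖ ≤ 2 := by
  have h1 : ‖pairing z w‖ ≤ 1 := (norm_pairing_le z w).trans
    (mul_le_one₀ (mem_unitBall.1 hz).le (norm_nonneg _) (mem_unitBall.1 hw).le)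
  have h2 := norm_sub_le (1 : ℂ) (pairing z w)
  rw [norm_one] at h2
  linarith

theorem one_sub_pairing_re_pos {z w : Cn n} (hz : z ∈ unitBall n) (hw : w ∈ unitBall n) :
    0 < (1 - pairing z w).re := by
  have h1 : ‖pairing z w‖ ≤ ‖z‖ := (norm_pairing_le z w).trans
    (mul_le_of_le_one_right (norm_nonneg _) (mem_unitBall.1 hw).le)
  have h2 := Complex.re_le_norm (pairing z w)
  have h3 := mem_unitBall.1 hz
  simp only [Complex.sub_re, Complex.one_re]
  linarith

theorem norm_one_sub_pairing_pos {z w : Cn n} (hz : z ∈ unitBall n) (hw : w ∈ unitBall n) :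
    0 < ‖1 - pairing z w‖ :=
  (one_sub_pairing_re_pos hz hw).trans_le (Complex.re_le_norm _)

theorem continuous_pairing_left (w : Cn n) : Continuous fun z => pairing z w := by
  simp only [pairing]; fun_prop

theorem continuous_pairing_right (z : Cn n) : Continuous fun w => pairing z w := by
  simp only [pairing]; fun_prop

theorem continuous_pairing : Continuous fun q : Cn n × Cn n => pairing q.1 q.2 := by
  simp only [pairing]; fun_prop

/-- The imaginary part of c only contributes a factor e^{arg(x) Im c}, which is bounded since the
argument is. With its lower companion this lets complex exponents be treated as real ones. -/
theorem norm_cpow_neg_le {x : ℂ} (hx : 0 < x.re) (c : ℂ) :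
    ‖x ^ (-c)‖ ≤ Real.exp (Real.pi * |c.im|) * ‖x‖ ^ (-c.re) := by
  have hx0 : x ≠ 0 := by rintro rfl; simp at hx
  rw [Complex.norm_cpow_of_ne_zero hx0, div_eq_mul_inv, ← Real.exp_neg, mul_comm]
  have : -(x.arg * (-c).im) ≤ Real.pi * |c.im| := by
    rw [Complex.neg_im, mul_neg, neg_neg]
    refine (le_abs_self _).trans ?_
    rw [abs_mul]
    exact mul_le_mul_of_nonneg_right (Complex.abs_arg_le_pi x) (abs_nonneg _)
  rw [Complex.neg_re]
  gcongr

theorem le_norm_cpow_neg {x : ℂ} (hx : 0 < x.re) (c : ℂ) :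
    Real.exp (-(Real.pi * |c.im|)) * ‖x‖ ^ (-c.re) ≤ ‖x ^ (-c)‖ := by
  have hx0 : x ≠ 0 := by rintro rfl; simp at hx
  rw [Complex.norm_cpow_of_ne_zero hx0, div_eq_mul_inv, ← Real.exp_neg, mul_comm]
  have : -(Real.pi * |c.im|) ≤ -(x.arg * (-c).im) := by
    rw [Complex.neg_im, mul_neg, neg_neg, neg_le]
    refine (neg_le_abs _).trans ?_
    rw [abs_mul]
    exact mul_le_mul_of_nonneg_right (Complex.abs_arg_le_pi x) (abs_nonneg _)
  rw [Complex.neg_re]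
  gcongr

/-- The kernel `(1 - ⟨z, w⟩)^{-c}`. -/
def ker (c : ℂ) (z w : Cn n) : ℂ := (1 - pairing z w) ^ (-c)

/-- As |1 - ⟨z,w⟩| ≤ 2, raising the exponent costs only a constant. All derivatives of a kernel
integral can thus be estimated with the single largest exponent. -/
theorem norm_ker_le_rpow (c : ℂ) {s : ℝ} (hs : c.re ≤ s) : ∃ C : ℝ, 0 < C ∧
    ∀ z ∈ unitBall n, ∀ w ∈ unitBall n, ‖ker c z w‖ ≤ C * ‖1 - pairing z w‖ ^ (-s) := by
  refine ⟨Real.exp (Real.pi * |c.im|) * 2 ^ (s - c.re), by positivity, fun z hz w hw => ?_⟩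
  have h0 := norm_one_sub_pairing_pos hz hw
  refine (norm_cpow_neg_le (one_sub_pairing_re_pos hz hw) c).trans ?_
  rw [mul_assoc]
  gcongr
  have : ‖1 - pairing z w‖ ^ (-c.re)
      = ‖1 - pairing z w‖ ^ (s - c.re) * ‖1 - pairing z w‖ ^ (-s) := by
    rw [← Real.rpow_add h0]; ring_nf
  rw [this]
  gcongr
  exact norm_one_sub_pairing_le hz hw

theorem norm_ker_le (c : ℂ) : ∃ C L : ℝ, 0 < C ∧ 0 ≤ L ∧
    ∀ z ∈ unitBall n, ∀ w ∈ unitBall n, ‖ker c z w‖ ≤ C * (1 - ‖z‖) ^ (-L) := by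
  obtain ⟨C, hC, h⟩ := norm_ker_le_rpow (n := n) c (le_max_left c.re 0)
  refine ⟨C, max c.re 0, hC, le_max_right _ _, fun z hz w hw => (h z hz w hw).trans ?_⟩
  have := mem_unitBall.1 hz
  gcongr ?_ * ?_
  exact Real.rpow_le_rpow_of_nonpos (by linarith) (one_sub_norm_le_norm_one_sub_pairing hw)
    (by simp)

theorem measurable_ker (c : ℂ) : Measurable fun q : Cn n × Cn n => ker c q.1 q.2 := by
  unfold ker
  exact (measurable_const.sub continuous_pairing.measurable).pow_const _

theorem measurable_ker_right (c : ℂ) (z : Cn n) : Measurable fun w => ker c z w := by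
  unfold ker
  exact (measurable_const.sub (continuous_pairing_right z).measurable).pow_const _

theorem measurable_ker_left (c : ℂ) (w : Cn n) : Measurable fun z => ker c z w := by
  unfold ker
  exact (measurable_const.sub (continuous_pairing_left w).measurable).pow_const _

/-- The principal branch commutes with conjugation off the negative axis, and 1 - ⟨z,w⟩ has positive
real part. This turns antiholomorphic dependence on w into holomorphic dependence. -/
theorem conj_ker (c : ℂ) {z w : Cn n} (hz : z ∈ unitBall n) (hw : w ∈ unitBall n) :
    starRingEnd ℂ (ker c z w) = ker (starRingEnd ℂ c) w z := by
  have harg : (1 - pairing z w).arg ≠ Real.pi := fun h =>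
    absurd (one_sub_pairing_re_pos hz hw) (not_lt.2 (by
      have := (Complex.arg_eq_pi_iff.1 h).1; exact this.le))
  unfold ker
  have := Complex.conj_cpow _ (-starRingEnd ℂ c) harg
  rw [map_neg, Complex.conj_conj] at this
  rw [← this]
  simp [conj_pairing]

/-! ### Integrals against the kernel -/

/-- The integral `∫ H(w) (1 - ⟨z, w⟩)^{-c} dv(w)` over the unit ball. -/
def kerInt (c : ℂ) (H : Cn n → ℂ) (z : Cn n) : ℂ := ∫ w in unitBall n, H w * ker c z w

theorem integrableOn_mul_ker (c : ℂ) {H : Cn n → ℂ} (hH : IntegrableOn H (unitBall n))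
    {z : Cn n} (hz : z ∈ unitBall n) :
    IntegrableOn (fun w => H w * ker c z w) (unitBall n) := by
  obtain ⟨C, L, hC, hL, h⟩ := norm_ker_le (n := n) c
  refine Integrable.mul_bdd (c := C * (1 - ‖z‖) ^ (-L)) hH (measurable_ker_right c z).aestronglyMeasurable
    ((ae_restrict_iff' measurableSet_unitBall).2 (.of_forall fun w hw => h z hz w hw))

theorem norm_kerInt_le (c : ℂ) {H : Cn n → ℂ} (hH : IntegrableOn H (unitBall n)) :
    ∃ C L : ℝ, 0 < C ∧ 0 ≤ L ∧ ∀ z ∈ unitBall n, ‖kerInt c H z‖ ≤ C * (1 - ‖z‖) ^ (-L) := by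
  obtain ⟨C, L, hC, hL, h⟩ := norm_ker_le (n := n) c
  set I := ∫ w in unitBall n, ‖H w‖
  have hI : 0 ≤ I := by positivity
  refine ⟨(I + 1) * C, L, by positivity, hL, fun z hz => ?_⟩
  have h1 : 0 ≤ 1 - ‖z‖ := by linarith [mem_unitBall.1 hz]
  calc ‖kerInt c H z‖ ≤ ∫ w in unitBall n, ‖H w‖ * (C * (1 - ‖z‖) ^ (-L)) := by
        refine norm_integral_le_of_norm_le (hH.norm.mul_const _) ?_
        refine (ae_restrict_iff' measurableSet_unitBall).2 (.of_forall fun w hw => ?_)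
        rw [norm_mul]
        gcongr
        exact h z hz w hw
    _ = I * (C * (1 - ‖z‖) ^ (-L)) := integral_mul_const _ _
    _ ≤ (I + 1) * C * (1 - ‖z‖) ^ (-L) := by
        rw [mul_assoc]
        gcongr
        linarith

theorem radialDeriv_eq_fderiv (f : Cn n → ℂ) (z : Cn n) : radialDeriv f z = fderiv ℂ f z z := by
  have h : z = ∑ k, z k • EuclideanSpace.single k (1 : ℂ) := by
    ext i; simp [Pi.single_apply]
  conv_rhs => rw [h]
  simp only [map_sum, map_smul, smul_eq_mul]
  rw [← h]; rfl

theorem hasFDerivAt_ker (c : ℂ) {z w : Cn n} (hz : z ∈ unitBall n) (hw : w ∈ unitBall n) :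
    HasFDerivAt (fun z => ker c z w) ((c * ker (c + 1) z w) • innerSL ℂ w) z := by
  have h1 : HasFDerivAt (fun z => 1 - pairing z w) (-(innerSL ℂ w)) z := by
    have : (fun z => 1 - pairing z w) = fun z => 1 - innerSL ℂ w z := by
      ext z; rw [pairing_eq_inner]; rfl
    rw [this]
    exact ((innerSL ℂ w).hasFDerivAt).const_sub 1
  have h2 := (Complex.hasStrictDerivAt_cpow_const (c := -c) (Or.inl (one_sub_pairing_re_pos hz hw))).hasDerivAt.comp_hasFDerivAt z h1
  refine h2.congr_fderiv ?_
  ext v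
  simp only [smul_apply, neg_apply, smul_eq_mul, ker]
  rw [show -c - 1 = -(c + 1) by ring]; ring

theorem hasFDerivAt_kerInt (c : ℂ) {H : Cn n → ℂ} (hH : IntegrableOn H (unitBall n))
    {z : Cn n} (hz : z ∈ unitBall n) :
    HasFDerivAt (kerInt c H)
      (∫ w in unitBall n, (H w * (c * ker (c + 1) z w)) • innerSL ℂ w) z := by
  obtain ⟨C, L, hC, hL, h⟩ := norm_ker_le (n := n) (c + 1)
  obtain ⟨r, hr1, hr2⟩ := exists_between (mem_unitBall.1 hz)
  have hball : ball (0 : Cn n) r ∈ 𝓝 z := isOpen_ball.mem_nhds (by simpa using hr1)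
  have hsub : ball (0 : Cn n) r ⊆ unitBall n := ball_subset_ball hr2.le
  refine hasFDerivAt_integral_of_dominated_of_fderiv_le (𝕜 := ℂ) (s := ball (0 : Cn n) r) (F' := fun z w => (H w * (c * ker (c + 1) z w)) • innerSL ℂ w) (F := fun z w => H w * ker c z w)
    (bound := fun w => ‖H w‖ * (‖c‖ * (C * (1 - r) ^ (-L)))) hball ?_
    (integrableOn_mul_ker c hH hz) ?_ ?_ (hH.norm.mul_const _) ?_
  · exact .of_forall fun z => hH.1.mul (measurable_ker_right c z).aestronglyMeasurable
  · refine (hH.1.mul (aestronglyMeasurable_const.mul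
      (measurable_ker_right (c + 1) z).aestronglyMeasurable)).smul ?_
    exact (innerSL ℂ).continuous.aestronglyMeasurable
  · refine (ae_restrict_iff' measurableSet_unitBall).2 (.of_forall fun w hw x hx => ?_)
    have hx1 := h x (hsub hx) w hw
    have hx2 : ‖x‖ < r := by simpa using hx
    rw [norm_smul, innerSL_apply_norm, norm_mul, norm_mul]
    have h1 : (1 - ‖x‖) ^ (-L) ≤ (1 - r) ^ (-L) :=
      Real.rpow_le_rpow_of_nonpos (by linarith) (by linarith) (by linarith)
    calc ‖H w‖ * (‖c‖ * ‖ker (c + 1) x w‖) * ‖w‖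
        ≤ ‖H w‖ * (‖c‖ * (C * (1 - r) ^ (-L))) * 1 := by
          have : 0 ≤ (1 - r) ^ (-L) := Real.rpow_nonneg (by linarith) _
          gcongr
          · exact hx1.trans (by gcongr)
          · exact (mem_unitBall.1 hw).le
      _ = _ := mul_one _
  · refine (ae_restrict_iff' measurableSet_unitBall).2 (.of_forall fun w hw x hx => ?_)
    have := (hasFDerivAt_ker c (hsub hx) hw).const_mul (H w)
    rwa [smul_smul] at this

theorem differentiableOn_kerInt (c : ℂ) {H : Cn n → ℂ} (hH : IntegrableOn H (unitBall n)) :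
    DifferentiableOn ℂ (kerInt c H) (unitBall n) := fun _ hz =>
  (hasFDerivAt_kerInt c hH hz).differentiableAt.differentiableWithinAt

/-- Under the integral, R produces c⟨z,w⟩(1 - ⟨z,w⟩)^{-c-1}; writing ⟨z,w⟩ = 1 - (1 - ⟨z,w⟩) splits
this into two kernels. -/
theorem radialDeriv_kerInt (c : ℂ) {H : Cn n → ℂ} (hH : IntegrableOn H (unitBall n))
    {z : Cn n} (hz : z ∈ unitBall n) :
    radialDeriv (kerInt c H) z = c * (kerInt (c + 1) H z - kerInt c H z) := by
  rw [radialDeriv_eq_fderiv, (hasFDerivAt_kerInt c hH hz).fderiv,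
    ContinuousLinearMap.integral_apply]
  · unfold kerInt
    rw [← integral_sub (integrableOn_mul_ker _ hH hz) (integrableOn_mul_ker _ hH hz),
      ← integral_const_mul]
    refine setIntegral_congr_fun measurableSet_unitBall fun w hw => ?_
    have h0 : (1 - pairing z w) ≠ 0 := norm_pos_iff.1 (norm_one_sub_pairing_pos hz hw)
    simp only [smul_apply, smul_eq_mul, ker, innerSL_apply_apply]
    rw [← pairing_eq_inner]
    have : (1 - pairing z w) ^ (-c) = (1 - pairing z w) * (1 - pairing z w) ^ (-(c + 1)) := by
      rw [show -c = 1 + -(c + 1) by ring, Complex.cpow_add _ _ h0, Complex.cpow_one]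
    rw [this]; ring
  · have := integrableOn_mul_ker (c + 1) hH hz
    have h2 : IntegrableOn (fun w => H w * (c * ker (c + 1) z w)) (unitBall n) := by
      refine (this.const_mul c).congr (.of_forall fun w => ?_)
      ring
    refine h2.norm.mono' (h2.1.smul (innerSL ℂ).continuous.aestronglyMeasurable) ?_
    refine (ae_restrict_iff' measurableSet_unitBall).2 (.of_forall fun w hw => ?_)
    rw [norm_smul, innerSL_apply_norm]
    exact mul_le_of_le_one_right (norm_nonneg _) (mem_unitBall.1 hw).le

end

section

/-! ### The weighted mean value property -/

theorem integral_comp_smul_circleMap {E : Type*} [NormedAddCommGroup E] [NormedSpace ℂ E]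
    {φ : E → ℂ} {ρ : ℝ} (hφ : DifferentiableOn ℂ φ (ball 0 ρ)) {v : E} (hv : v ∈ ball (0 : E) ρ) :
    ∫ θ in Ioc 0 (2 * Real.pi), φ (circleMap 0 1 θ • v) = 2 * Real.pi * φ 0 := by
  have hv' : ‖v‖ < ρ := by simpa using hv
  have hU : IsOpen ((fun ζ : ℂ => ζ • v) ⁻¹' ball 0 ρ) :=
    isOpen_ball.preimage (continuous_id.smul continuous_const)
  have hd : DifferentiableOn ℂ (fun ζ : ℂ => φ (ζ • v)) ((fun ζ : ℂ => ζ • v) ⁻¹' ball 0 ρ) :=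
    hφ.comp (differentiable_id.smul_const v).differentiableOn fun _ h => h
  have hcl : closedBall (0 : ℂ) |1| ⊆ (fun ζ : ℂ => ζ • v) ⁻¹' ball 0 ρ := fun ζ hζ => by
    simp only [abs_one, mem_closedBall, dist_zero_right] at hζ
    simp only [mem_preimage, mem_ball, dist_zero_right, norm_smul]
    exact (mul_le_of_le_one_left (norm_nonneg _) hζ).trans_lt hv'
  have := (hd.diffContOnCl_ball hcl).circleAverage
  rw [Real.circleAverage_def, intervalIntegral.integral_of_le Real.two_pi_pos.le] at this
  simp only [zero_smul] at this
  have h2 : (2 * Real.pi : ℂ) ≠ 0 := by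
    have := Real.pi_ne_zero
    exact_mod_cast mul_ne_zero two_ne_zero this
  rw [← this]
  simp only [Complex.real_smul]
  push_cast
  rw [mul_inv_cancel_left₀ h2]

/-- Rotation invariance lets the integral be averaged over v ↦ e^{iθ}v. After Fubini the average
acts on φ alone, where the mean value property on the complex line through v yields φ(0). -/
theorem setIntegral_mul_radial {E : Type*} [NormedAddCommGroup E] [NormedSpace ℂ E]
    [MeasurableSpace E] [BorelSpace E] [SecondCountableTopology E] (μ : Measure E) [SFinite μ]
    (hμ : ∀ a : ℂ, ‖a‖ = 1 → MeasurePreserving (fun v : E => a • v) μ μ)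
    {φ : E → ℂ} {ρ : ℝ} (hφ : DifferentiableOn ℂ φ (ball 0 ρ)) {ω : E → ℂ} (hω : Measurable ω)
    (hrad : ∀ a : ℂ, ‖a‖ = 1 → ∀ v, ω (a • v) = ω v)
    (hint : IntegrableOn (fun v => φ v * ω v) (ball 0 ρ) μ) :
    ∫ v in ball 0 ρ, φ v * ω v ∂μ = φ 0 * ∫ v in ball 0 ρ, ω v ∂μ := by
  classical
  set Φ : E → ℂ := (ball 0 ρ).indicator fun v => φ v * ω v with hΦ
  have hΦint : Integrable Φ μ := (integrable_indicator_iff measurableSet_ball).2 hint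
  have hΦmeas : Measurable Φ := by
    have h1 : Measurable ((ball (0 : E) ρ).indicator φ) := by
      have := hφ.continuousOn.measurable_piecewise (g := fun _ => (0 : ℂ)) continuousOn_const
        measurableSet_ball
      rwa [← piecewise_eq_indicator]
    have : Φ = fun v => (ball (0 : E) ρ).indicator φ v * ω v := by
      ext v; simp only [hΦ, indicator]; split_ifs <;> simp
    rw [this]; exact h1.mul hω
  have hcirc : ∀ θ : ℝ, ‖circleMap 0 1 θ‖ = 1 := fun θ => by simp
  have hrot : ∀ θ : ℝ, ∫ v, Φ (circleMap 0 1 θ • v) ∂μ = ∫ v, Φ v ∂μ := fun θ => by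
    have h := hμ _ (hcirc θ)
    conv_rhs => rw [← h.map_eq]
    rw [integral_map h.measurable.aemeasurable hΦmeas.aestronglyMeasurable]
  have hrot' : ∀ θ : ℝ, ∫ v, ‖Φ (circleMap 0 1 θ • v)‖ ∂μ = ∫ v, ‖Φ v‖ ∂μ := fun θ => by
    have h := hμ _ (hcirc θ)
    conv_rhs => rw [← h.map_eq]
    rw [integral_map h.measurable.aemeasurable hΦmeas.norm.aestronglyMeasurable]
  have hjoint : Integrable (fun q : ℝ × E => Φ (circleMap 0 1 q.1 • q.2))
      ((volume.restrict (Ioc 0 (2 * Real.pi))).prod μ) := by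
    have hm : Measurable fun q : ℝ × E => Φ (circleMap 0 1 q.1 • q.2) :=
      hΦmeas.comp (((continuous_circleMap 0 1).comp continuous_fst).smul continuous_snd).measurable
    refine (integrable_prod_iff hm.aestronglyMeasurable).2 ⟨.of_forall fun θ => ?_, ?_⟩
    · exact (hμ _ (hcirc θ)).integrable_comp_of_integrable hΦint
    · simp only [hrot']
      exact integrable_const _
  have hswap := integral_integral_swap (f := fun (θ : ℝ) (v : E) => Φ (circleMap 0 1 θ • v)) hjoint
  simp only [hrot, integral_const] at hswap
  have hinner : ∀ v, ∫ θ in Ioc 0 (2 * Real.pi), Φ (circleMap 0 1 θ • v)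
      = (ball (0 : E) ρ).indicator (fun v => 2 * Real.pi * (φ 0 * ω v)) v := fun v => by
    have hmem : ∀ θ : ℝ, circleMap 0 1 θ • v ∈ ball (0 : E) ρ ↔ v ∈ ball (0 : E) ρ := fun θ => by
      simp [norm_smul]
    by_cases hv : v ∈ ball (0 : E) ρ
    · simp only [hΦ, indicator, hmem, hv, if_true, hrad _ (hcirc _)]
      rw [integral_mul_const, integral_comp_smul_circleMap hφ hv]
      ring
    · simp only [hΦ, indicator, hmem, hv, if_false, integral_zero]
  simp only [hinner] at hswap
  rw [hΦ, integral_indicator measurableSet_ball, integral_indicator measurableSet_ball,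
    integral_const_mul, integral_const_mul] at hswap
  simp only [measureReal_restrict_apply_univ, Real.volume_real_Ioc, sub_zero,
    max_eq_left Real.two_pi_pos.le, Complex.real_smul] at hswap
  have h2 : (2 * Real.pi : ℂ) ≠ 0 := by
    have := Real.pi_ne_zero
    exact_mod_cast mul_ne_zero two_ne_zero this
  push_cast at hswap
  exact mul_left_cancel₀ h2 hswap

theorem measurePreserving_linearIsometryEquiv {V W : Type*} [NormedAddCommGroup V]
    [InnerProductSpace ℝ V] [NormedSpace ℂ V] [IsScalarTower ℝ ℂ V] [MeasurableSpace V]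
    [BorelSpace V] [FiniteDimensional ℝ V] [NormedAddCommGroup W] [InnerProductSpace ℝ W]
    [NormedSpace ℂ W] [IsScalarTower ℝ ℂ W] [MeasurableSpace W] [BorelSpace W]
    [FiniteDimensional ℝ W] (e : V ≃ₗᵢ[ℂ] W) : MeasurePreserving e volume volume :=
  LinearIsometryEquiv.measurePreserving
    ({ e.toLinearEquiv.restrictScalars ℝ with norm_map' := e.norm_map } : V ≃ₗᵢ[ℝ] W)

theorem measurePreserving_smul {V : Type*} [NormedAddCommGroup V]
    [InnerProductSpace ℝ V] [NormedSpace ℂ V] [IsScalarTower ℝ ℂ V] [MeasurableSpace V]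
    [BorelSpace V] [FiniteDimensional ℝ V] (a : ℂ) (ha : ‖a‖ = 1) :
    MeasurePreserving (fun v : V => a • v) volume volume :=
  measurePreserving_linearIsometryEquiv
    { LinearEquiv.smulOfNeZero ℂ V a (norm_ne_zero_iff.1 (by simp [ha])) with
      norm_map' := fun v => by
        change ‖a • v‖ = ‖v‖
        rw [norm_smul, ha, one_mul] }

/-! ### Slicing the ball -/

/-- Extend each unit vector to an orthonormal basis and match the bases. -/
theorem exists_linearIsometryEquiv_map_eq {m : ℕ} {V W : Type*} [NormedAddCommGroup V]
    [InnerProductSpace ℂ V] [FiniteDimensional ℂ V] [NormedAddCommGroup W] [InnerProductSpace ℂ W]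
    [FiniteDimensional ℂ W] (hV : Module.finrank ℂ V = m + 1) (hW : Module.finrank ℂ W = m + 1)
    {x : V} {y : W} (hx : ‖x‖ = 1) (hy : ‖y‖ = 1) : ∃ S : V ≃ₗᵢ[ℂ] W, S x = y := by
  have aux : ∃ b : OrthonormalBasis (Fin (m + 1)) ℂ V, b 0 = x := by
    obtain ⟨b, hb⟩ := Orthonormal.exists_orthonormalBasis_extension_of_card_eq (𝕜 := ℂ) (E := V)
      (ι := Fin (m + 1)) (by simpa using hV) (v := fun _ => x) (s := {0}) (by
        refine ⟨fun i => by simpa [Set.domRestrict] using hx, fun i j hij => ?_⟩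
        exact absurd (Subsingleton.elim i j) hij)
    exact ⟨b, hb 0 rfl⟩
  have aux' : ∃ b : OrthonormalBasis (Fin (m + 1)) ℂ W, b 0 = y := by
    obtain ⟨b, hb⟩ := Orthonormal.exists_orthonormalBasis_extension_of_card_eq (𝕜 := ℂ) (E := W)
      (ι := Fin (m + 1)) (by simpa using hW) (v := fun _ => y) (s := {0}) (by
        refine ⟨fun i => by simpa [Set.domRestrict] using hy, fun i j hij => ?_⟩
        exact absurd (Subsingleton.elim i j) hij)
    exact ⟨b, hb 0 rfl⟩
  obtain ⟨b, rfl⟩ := aux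
  obtain ⟨b', rfl⟩ := aux'
  exact ⟨b.repr.trans b'.repr.symm, by simp⟩

/-- Unitary coordinates with first axis along z: the kernel at z depends only on the first
coordinate u, and the other m coordinates can be integrated out. -/
theorem exists_slice {m : ℕ} (z : Cn (m + 1)) : ∃ T : (ℂ × Cn m) ≃L[ℂ] Cn (m + 1),
    MeasurePreserving T volume volume ∧ (∀ u v, ‖T (u, v)‖ ^ 2 = ‖u‖ ^ 2 + ‖v‖ ^ 2) ∧
    (∀ u v, pairing z (T (u, v)) = ‖z‖ * starRingEnd ℂ u) ∧ T (‖z‖, 0) = z := by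
  have hfr : Module.finrank ℂ (WithLp 2 (ℂ × Cn m)) = m + 1 := by
    rw [(WithLp.linearEquiv 2 ℂ (ℂ × Cn m)).finrank_eq]
    simp [add_comm]
  have hone : ‖(WithLp.toLp 2 ((1 : ℂ), (0 : Cn m)))‖ = 1 := by simp
  obtain ⟨S, hS⟩ : ∃ S : WithLp 2 (ℂ × Cn m) ≃ₗᵢ[ℂ] Cn (m + 1),
      S (WithLp.toLp 2 ((‖z‖ : ℂ), (0 : Cn m))) = z := by
    have hsm : WithLp.toLp 2 ((‖z‖ : ℂ), (0 : Cn m))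
        = (‖z‖ : ℂ) • WithLp.toLp 2 ((1 : ℂ), (0 : Cn m)) := by
      rw [← WithLp.toLp_smul]; simp
    -- For z = 0 any unitary map serves.
    by_cases hz : z = 0
    · obtain ⟨S, -⟩ := exists_linearIsometryEquiv_map_eq (m := m) hfr (W := Cn (m + 1)) (by simp)
        hone (y := EuclideanSpace.single 0 1) (by simp)
      exact ⟨S, by rw [hsm]; simp [hz]⟩
    · obtain ⟨S, hS⟩ := exists_linearIsometryEquiv_map_eq (m := m) hfr (W := Cn (m + 1)) (by simp)
        hone (y := (‖z‖⁻¹ : ℂ) • z) (by simp [norm_smul, hz])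
      refine ⟨S, ?_⟩
      rw [hsm, map_smul, hS, smul_inv_smul₀ (by simpa using hz)]
  refine ⟨(WithLp.prodContinuousLinearEquiv 2 ℂ ℂ (Cn m)).symm.trans S.toContinuousLinearEquiv,
    ?_, fun u v => ?_, fun u v => ?_, ?_⟩
  · exact (measurePreserving_linearIsometryEquiv S).comp (WithLp.volume_preserving_toLp ℂ (Cn m))
  · change ‖S (WithLp.toLp 2 (u, v))‖ ^ 2 = _
    rw [S.norm_map, WithLp.prod_norm_sq_eq_of_L2]; rfl
  · change pairing z (S (WithLp.toLp 2 (u, v))) = _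
    rw [pairing_eq_inner]
    conv_lhs => rw [← hS]
    rw [S.inner_map_map]
    simp [WithLp.prod_inner_apply]
  · exact hS

end

section

/-! ### Iterated integrals over the ball in slice coordinates. -/

theorem measurable_psi {E : Type*} [NormedAddCommGroup E] [MeasurableSpace E] [BorelSpace E] :
    Measurable (psi : E → ℝ) :=
  measurable_const.sub (measurable_norm.pow_const 2)

/-- The fibre over u is a ball of squared radius d = 1 - |u|². Rescaling it to the unit ball of real
dimension 2m gives d^m from the volume and d^t from the weight, so fibre integration raises the
weight exponent by m. -/
theorem lintegral_ball_sub_norm_sq_rpow (m : ℕ) (t : ℝ) {d : ℝ} (hd : 0 < d) :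
    ∫⁻ v in ball (0 : Cn m) (√d), ENNReal.ofReal ((d - ‖v‖ ^ 2) ^ t)
      = ENNReal.ofReal (d ^ (m + t)) * ∫⁻ v in unitBall m, ENNReal.ofReal (psi v ^ t) := by
  have hR : 0 < √d := Real.sqrt_pos.2 hd
  set f : Cn m → ℝ≥0∞ :=
    (ball (0 : Cn m) (√d)).indicator fun v => ENNReal.ofReal ((d - ‖v‖ ^ 2) ^ t) with hf
  have hfm : Measurable f :=
    (((measurable_const.sub (measurable_norm.pow_const 2)).pow_const t).ennreal_ofReal).indicator
      measurableSet_ball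
  have hmap := Measure.map_addHaar_smul (volume : Measure (Cn m)) hR.ne'
  have h1 : ∫⁻ v, f (√d • v) = ENNReal.ofReal |((√d) ^ Module.finrank ℝ (Cn m))⁻¹| * ∫⁻ v, f v := by
    rw [← lintegral_map hfm (measurable_const_smul _), hmap, lintegral_smul_measure, smul_eq_mul]
  have hfr : Module.finrank ℝ (Cn m) = 2 * m := by
    rw [finrank_real_of_complex]; simp
  have h2 : ∀ v : Cn m, f (√d • v)
      = (unitBall m).indicator (fun v => ENNReal.ofReal (d ^ t) * ENNReal.ofReal (psi v ^ t)) v := by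
    intro v
    have hmem : √d • v ∈ ball (0 : Cn m) (√d) ↔ v ∈ unitBall m := by
      rw [mem_unitBall, mem_ball_zero_iff, norm_smul, Real.norm_of_nonneg hR.le]
      exact mul_lt_iff_lt_one_right hR
    by_cases hv : v ∈ unitBall m
    · rw [indicator_of_mem hv, hf, indicator_of_mem (hmem.2 hv)]
      have hp := psi_pos (mem_unitBall.1 hv)
      rw [← ENNReal.ofReal_mul (by positivity), ← Real.mul_rpow hd.le hp.le, norm_smul, mul_pow,
        Real.norm_of_nonneg hR.le, Real.sq_sqrt hd.le]
      congr 2; simp only [psi]; ring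
    · rw [indicator_of_notMem hv, hf, indicator_of_notMem (fun h => hv (hmem.1 h))]
  simp only [h2] at h1
  rw [lintegral_indicator measurableSet_unitBall, lintegral_const_mul _
    (measurable_psi.pow_const t).ennreal_ofReal, hf, lintegral_indicator measurableSet_ball, hfr,
    pow_mul, Real.sq_sqrt hd.le, abs_of_pos (by positivity)] at h1
  have h3 : ENNReal.ofReal (d ^ (m + t))
      = ENNReal.ofReal (d ^ m) * ENNReal.ofReal (d ^ t) := by
    rw [← ENNReal.ofReal_mul (by positivity), Real.rpow_add hd, Real.rpow_natCast]
  rw [h3, mul_assoc, h1, ← mul_assoc, ← ENNReal.ofReal_mul (by positivity),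
    mul_inv_cancel₀ (by positivity), ENNReal.ofReal_one, one_mul]

theorem integral_ball_sub_norm_sq_cpow (m : ℕ) (β : ℂ) {d : ℝ} (hd : 0 < d) :
    ∫ v in ball (0 : Cn m) (√d), ((d - ‖v‖ ^ 2 : ℝ) : ℂ) ^ β
      = (d : ℂ) ^ (m + β) * ∫ v in unitBall m, (psi v : ℂ) ^ β := by
  have hR : 0 < √d := Real.sqrt_pos.2 hd
  have hfr : Module.finrank ℝ (Cn m) = 2 * m := by
    rw [finrank_real_of_complex]; simp
  have h := Measure.setIntegral_comp_smul_of_pos (volume : Measure (Cn m))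
    (fun v : Cn m => ((d - ‖v‖ ^ 2 : ℝ) : ℂ) ^ β) (unitBall m) hR
  have hball : √d • unitBall m = ball (0 : Cn m) (√d) := by
    exact smul_unitBall_of_pos hR
  have h2 : ∫ v in unitBall m, ((d - ‖√d • v‖ ^ 2 : ℝ) : ℂ) ^ β
      = (d : ℂ) ^ β * ∫ v in unitBall m, (psi v : ℂ) ^ β := by
    rw [← integral_const_mul]
    refine setIntegral_congr_fun measurableSet_unitBall fun v hv => ?_
    have hp := psi_pos (mem_unitBall.1 hv)
    rw [← Complex.mul_cpow_ofReal_nonneg hd.le hp.le, norm_smul, mul_pow,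
        Real.norm_of_nonneg hR.le, Real.sq_sqrt hd.le, ← Complex.ofReal_mul]
    congr 2; simp only [psi]; ring
  rw [h2, hball, hfr, pow_mul, Real.sq_sqrt hd.le, Complex.real_smul] at h
  have hd' : (d : ℂ) ≠ 0 := by exact_mod_cast hd.ne'
  rw [Complex.cpow_add _ _ hd', Complex.cpow_natCast, mul_assoc, h, ← mul_assoc]
  push_cast
  rw [mul_inv_cancel₀ (pow_ne_zero _ hd'), one_mul]

section Slice

variable {m : ℕ} {T : (ℂ × Cn m) ≃L[ℂ] Cn (m + 1)}

theorem slice_mem_iff (hT : ∀ u v, ‖T (u, v)‖ ^ 2 = ‖u‖ ^ 2 + ‖v‖ ^ 2) (u : ℂ) (v : Cn m) :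
    T (u, v) ∈ unitBall (m + 1) ↔ u ∈ ball (0 : ℂ) 1 ∧ v ∈ ball (0 : Cn m) (√(psi u)) := by
  have h1 : T (u, v) ∈ unitBall (m + 1) ↔ ‖u‖ ^ 2 + ‖v‖ ^ 2 < 1 := by
    rw [← hT, mem_unitBall, sq_lt_one_iff₀ (norm_nonneg _)]
  have h2 : v ∈ ball (0 : Cn m) (√(psi u)) ↔ ‖v‖ ^ 2 < 1 - ‖u‖ ^ 2 := by
    rw [mem_ball_zero_iff, Real.lt_sqrt (norm_nonneg _)]
  rw [h1, h2, mem_ball_zero_iff, ← sq_lt_one_iff₀ (norm_nonneg _)]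
  constructor
  · intro h
    exact ⟨by nlinarith [sq_nonneg ‖v‖], by linarith⟩
  · rintro ⟨-, h⟩; linarith

theorem slice_indicator {F : Type*} [Zero F] (hT : ∀ u v, ‖T (u, v)‖ ^ 2 = ‖u‖ ^ 2 + ‖v‖ ^ 2)
    (Φ : Cn (m + 1) → F) (u : ℂ) (v : Cn m) :
    (unitBall (m + 1)).indicator Φ (T (u, v)) = (ball (0 : ℂ) 1).indicator
      (fun u => (ball (0 : Cn m) (√(psi u))).indicator (fun v => Φ (T (u, v))) v) u := by
  classical
  simp only [indicator, slice_mem_iff hT]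
  split_ifs <;> simp_all

theorem lintegral_slice (hT : ∀ u v, ‖T (u, v)‖ ^ 2 = ‖u‖ ^ 2 + ‖v‖ ^ 2)
    (hmp : MeasurePreserving T volume volume) {Φ : Cn (m + 1) → ℝ≥0∞} (hΦ : Measurable Φ) :
    ∫⁻ w in unitBall (m + 1), Φ w
      = ∫⁻ u in ball (0 : ℂ) 1, ∫⁻ v in ball (0 : Cn m) (√(psi u)), Φ (T (u, v)) := by
  have hm : Measurable ((unitBall (m + 1)).indicator Φ) := hΦ.indicator measurableSet_unitBall
  rw [← lintegral_indicator measurableSet_unitBall, ← hmp.lintegral_comp hm,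
    Measure.volume_eq_prod, lintegral_prod (fun q => (unitBall (m + 1)).indicator Φ (T q))
      (hm.comp hmp.measurable).aemeasurable,
    ← lintegral_indicator measurableSet_ball]
  refine lintegral_congr fun u => ?_
  simp only [slice_indicator hT]
  by_cases hu : u ∈ ball (0 : ℂ) 1
  · simp only [indicator_of_mem hu]
    rw [lintegral_indicator measurableSet_ball]
  · simp only [indicator_of_notMem hu, lintegral_zero]

theorem integral_slice (hT : ∀ u v, ‖T (u, v)‖ ^ 2 = ‖u‖ ^ 2 + ‖v‖ ^ 2)
    (hmp : MeasurePreserving T volume volume) {Φ : Cn (m + 1) → ℂ}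
    (hΦ : IntegrableOn Φ (unitBall (m + 1))) :
    (∀ᵐ u ∂(volume.restrict (ball (0 : ℂ) 1)),
      IntegrableOn (fun v => Φ (T (u, v))) (ball (0 : Cn m) (√(psi u)))) ∧
    IntegrableOn (fun u => ∫ v in ball (0 : Cn m) (√(psi u)), Φ (T (u, v))) (ball (0 : ℂ) 1) ∧
    ∫ w in unitBall (m + 1), Φ w
      = ∫ u in ball (0 : ℂ) 1, ∫ v in ball (0 : Cn m) (√(psi u)), Φ (T (u, v)) := by
  have hi : Integrable ((unitBall (m + 1)).indicator Φ) :=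
    (integrable_indicator_iff measurableSet_unitBall).2 hΦ
  have hemb : MeasurableEmbedding T := T.toHomeomorph.measurableEmbedding
  have hi' : Integrable (fun q : ℂ × Cn m => (unitBall (m + 1)).indicator Φ (T q))
      ((volume : Measure ℂ).prod volume) := by
    rw [← Measure.volume_eq_prod]; exact (hmp.integrable_comp_emb hemb).2 hi
  have hval : ∀ u, ∫ v, (unitBall (m + 1)).indicator Φ (T (u, v)) = (ball (0 : ℂ) 1).indicator
      (fun u => ∫ v in ball (0 : Cn m) (√(psi u)), Φ (T (u, v))) u := fun u => by
    simp only [slice_indicator hT]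
    by_cases hu : u ∈ ball (0 : ℂ) 1
    · simp only [indicator_of_mem hu]
      rw [integral_indicator measurableSet_ball]
    · simp only [indicator_of_notMem hu, integral_zero]
  refine ⟨?_, ?_, ?_⟩
  · rw [ae_restrict_iff' measurableSet_ball]
    filter_upwards [hi'.prod_right_ae] with u hu hmem
    simp only [slice_indicator hT, indicator_of_mem hmem] at hu
    exact (integrable_indicator_iff measurableSet_ball).1 hu
  · have := hi'.integral_prod_left
    simp only [hval] at this
    exact (integrable_indicator_iff measurableSet_ball).1 this
  · rw [← integral_indicator measurableSet_unitBall, ← hmp.integral_comp hemb,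
      Measure.volume_eq_prod, integral_prod _ hi', ← integral_indicator measurableSet_ball]
    simp only [hval]

theorem psi_slice (hT : ∀ u v, ‖T (u, v)‖ ^ 2 = ‖u‖ ^ 2 + ‖v‖ ^ 2) (u : ℂ) (v : Cn m) :
    psi (T (u, v)) = psi u - ‖v‖ ^ 2 := by
  simp only [psi, hT]; ring

end Slice

/-- Integrating a function of one complex coordinate over the ball reduces to the disc. -/
theorem lintegral_psi_mul_comp_pairing {m : ℕ} (t : ℝ) (z : Cn (m + 1)) {F : ℂ → ℝ≥0∞}
    (hF : Measurable F) :
    ∫⁻ w in unitBall (m + 1), ENNReal.ofReal (psi w ^ t) * F (pairing z w)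
      = (∫⁻ v in unitBall m, ENNReal.ofReal (psi v ^ t)) *
        ∫⁻ u in ball (0 : ℂ) 1, ENNReal.ofReal (psi u ^ (m + t)) * F (‖z‖ * starRingEnd ℂ u) := by
  obtain ⟨T, hmp, hT, hpair, -⟩ := exists_slice z
  have hFm : Measurable fun u : ℂ => F (‖z‖ * starRingEnd ℂ u) :=
    hF.comp (measurable_const.mul Complex.continuous_conj.measurable)
  have hΦ : Measurable fun w => ENNReal.ofReal (psi w ^ t) * F (pairing z w) :=
    (measurable_psi.pow_const t).ennreal_ofReal.mul
      (hF.comp (continuous_pairing_right z).measurable)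
  have hΨ : Measurable fun u : ℂ =>
      ENNReal.ofReal (psi u ^ (m + t)) * F (‖z‖ * starRingEnd ℂ u) :=
    (measurable_psi.pow_const _).ennreal_ofReal.mul hFm
  rw [lintegral_slice hT hmp hΦ, ← lintegral_const_mul _ hΨ]
  refine setLIntegral_congr_fun measurableSet_ball fun u hu => ?_
  have hu' : 0 < psi u := psi_pos (by simpa using hu)
  simp only [psi_slice hT, hpair]
  have hω : Measurable fun v : Cn m => ENNReal.ofReal ((psi u - ‖v‖ ^ 2) ^ t) :=
    ((measurable_const.sub (measurable_norm.pow_const 2)).pow_const t).ennreal_ofReal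
  rw [lintegral_mul_const _ hω,
    lintegral_ball_sub_norm_sq_rpow m t hu']
  ring

/-! ### Integrals over the disc -/

theorem integrableOn_rpow_one_sub_sq {t : ℝ} (ht : -1 < t) :
    IntegrableOn (fun y : ℝ => y * (1 - y ^ 2) ^ t) (Ioc 0 1) := by
  have ht1 : 0 < t + 1 := by linarith
  refine intervalIntegral.integrableOn_deriv_of_nonneg
    (g := fun y : ℝ => -((1 - y ^ 2) ^ (t + 1)) / (2 * (t + 1))) ?_ ?_ ?_
  · have : Continuous fun y : ℝ => (1 - y ^ 2) ^ (t + 1) :=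
      (continuous_const.sub (continuous_pow 2)).rpow_const fun _ => Or.inr ht1.le
    exact (this.neg.div_const _).continuousOn
  · intro y hy
    have hpos : 0 < 1 - y ^ 2 := by nlinarith [hy.1, hy.2]
    have h1 : HasDerivAt (fun y : ℝ => 1 - y ^ 2) (-(2 * y)) y := by
      simpa using (hasDerivAt_pow 2 y).const_sub 1
    have h2 := ((h1.rpow_const (p := t + 1) (Or.inl hpos.ne')).neg).div_const (2 * (t + 1))
    refine h2.congr_deriv ?_
    rw [show t + 1 - 1 = t by ring]
    field_simp
  · intro y hy
    have hpos : 0 < 1 - y ^ 2 := by nlinarith [hy.1, hy.2]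
    have := hy.1
    positivity

theorem integrableOn_ball_fun_norm_iff {E F : Type*} [NormedAddCommGroup E] [NormedSpace ℝ E]
    [FiniteDimensional ℝ E] [Nontrivial E] [MeasurableSpace E] [BorelSpace E] (μ : Measure E)
    [μ.IsAddHaarMeasure] [NormedAddCommGroup F] [NormedSpace ℝ F] (f : ℝ → F) :
    IntegrableOn (fun u : E => f ‖u‖) (ball 0 1) μ ↔
      IntegrableOn (fun y : ℝ => y ^ (Module.finrank ℝ E - 1) • f y) (Ioo 0 1) := by
  have h1 : (fun u : E => ((Iio 1).indicator f) ‖u‖) = (ball (0 : E) 1).indicator fun u => f ‖u‖ := by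
    classical
    ext u; simp [indicator]
  have h2 : (fun y : ℝ => y ^ (Module.finrank ℝ E - 1) • (Iio 1).indicator f y)
      = (Iio 1).indicator fun y => y ^ (Module.finrank ℝ E - 1) • f y := by
    classical
    ext u; simp only [indicator]; split_ifs <;> simp
  have := integrable_fun_norm_addHaar μ (f := (Iio 1).indicator f)
  rw [h1, integrable_indicator_iff measurableSet_ball] at this
  rw [this, h2]
  rw [IntegrableOn, integrable_indicator_iff measurableSet_Iio, IntegrableOn,
    Measure.restrict_restrict measurableSet_Iio, inter_comm, Ioi_inter_Iio, IntegrableOn]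

theorem integrableOn_disc_iff {F : Type*} [NormedAddCommGroup F] [NormedSpace ℝ F] (f : ℝ → F) :
    IntegrableOn (fun u : ℂ => f ‖u‖) (ball 0 1) ↔
      IntegrableOn (fun y : ℝ => y • f y) (Ioo 0 1) := by
  simpa using integrableOn_ball_fun_norm_iff (volume : Measure ℂ) f

theorem integrableOn_disc_psi_rpow {t : ℝ} (ht : -1 < t) :
    IntegrableOn (fun u : ℂ => psi u ^ t) (ball 0 1) :=
  (integrableOn_disc_iff fun y : ℝ => (1 - y ^ 2) ^ t).2
    ((integrableOn_rpow_one_sub_sq ht).mono_set Ioo_subset_Ioc_self)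

/-- In polar coordinates the integrand y(1 - y²)^β has antiderivative -(1 - y²)^{β+1}/(2(β + 1)),
which vanishes at y = 1 because Re β > -1. -/
theorem integral_disc_psi_cpow {β : ℂ} (hβ : -1 < β.re) :
    ∫ u in ball (0 : ℂ) 1, (psi u : ℂ) ^ β = Real.pi / (β + 1) := by
  have hβ1 : 0 < (β + 1).re := by simp; linarith
  have hβ0 : β + 1 ≠ 0 := fun h => by simp [h] at hβ1
  have h1 : (fun u : ℂ => ((Iio 1).indicator fun y : ℝ => ((1 - y ^ 2 : ℝ) : ℂ) ^ β) ‖u‖)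
      = (ball (0 : ℂ) 1).indicator fun u => (psi u : ℂ) ^ β := by
    classical
    ext u; simp [indicator]
  have h2 : (fun y : ℝ => y • (Iio 1).indicator (fun y : ℝ => ((1 - y ^ 2 : ℝ) : ℂ) ^ β) y)
      = (Iio 1).indicator fun y : ℝ => y • ((1 - y ^ 2 : ℝ) : ℂ) ^ β := by
    classical
    ext u; simp only [indicator]; split_ifs <;> simp
  have h := integral_fun_norm_addHaar (volume : Measure ℂ)
    ((Iio 1).indicator fun y : ℝ => ((1 - y ^ 2 : ℝ) : ℂ) ^ β)
  rw [h1, integral_indicator measurableSet_ball] at h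
  rw [h]
  simp only [Complex.finrank_real_complex, Nat.add_one_sub_one, pow_one, h2]
  rw [integral_indicator measurableSet_Iio, Measure.restrict_restrict measurableSet_Iio, inter_comm,
    Ioi_inter_Iio, ← integral_Ioc_eq_integral_Ioo, ← intervalIntegral.integral_of_le zero_le_one]
  have hint : IntervalIntegrable (fun y : ℝ => y • ((1 - y ^ 2 : ℝ) : ℂ) ^ β) volume 0 1 := by
    rw [intervalIntegrable_iff_integrableOn_Ioo_of_le zero_le_one]
    have := (integrableOn_rpow_one_sub_sq hβ).mono_set Ioo_subset_Ioc_self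
    refine Integrable.mono' this ?_ ?_
    · refine Measurable.aestronglyMeasurable ?_
      exact measurable_id.smul ((Complex.measurable_ofReal.comp
        (measurable_const.sub (measurable_id.pow_const 2))).pow_const _)
    · refine (ae_restrict_iff' measurableSet_Ioo).2 (.of_forall fun y hy => ?_)
      have hpos : 0 < 1 - y ^ 2 := by nlinarith [hy.1, hy.2]
      rw [norm_smul, Real.norm_of_nonneg hy.1.le, Complex.norm_cpow_eq_rpow_re_of_pos hpos]
  rw [intervalIntegral.integral_eq_sub_of_hasDerivAt_of_le zero_le_one
    (f := fun y : ℝ => -(((1 - y ^ 2 : ℝ) : ℂ) ^ (β + 1)) / (2 * (β + 1))) ?_ ?_ hint]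
  · have hv : (volume : Measure ℂ).real (ball 0 1) = Real.pi := by
      simp [measureReal_def, Complex.volume_ball]
    rw [hv]
    simp [Complex.zero_cpow hβ0]
    field_simp
  · refine ContinuousOn.div_const (ContinuousOn.neg ?_) _
    have hc : Continuous fun y : ℝ => (1 - y ^ 2) := by fun_prop
    exact ((Complex.continuous_ofReal_cpow_const hβ1).comp hc).continuousOn
  · intro y hy
    have hpos : 0 < 1 - y ^ 2 := by nlinarith [hy.1, hy.2]
    have h1 : HasDerivAt (fun y : ℝ => ((1 - y ^ 2 : ℝ) : ℂ)) (-(2 * y)) y := by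
      have := ((hasDerivAt_pow 2 y).const_sub 1).ofReal_comp
      simpa using this
    have hs : ((1 - y ^ 2 : ℝ) : ℂ) ∈ Complex.slitPlane := Complex.ofReal_mem_slitPlane.2 hpos
    have h3 := (((Complex.hasStrictDerivAt_cpow_const (c := β + 1) hs).hasDerivAt.comp y h1).neg).div_const
      (2 * (β + 1))
    refine h3.congr_deriv ?_
    rw [show β + 1 - 1 = β by ring, Complex.real_smul]
    field_simp

theorem lintegral_disc_psi_rpow_lt_top {t : ℝ} (ht : -1 < t) :
    ∫⁻ u in ball (0 : ℂ) 1, ENNReal.ofReal (psi u ^ t) < ∞ := by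
  have := (integrableOn_disc_psi_rpow ht).2
  refine lt_of_le_of_lt (lintegral_mono fun u => ?_) this
  rw [← ofReal_norm]
  exact ENNReal.ofReal_le_ofReal (Real.le_norm_self _)

theorem lintegral_psi_rpow_lt_top (n : ℕ) {t : ℝ} (ht : -1 < t) :
    ∫⁻ v in unitBall n, ENNReal.ofReal (psi v ^ t) < ∞ := by
  induction n with
  | zero =>
    have : ∀ v : Cn 0, psi v ^ t = 1 := fun v => by
      rw [Subsingleton.elim v 0]; simp [psi]
    simp only [this, ENNReal.ofReal_one, lintegral_one, Measure.restrict_apply_univ]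
    exact measure_ball_lt_top
  | succ m ih =>
    have := lintegral_psi_mul_comp_pairing (m := m) t 0 (F := fun _ => 1) measurable_const
    simp only [mul_one] at this
    rw [this]
    refine ENNReal.mul_lt_top ih (lintegral_disc_psi_rpow_lt_top ?_)
    have : (0 : ℝ) ≤ m := Nat.cast_nonneg m
    linarith

theorem integrableOn_psi_rpow (n : ℕ) {t : ℝ} (ht : -1 < t) :
    IntegrableOn (fun v : Cn n => psi v ^ t) (unitBall n) := by
  refine ⟨(measurable_psi.pow_const t).aestronglyMeasurable, ?_⟩
  refine lt_of_le_of_lt (le_of_eq ?_) (lintegral_psi_rpow_lt_top n ht)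
  refine setLIntegral_congr_fun measurableSet_unitBall fun v hv => ?_
  have := psi_pos (mem_unitBall.1 hv)
  rw [← ofReal_norm, Real.norm_of_nonneg (by positivity)]

end

section

/-! ### The reproducing formula on the disc -/

/-- The involution of the disc that exchanges `0` and `r`. -/
def moebius (r : ℝ) (v : ℂ) : ℂ := (r - v) / (1 - r * v)

section Moebius

variable {r : ℝ} {v : ℂ}

theorem one_sub_mul_re_pos (hr0 : 0 ≤ r) (hr1 : r < 1) (hv : ‖v‖ < 1) : 0 < (1 - r * v).re := by
  have h1 : |v.re| ≤ ‖v‖ := Complex.abs_re_le_norm v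
  have h2 := (abs_le.1 h1).2
  simp only [Complex.sub_re, Complex.one_re, Complex.mul_re, Complex.ofReal_re, Complex.ofReal_im,
    zero_mul, sub_zero]
  nlinarith

theorem one_sub_mul_ne_zero (hr0 : 0 ≤ r) (hr1 : r < 1) (hv : ‖v‖ < 1) : (1 - r * v : ℂ) ≠ 0 :=
  fun h => by simpa [h] using one_sub_mul_re_pos hr0 hr1 hv

theorem psi_moebius (hr0 : 0 ≤ r) (hr1 : r < 1) (hv : ‖v‖ < 1) :
    psi (moebius r v) = (1 - r ^ 2) * psi v / Complex.normSq (1 - r * v) := by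
  have h0 := one_sub_mul_ne_zero hr0 hr1 hv
  have h1 : Complex.normSq (1 - r * v) ≠ 0 := by simpa using h0
  simp only [psi, moebius]
  rw [← Complex.normSq_eq_norm_sq, ← Complex.normSq_eq_norm_sq, Complex.normSq_div]
  field_simp
  simp only [Complex.normSq_apply, Complex.sub_re, Complex.sub_im, Complex.mul_re, Complex.mul_im,
    Complex.ofReal_re, Complex.ofReal_im, Complex.one_re, Complex.one_im]
  ring

theorem norm_moebius_lt_one (hr0 : 0 ≤ r) (hr1 : r < 1) (hv : ‖v‖ < 1) : ‖moebius r v‖ < 1 := by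
  have h0 := one_sub_mul_ne_zero hr0 hr1 hv
  have h1 : 0 < Complex.normSq (1 - r * v) := by simpa [Complex.normSq_pos] using h0
  have h2 : 0 < psi (moebius r v) := by
    rw [psi_moebius hr0 hr1 hv]
    have := psi_pos hv
    have : 0 < 1 - r ^ 2 := by nlinarith
    positivity
  simp only [psi] at h2
  rw [← sq_lt_one_iff₀ (norm_nonneg _)]
  linarith

theorem one_sub_mul_moebius (hr0 : 0 ≤ r) (hr1 : r < 1) (hv : ‖v‖ < 1) :
    1 - r * moebius r v = (1 - r ^ 2) / (1 - r * v) := by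
  have h0 := one_sub_mul_ne_zero hr0 hr1 hv
  unfold moebius
  field_simp
  ring

theorem moebius_moebius (hr0 : 0 ≤ r) (hr1 : r < 1) (hv : ‖v‖ < 1) :
    moebius r (moebius r v) = v := by
  have h0 := one_sub_mul_ne_zero hr0 hr1 hv
  have h2 : (1 - r ^ 2 : ℂ) ≠ 0 := by
    have : (1 - r ^ 2 : ℝ) ≠ 0 := by nlinarith
    exact_mod_cast this
  rw [moebius, one_sub_mul_moebius hr0 hr1 hv, moebius]
  field_simp
  ring

theorem moebius_image (hr0 : 0 ≤ r) (hr1 : r < 1) :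
    moebius r '' ball (0 : ℂ) 1 = ball (0 : ℂ) 1 := by
  ext v
  constructor
  · rintro ⟨w, hw, rfl⟩
    rw [mem_ball_zero_iff] at hw ⊢
    exact norm_moebius_lt_one hr0 hr1 hw
  · intro hv
    rw [mem_ball_zero_iff] at hv
    exact ⟨moebius r v, by simpa using norm_moebius_lt_one hr0 hr1 hv, moebius_moebius hr0 hr1 hv⟩

theorem moebius_injOn (hr0 : 0 ≤ r) (hr1 : r < 1) : InjOn (moebius r) (ball (0 : ℂ) 1) := by
  intro v hv w hw h
  rw [mem_ball_zero_iff] at hv hw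
  rw [← moebius_moebius hr0 hr1 hv, h, moebius_moebius hr0 hr1 hw]

theorem hasDerivAt_moebius (hr0 : 0 ≤ r) (hr1 : r < 1) (hv : ‖v‖ < 1) :
    HasDerivAt (moebius r) (-(1 - r ^ 2) / (1 - r * v) ^ 2) v := by
  have h0 := one_sub_mul_ne_zero hr0 hr1 hv
  have h1 : HasDerivAt (fun v : ℂ => (r : ℂ) - v) (-1) v := (hasDerivAt_id v).const_sub _
  have h2 : HasDerivAt (fun v : ℂ => 1 - (r : ℂ) * v) (-r) v := by
    simpa using ((hasDerivAt_id v).const_mul (r : ℂ)).const_sub 1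
  refine (h1.div h2 h0).congr_deriv ?_
  congr 1
  ring

theorem det_restrictScalars_smulRight (a : ℂ) :
    |((ContinuousLinearMap.toSpanSingleton ℂ a).restrictScalars ℝ : ℂ →L[ℝ] ℂ).det|
      = Complex.normSq a := by
  have : (((ContinuousLinearMap.toSpanSingleton ℂ a).restrictScalars ℝ : ℂ →L[ℝ] ℂ) :
      ℂ →ₗ[ℝ] ℂ) = LinearMap.mul ℝ ℂ a := by
    ext x; simp [mul_comm]
  rw [ContinuousLinearMap.det, this]
  have h2 := Algebra.norm_apply (R := ℝ) (S := ℂ) a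
  rw [Algebra.norm_complex_apply] at h2
  have h3 : LinearMap.det (LinearMap.mul ℝ ℂ a) = Complex.normSq a := h2.symm
  rw [h3, abs_of_nonneg (Complex.normSq_nonneg _)]

/-- The Jacobian, the weight and the kernel combine so that the antiholomorphic factors cancel,
leaving something holomorphic times a radial weight. Since 1 - rv has positive real part, no branch
changes occur: each power is the exponential of a combination of logarithms, and the identity
becomes linear in those. -/
theorem moebius_weight (hr0 : 0 ≤ r) (hr1 : r < 1) (hv : ‖v‖ < 1) (s : ℂ) :
    (Complex.normSq (-(1 - r ^ 2) / (1 - r * v) ^ 2) : ℂ) * ((psi (moebius r v) : ℂ) ^ s *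
        (1 - r * starRingEnd ℂ (moebius r v)) ^ (-(2 + s)))
      = (1 - r * v) ^ (-(2 + s)) * (psi v : ℂ) ^ s := by
  have hre := one_sub_mul_re_pos hr0 hr1 hv
  have h0 := one_sub_mul_ne_zero hr0 hr1 hv
  have hψ := psi_pos hv
  have hR : 0 < 1 - r ^ 2 := by nlinarith
  set a : ℂ := 1 - r * v with ha
  have hconj : 1 - r * starRingEnd ℂ (moebius r v) = ((1 - r ^ 2 : ℝ) : ℂ) * (starRingEnd ℂ a)⁻¹ := by
    have := congrArg (starRingEnd ℂ) (one_sub_mul_moebius hr0 hr1 hv)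
    simp only [map_sub, map_one, map_mul, map_div₀, map_pow, Complex.conj_ofReal] at this
    rw [this, ha]; simp [div_eq_mul_inv]
  have harg : a.arg ≠ Real.pi := fun h => by
    have := (Complex.arg_eq_pi_iff.1 h).1; linarith
  have harg' : (starRingEnd ℂ a).arg ≠ Real.pi := fun h => by
    have := (Complex.arg_eq_pi_iff.1 h).1; simp at this; linarith
  have hca : starRingEnd ℂ a ≠ 0 := by simpa using h0
  have hns : 0 < Complex.normSq a := Complex.normSq_pos.2 h0
  set L := Complex.log a with hL
  set ρ : ℂ := (Real.log (1 - r ^ 2) : ℂ) with hρ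
  set l : ℂ := (Real.log (psi v) : ℂ) with hl
  have hLc : Complex.log (starRingEnd ℂ a) = starRingEnd ℂ L := by
    rw [Complex.log_conj _ harg]
  have hlogns : (Real.log (Complex.normSq a) : ℂ) = L + starRingEnd ℂ L := by
    rw [Complex.normSq_eq_norm_sq, Real.log_pow, Complex.add_conj, hL, Complex.log_re]
    push_cast; ring
  have e1 : ((psi (moebius r v) : ℝ) : ℂ) ^ s = Complex.exp ((ρ + l - (L + starRingEnd ℂ L)) * s) := by
    rw [psi_moebius hr0 hr1 hv, Complex.cpow_def_of_ne_zero
      (by exact_mod_cast (div_pos (mul_pos hR hψ) hns).ne'), ← Complex.ofReal_log (by positivity),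
      Real.log_div (by positivity) hns.ne', Real.log_mul hR.ne' hψ.ne', ← hlogns]
    push_cast; rfl
  have e2 : (1 - r * starRingEnd ℂ (moebius r v)) ^ (-(2 + s))
      = Complex.exp ((ρ - starRingEnd ℂ L) * (-(2 + s))) := by
    rw [hconj, Complex.cpow_def_of_ne_zero
      (mul_ne_zero (by exact_mod_cast hR.ne') (inv_ne_zero hca)),
      Complex.log_ofReal_mul hR (inv_ne_zero hca), Complex.log_inv _ harg', hLc, ← sub_eq_add_neg]
  have e3 : (Complex.normSq (-(1 - r ^ 2) / a ^ 2) : ℂ)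
      = Complex.exp (2 * ρ - 2 * (L + starRingEnd ℂ L)) := by
    have h4 : Complex.normSq (-(1 - r ^ 2) / a ^ 2) = Real.exp (2 * Real.log (1 - r ^ 2)
        - 2 * Real.log (Complex.normSq a)) := by
      rw [Real.exp_sub, mul_comm 2, mul_comm 2, Real.exp_mul, Real.exp_mul, Real.exp_log hR,
        Real.exp_log hns, Complex.normSq_div, map_pow, Complex.normSq_neg]
      have : (1 - (r : ℂ) ^ 2) = ((1 - r ^ 2 : ℝ) : ℂ) := by push_cast; rfl
      rw [this, Complex.normSq_ofReal]
      norm_cast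
      ring
    rw [h4]
    push_cast
    rw [hlogns]
  rw [e1, e2, e3, Complex.cpow_def_of_ne_zero h0, Complex.cpow_def_of_ne_zero
    (by exact_mod_cast hψ.ne'), ← Complex.ofReal_log hψ.le, ← Complex.exp_add, ← Complex.exp_add,
    ← Complex.exp_add]
  congr 1
  ring

end Moebius

/-- Substitute u = (r - v)/(1 - rv). The new integrand is holomorphic times (1 - |v|²)^s, so its
integral is the value at v = 0, which corresponds to u = r, times the mass of the weight. -/
theorem integral_disc_reproducing {r : ℝ} (hr0 : 0 ≤ r) (hr1 : r < 1) {s : ℂ} (hs : -1 < s.re)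
    {g : ℂ → ℂ} (hg : DifferentiableOn ℂ g (ball 0 1))
    (hint : IntegrableOn (fun u => g u * ((psi u : ℂ) ^ s * (1 - r * starRingEnd ℂ u) ^ (-(2 + s))))
      (ball 0 1)) :
    ∫ u in ball (0 : ℂ) 1, g u * ((psi u : ℂ) ^ s * (1 - r * starRingEnd ℂ u) ^ (-(2 + s)))
      = g r * (Real.pi / (s + 1)) := by
  set G : ℂ → ℂ := fun u => g u * ((psi u : ℂ) ^ s * (1 - r * starRingEnd ℂ u) ^ (-(2 + s))) with hG
  set f' : ℂ → ℂ →L[ℝ] ℂ := fun v =>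
    (ContinuousLinearMap.toSpanSingleton ℂ (-(1 - r ^ 2) / (1 - r * v) ^ 2)).restrictScalars ℝ
    with hf'
  have hd : ∀ v ∈ ball (0 : ℂ) 1, HasFDerivWithinAt (moebius r) (f' v) (ball 0 1) v := fun v hv =>
    ((hasDerivAt_moebius hr0 hr1 (by simpa using hv)).hasFDerivAt.restrictScalars
      ℝ).hasFDerivWithinAt
  have hcongr : ∀ v ∈ ball (0 : ℂ) 1, |(f' v).det| • G (moebius r v)
      = (g (moebius r v) * (1 - r * v) ^ (-(2 + s))) * (psi v : ℂ) ^ s := fun v hv => by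
    simp only [hf', hG]
    rw [det_restrictScalars_smulRight, Complex.real_smul, mul_assoc,
      ← moebius_weight hr0 hr1 (by simpa using hv) s]
    ring
  have hint' := hint
  rw [← moebius_image hr0 hr1, integrableOn_image_iff_integrableOn_abs_det_fderiv_smul volume
    measurableSet_ball hd (moebius_injOn hr0 hr1), integrableOn_congr_fun hcongr
    measurableSet_ball] at hint'
  have hval := integral_image_eq_integral_abs_det_fderiv_smul volume measurableSet_ball hd
    (moebius_injOn hr0 hr1) G
  rw [moebius_image hr0 hr1, setIntegral_congr_fun measurableSet_ball hcongr] at hval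
  rw [hval, setIntegral_mul_radial volume (fun a ha => measurePreserving_smul a ha) ?_ ?_ ?_ hint',
    integral_disc_psi_cpow hs]
  · simp [moebius]
  · have h1 : DifferentiableOn ℂ (moebius r) (ball 0 1) := fun v hv =>
      (hasDerivAt_moebius hr0 hr1 (by simpa using hv)).differentiableAt.differentiableWithinAt
    refine (hg.comp h1 fun v hv => ?_).mul ?_
    · rw [← moebius_image hr0 hr1]; exact ⟨v, hv, rfl⟩
    · refine DifferentiableOn.cpow_const (by fun_prop) fun v hv => Or.inl ?_
      exact one_sub_mul_re_pos hr0 hr1 (by simpa using hv)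
  · exact (Complex.measurable_ofReal.comp measurable_psi).pow_const s
  · intro a ha v
    simp only [psi, norm_smul, ha, one_mul]

/-! ### The reproducing formula on the ball -/

theorem measurable_psi_cpow {n : ℕ} (β : ℂ) : Measurable fun w : Cn n => (psi w : ℂ) ^ β :=
  (Complex.measurable_ofReal.comp measurable_psi).pow_const β

theorem norm_psi_cpow {n : ℕ} (β : ℂ) {w : Cn n} (hw : w ∈ unitBall n) :
    ‖(psi w : ℂ) ^ β‖ = psi w ^ β.re :=
  Complex.norm_cpow_eq_rpow_re_of_pos (psi_pos (mem_unitBall.1 hw)) β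

theorem integrableOn_psi_cpow (n : ℕ) {β : ℂ} (hβ : -1 < β.re) :
    IntegrableOn (fun w : Cn n => (psi w : ℂ) ^ β) (unitBall n) :=
  Integrable.mono' (integrableOn_psi_rpow n hβ) (measurable_psi_cpow β).aestronglyMeasurable
    ((ae_restrict_iff' measurableSet_unitBall).2 (.of_forall fun _ hw => (norm_psi_cpow β hw).le))

/-- In slice coordinates the fibre integral is handled by the mean value property, which replaces h
on the fibre by its value at the centre. What is left is the disc formula with exponent m + β at the
point |z|. -/
theorem reproducing_aux {m : ℕ} {β : ℂ} (hβ : -1 < β.re)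
    (hC : ∫ v in unitBall m, (psi v : ℂ) ^ β ≠ 0) {h : Cn (m + 1) → ℂ}
    (hh : DifferentiableOn ℂ h (unitBall (m + 1)))
    (hint : IntegrableOn (fun w => h w * (psi w : ℂ) ^ β) (unitBall (m + 1)))
    {z : Cn (m + 1)} (hz : z ∈ unitBall (m + 1)) :
    kerInt (m + 2 + β) (fun w => h w * (psi w : ℂ) ^ β) z
      = (∫ v in unitBall m, (psi v : ℂ) ^ β) * (Real.pi / (m + β + 1)) * h z := by
  obtain ⟨T, hmp, hT, hpair, hTz⟩ := exists_slice z
  have hz1 := mem_unitBall.1 hz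
  have hz0 := norm_nonneg z
  set C := ∫ v in unitBall m, (psi v : ℂ) ^ β with hCdef
  obtain ⟨hae, hi, hval⟩ := integral_slice hT hmp (integrableOn_mul_ker (m + 2 + β) hint hz)
  -- Fubini gives integrability of the fibres only for almost every u.
  have hkey : ∀ᵐ u ∂(volume.restrict (ball (0 : ℂ) 1)),
      ∫ v in ball (0 : Cn m) (√(psi u)),
        h (T (u, v)) * (psi (T (u, v)) : ℂ) ^ β * ker (m + 2 + β) z (T (u, v))
      = C * (h (T (u, 0)) * ((psi u : ℂ) ^ (m + β) *
          (1 - ‖z‖ * starRingEnd ℂ u) ^ (-(2 + (m + β))))) := by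
    filter_upwards [hae, ae_restrict_mem measurableSet_ball] with u hu hmem
    have hu1 : ‖u‖ < 1 := by simpa using hmem
    have hψ := psi_pos hu1
    have hk0 : (1 - ‖z‖ * starRingEnd ℂ u : ℂ) ≠ 0 :=
      one_sub_mul_ne_zero hz0 hz1 (by simpa using hu1)
    set k : ℂ := (1 - ‖z‖ * starRingEnd ℂ u) ^ (-(m + 2 + β)) with hk
    have hk1 : k ≠ 0 := by rw [hk, Complex.cpow_ne_zero_iff]; exact Or.inl hk0
    have hform : ∀ v, h (T (u, v)) * (psi (T (u, v)) : ℂ) ^ β * ker (m + 2 + β) z (T (u, v))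
        = (h (T (u, v)) * ((psi u - ‖v‖ ^ 2 : ℝ) : ℂ) ^ β) * k := fun v => by
      rw [ker, hpair, psi_slice hT]
    simp only [hform] at hu ⊢
    have hu2 : IntegrableOn (fun v => h (T (u, v)) * ((psi u - ‖v‖ ^ 2 : ℝ) : ℂ) ^ β)
        (ball (0 : Cn m) (√(psi u))) := by
      refine (hu.mul_const k⁻¹).congr (.of_forall fun v => ?_)
      simp only
      rw [mul_inv_cancel_right₀ hk1]
    have hdiff : DifferentiableOn ℂ (fun v => h (T (u, v))) (ball (0 : Cn m) (√(psi u))) := by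
      refine hh.comp (t := unitBall (m + 1)) (f := fun v => T (u, v)) ?_ fun v hv => ?_
      · exact (T.differentiable.comp ((differentiable_const u).prodMk differentiable_id)).differentiableOn
      · exact (slice_mem_iff hT u v).2 ⟨hmem, hv⟩
    rw [integral_mul_const, setIntegral_mul_radial volume (fun a ha => measurePreserving_smul a ha)
      hdiff ?_ ?_ hu2, integral_ball_sub_norm_sq_cpow m β hψ, hk,
      show -(m + 2 + β) = -(2 + (m + β)) by ring]
    · ring
    · exact (Complex.measurable_ofReal.comp
        (measurable_const.sub (measurable_norm.pow_const 2))).pow_const β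
    · intro a ha v
      simp only [norm_smul, ha, one_mul]
  -- Integrability on the disc is inherited from the iterated integral; removing the fibre constant
  -- needs `hC`.
  have hi2 : IntegrableOn (fun u => h (T (u, 0)) * ((psi u : ℂ) ^ (m + β) *
          (1 - ‖z‖ * starRingEnd ℂ u) ^ (-(2 + (m + β))))) (ball (0 : ℂ) 1) := by
    refine ((hi.congr hkey).const_mul C⁻¹).congr (.of_forall fun u => ?_)
    simp only
    rw [inv_mul_cancel_left₀ hC]
  have hdisc : DifferentiableOn ℂ (fun u => h (T (u, 0))) (ball (0 : ℂ) 1) := by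
    refine hh.comp (t := unitBall (m + 1)) (f := fun u => T (u, 0)) ?_ fun u hu => ?_
    · exact (T.differentiable.comp (differentiable_id.prodMk (differentiable_const _))).differentiableOn
    · refine (slice_mem_iff hT u 0).2 ⟨hu, ?_⟩
      rw [mem_ball_zero_iff, norm_zero, Real.sqrt_pos]
      exact psi_pos (by simpa using hu)
  have hmβ : -1 < ((m : ℂ) + β).re := by
    have : (0 : ℝ) ≤ m := Nat.cast_nonneg m
    simp; linarith
  rw [kerInt, hval, integral_congr_ae hkey, integral_const_mul,
    integral_disc_reproducing hz0 hz1 hmβ hdisc hi2, hTz]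
  ring

/-- The constant in the reproducing formula. -/
def volConst (n : ℕ) (β : ℂ) : ℂ := ∫ v in unitBall n, (psi v : ℂ) ^ β

/-- This is the reproducing formula for the constant function 1 at z = 0, where the kernel equals 1.
-/
theorem volConst_succ {m : ℕ} {β : ℂ} (hβ : -1 < β.re) (hC : volConst m β ≠ 0) :
    volConst (m + 1) β = volConst m β * (Real.pi / (m + β + 1)) := by
  have := reproducing_aux hβ hC (h := fun _ => 1) (differentiableOn_const _)
    (by simpa using integrableOn_psi_cpow (m + 1) hβ) zero_mem_unitBall
  simpa [kerInt, ker, volConst] using this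

/-- For complex β the integrand has no sign. The recursion in the dimension instead gives a product
of nonzero factors π/(j + β + 1), starting from the one-point ball in dimension 0. -/
theorem volConst_ne_zero (n : ℕ) {β : ℂ} (hβ : -1 < β.re) : volConst n β ≠ 0 := by
  induction n with
  | zero =>
    have : ∀ v : Cn 0, (psi v : ℂ) ^ β = 1 := fun v => by
      rw [Subsingleton.elim v 0]; simp [psi]
    simp only [volConst, this, integral_const, mul_one, Complex.real_smul]
    have : volume.real (unitBall 0) ≠ 0 :=
      ENNReal.toReal_ne_zero.2 ⟨(measure_ball_pos _ _ one_pos).ne', measure_ball_lt_top.ne⟩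
    simpa using this
  | succ m ih =>
    rw [volConst_succ hβ ih]
    refine mul_ne_zero ih (div_ne_zero (by exact_mod_cast Real.pi_ne_zero) fun h => ?_)
    have h1 := congrArg Complex.re h
    have : (0 : ℝ) ≤ m := Nat.cast_nonneg m
    simp at h1; linarith

/-- The reproducing formula for weighted integrable holomorphic functions on the ball. -/
theorem kerInt_reproducing {n : ℕ} (hn : 0 < n) {β : ℂ} (hβ : -1 < β.re) {h : Cn n → ℂ}
    (hh : DifferentiableOn ℂ h (unitBall n))
    (hint : IntegrableOn (fun w => h w * (psi w : ℂ) ^ β) (unitBall n))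
    {z : Cn n} (hz : z ∈ unitBall n) :
    kerInt (n + 1 + β) (fun w => h w * (psi w : ℂ) ^ β) z = volConst n β * h z := by
  obtain ⟨m, rfl⟩ := Nat.exists_eq_succ_of_ne_zero hn.ne'
  have hC := volConst_ne_zero m hβ
  have h1 := reproducing_aux hβ hC hh hint hz
  have h2 := volConst_succ hβ hC
  rw [← volConst] at h1
  rw [← h2] at h1
  rw [← h1]
  congr 1
  push_cast; ring

end

section

/-! ### Forelli-Rudin estimates -/

theorem lintegral_Ioc_rpow {a t : ℝ} (ha : 0 < a) (ht : -1 < t) :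
    ∫⁻ y in Ioc 0 a, ENNReal.ofReal (y ^ t) = ENNReal.ofReal (a ^ (t + 1) / (t + 1)) := by
  have hi := intervalIntegral.intervalIntegrable_rpow' (a := 0) (b := a) ht
  rw [intervalIntegrable_iff_integrableOn_Ioc_of_le ha.le] at hi
  rw [← ofReal_integral_eq_lintegral_ofReal hi, ← intervalIntegral.integral_of_le ha.le,
    integral_rpow (Or.inl ht), Real.zero_rpow (by linarith), sub_zero]
  exact (ae_restrict_iff' measurableSet_Ioc).2 (.of_forall fun y hy => Real.rpow_nonneg hy.1.le _)

theorem lintegral_Ioi_rpow {a s : ℝ} (ha : 0 < a) (hs : 0 < s) :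
    ∫⁻ y in Ioi a, ENNReal.ofReal (y ^ (-1 - s)) = ENNReal.ofReal (a ^ (-s) / s) := by
  have hs' : -1 - s < -1 := by linarith
  rw [← ofReal_integral_eq_lintegral_ofReal (integrableOn_Ioi_rpow_of_lt hs' ha),
    integral_Ioi_rpow_of_lt hs' ha]
  · congr 1
    rw [show -1 - s + 1 = -s by ring, neg_div_neg_eq]
  · exact (ae_restrict_iff' measurableSet_Ioi).2 (.of_forall fun y hy =>
      Real.rpow_nonneg (ha.trans hy).le _)

/-- Both one-variable Forelli-Rudin integrals are estimated by cutting at the distance to the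
boundary: an integrable power near 0, a decaying power beyond. -/
theorem lintegral_Ioi_le_of_le_rpow {a t s A B : ℝ} (ha : 0 < a) (ht : -1 < t) (hs : 0 < s)
    (hA : 0 ≤ A) (hB : 0 ≤ B) {f : ℝ → ℝ≥0∞} (h1 : ∀ y ∈ Ioc 0 a, f y ≤ ENNReal.ofReal (A * y ^ t))
    (h2 : ∀ y ∈ Ioi a, f y ≤ ENNReal.ofReal (B * y ^ (-1 - s))) :
    ∫⁻ y in Ioi 0, f y ≤ ENNReal.ofReal (A * (a ^ (t + 1) / (t + 1)) + B * (a ^ (-s) / s)) := by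
  have ht1 : 0 < t + 1 := by linarith
  rw [← Ioc_union_Ioi_eq_Ioi ha.le, ENNReal.ofReal_add (by positivity) (by positivity),
    ENNReal.ofReal_mul hA, ENNReal.ofReal_mul hB, ← lintegral_Ioc_rpow ha ht,
    ← lintegral_Ioi_rpow ha hs, ← lintegral_const_mul' _ _ ENNReal.ofReal_ne_top,
    ← lintegral_const_mul' _ _ ENNReal.ofReal_ne_top]
  refine (lintegral_union_le _ _ _).trans (add_le_add ?_ ?_)
  · refine setLIntegral_mono' measurableSet_Ioc fun y hy => (h1 y hy).trans ?_
    rw [ENNReal.ofReal_mul hA]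
  · refine setLIntegral_mono' measurableSet_Ioi fun y hy => (h2 y hy).trans ?_
    rw [ENNReal.ofReal_mul hB]

theorem lintegral_comp_abs_le (g : ℝ → ℝ≥0∞) :
    ∫⁻ θ, g |θ| ≤ 2 * ∫⁻ y in Ioi 0, g y := by
  have h1 : ∫⁻ θ in Ioi (0 : ℝ), g |θ| = ∫⁻ y in Ioi 0, g y :=
    setLIntegral_congr_fun measurableSet_Ioi fun y hy => by simp only [abs_of_pos (mem_Ioi.1 hy)]
  have h2 : ∫⁻ θ in Iic (0 : ℝ), g |θ| = ∫⁻ y in Ioi 0, g y := by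
    rw [← lintegral_indicator measurableSet_Iic, ← lintegral_sub_left_eq_self _ (0 : ℝ)]
    have : ∀ θ : ℝ, (Iic (0 : ℝ)).indicator (fun θ => g |θ|) (0 - θ)
        = (Ici (0 : ℝ)).indicator (fun θ => g |θ|) θ := fun θ => by
      classical
      simp [indicator]
    simp only [this]
    rw [lintegral_indicator measurableSet_Ici, ← h1, restrict_Ioi_eq_restrict_Ici]
  rw [← setLIntegral_univ, ← Iic_union_Ioi (a := (0 : ℝ)), two_mul]
  refine (lintegral_union_le _ _ _).trans ?_
  rw [h1, h2]

theorem abs_div_pi_le_norm_one_sub {x θ : ℝ} (hx0 : 0 ≤ x) (hθ : |θ| ≤ Real.pi) :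
    |θ| / Real.pi ≤ ‖1 - x * starRingEnd ℂ (Real.cos θ + Real.sin θ * Complex.I)‖ := by
  have hpi := Real.pi_pos
  have hsq : ‖1 - x * starRingEnd ℂ (Real.cos θ + Real.sin θ * Complex.I)‖ ^ 2
      = 1 - 2 * x * Real.cos θ + x ^ 2 := by
    rw [← Complex.normSq_eq_norm_sq, Complex.normSq_apply]
    simp [-Complex.ofReal_cos, -Complex.ofReal_sin]
    linear_combination x ^ 2 * Real.sin_sq_add_cos_sq θ
  refine abs_le_of_sq_le_sq' ?_ (norm_nonneg _) |>.2
  rw [hsq]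
  -- For cos θ ≥ 0 completing the square bounds the expression below by sin²θ; for cos θ ≤ 0 it is
  -- at least 1.
  rcases le_or_gt |θ| (Real.pi / 2) with h | h
  · have h1 := Real.mul_abs_le_abs_sin h
    have h2 : |θ| / Real.pi ≤ |Real.sin θ| := by
      refine le_trans ?_ h1
      rw [div_mul_eq_mul_div]
      gcongr
      nlinarith [abs_nonneg θ]
    have h3 : (|θ| / Real.pi) ^ 2 ≤ Real.sin θ ^ 2 := by
      rw [← sq_abs (Real.sin θ)]
      gcongr
    nlinarith [sq_nonneg (x - Real.cos θ), Real.sin_sq_add_cos_sq θ]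
  · have h1 : Real.cos θ ≤ 0 := by
      rw [← Real.cos_abs]
      exact Real.cos_nonpos_of_pi_div_two_le_of_le h.le (by linarith)
    have h2 : |θ| / Real.pi ≤ 1 := (div_le_one hpi).2 hθ
    have h3 : (|θ| / Real.pi) ^ 2 ≤ 1 := pow_le_one₀ (by positivity) h2
    nlinarith [mul_nonneg hx0 (neg_nonneg.2 h1)]

theorem one_sub_le_norm_one_sub {x θ : ℝ} (hx0 : 0 ≤ x) :
    1 - x ≤ ‖1 - x * starRingEnd ℂ (Real.cos θ + Real.sin θ * Complex.I)‖ := by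
  have h : ‖(Real.cos θ + Real.sin θ * Complex.I : ℂ)‖ = 1 := by
    simp
  have := norm_sub_norm_le (1 : ℂ) (x * starRingEnd ℂ (Real.cos θ + Real.sin θ * Complex.I))
  rw [norm_one, norm_mul, Complex.norm_conj, h, mul_one, Complex.norm_real,
    Real.norm_of_nonneg hx0] at this
  exact this

theorem lintegral_angle_le {b : ℝ} (hb : 1 < b) {x : ℝ} (hx0 : 0 ≤ x) (hx1 : x < 1) :
    ∫⁻ θ in Ioo (-Real.pi) Real.pi, ENNReal.ofReal
      (‖1 - x * starRingEnd ℂ (Real.cos θ + Real.sin θ * Complex.I)‖ ^ (-b))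
      ≤ ENNReal.ofReal ((2 * (1 + Real.pi ^ b / (b - 1))) * (1 - x) ^ (-(b - 1))) := by
  have hpi := Real.pi_pos
  have ha : 0 < 1 - x := by linarith
  have hb1 : 0 < b - 1 := by linarith
  -- The kernel is bounded below by both 1 - x and |θ|/π. The first bound is used for |θ| ≤ 1 - x,
  -- the second beyond.
  set g : ℝ → ℝ≥0∞ := fun y => ENNReal.ofReal ((max (1 - x) (y / Real.pi)) ^ (-b)) with hg
  have h1 : ∫⁻ θ in Ioo (-Real.pi) Real.pi, ENNReal.ofReal
      (‖1 - x * starRingEnd ℂ (Real.cos θ + Real.sin θ * Complex.I)‖ ^ (-b))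
      ≤ ∫⁻ θ in Ioo (-Real.pi) Real.pi, g |θ| := by
    refine setLIntegral_mono' measurableSet_Ioo fun θ hθ => ?_
    refine ENNReal.ofReal_le_ofReal ?_
    refine Real.rpow_le_rpow_of_nonpos (lt_max_of_lt_left ha) ?_ (by linarith)
    exact max_le (one_sub_le_norm_one_sub hx0)
      (abs_div_pi_le_norm_one_sub hx0 (abs_le.2 ⟨hθ.1.le, hθ.2.le⟩))
  refine h1.trans ((setLIntegral_le_lintegral _ _).trans ((lintegral_comp_abs_le g).trans ?_))
  have h2 := lintegral_Ioi_le_of_le_rpow (f := g) (a := 1 - x) (t := 0) (s := b - 1)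
    (A := (1 - x) ^ (-b)) (B := Real.pi ^ b) ha (by norm_num) hb1 (by positivity) (by positivity)
    (fun y _ => by
      rw [Real.rpow_zero, mul_one]
      exact ENNReal.ofReal_le_ofReal (Real.rpow_le_rpow_of_nonpos ha (le_max_left _ _) (by linarith)))
    (fun y hy => by
      have hy0 : 0 < y := ha.trans hy
      refine ENNReal.ofReal_le_ofReal ?_
      refine (Real.rpow_le_rpow_of_nonpos (by positivity) (le_max_right _ _) (by linarith)).trans ?_
      rw [show -1 - (b - 1) = -b by ring, Real.div_rpow hy0.le hpi.le, Real.rpow_neg hpi.le,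
        div_inv_eq_mul, mul_comm])
  refine (mul_le_mul_right h2 2).trans (le_of_eq ?_)
  rw [show (2 : ℝ≥0∞) = ENNReal.ofReal 2 by simp, ← ENNReal.ofReal_mul (by norm_num)]
  congr 1
  have h3 : (1 - x) ^ (-(b - 1)) = (1 - x) ^ (-b) * (1 - x) := by
    rw [show -(b - 1) = -b + 1 by ring, Real.rpow_add ha, Real.rpow_one]
  rw [zero_add, Real.rpow_one, div_one, h3]
  ring

theorem lintegral_radius_le {t s r : ℝ} (ht : -1 < t) (hs : 0 < s) (hr0 : 0 ≤ r) (hr1 : r < 1) :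
    ∫⁻ ρ in Ioo 0 1, ENNReal.ofReal ((1 - ρ) ^ t * (1 - r * ρ) ^ (-(1 + t + s)))
      ≤ ENNReal.ofReal ((1 / (t + 1) + 1 / s) * (1 - r) ^ (-s)) := by
  have ha : 0 < 1 - r := by linarith
  set f : ℝ → ℝ≥0∞ := (Ioo (0 : ℝ) 1).indicator fun y =>
    ENNReal.ofReal (y ^ t * (1 - r * (1 - y)) ^ (-(1 + t + s))) with hf
  have h1 : ∫⁻ ρ in Ioo 0 1, ENNReal.ofReal ((1 - ρ) ^ t * (1 - r * ρ) ^ (-(1 + t + s)))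
      = ∫⁻ y, f y := by
    -- Substitute y = 1 - ρ; then 1 - rρ is at least both 1 - r and y.
    rw [← lintegral_indicator measurableSet_Ioo, ← lintegral_sub_left_eq_self f (1 : ℝ)]
    refine lintegral_congr fun y => ?_
    classical
    simp only [hf, indicator, mem_Ioo, sub_pos, sub_lt_self_iff, sub_sub_cancel]
    simp only [and_comm]
  have h2 : ∫⁻ y, f y = ∫⁻ y in Ioi 0, f y := by
    refine (setLIntegral_eq_of_support_subset ?_).symm
    intro y hy
    by_contra hny
    exact hy (indicator_of_notMem (fun h => hny h.1) _)
  rw [h1, h2]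
  refine (lintegral_Ioi_le_of_le_rpow (a := 1 - r) (t := t) (s := s)
    (A := (1 - r) ^ (-(1 + t + s))) (B := 1) ha ht hs (by positivity) zero_le_one
    (fun y hy => ?_) (fun y hy => ?_)).trans (le_of_eq ?_)
  · refine (indicator_le_self' (fun _ _ => zero_le) y).trans (ENNReal.ofReal_le_ofReal ?_)
    rw [mul_comm]
    have := hy.1
    gcongr ?_ * _
    refine Real.rpow_le_rpow_of_nonpos ha ?_ (by linarith)
    nlinarith
  · have hy0 : 0 < y := ha.trans hy
    by_cases hy1 : y ∈ Ioo (0 : ℝ) 1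
    · rw [hf, indicator_of_mem hy1]
      refine ENNReal.ofReal_le_ofReal ?_
      rw [one_mul, show -1 - s = t + (-(1 + t + s)) by ring, Real.rpow_add hy0]
      gcongr _ * ?_
      refine Real.rpow_le_rpow_of_nonpos hy0 ?_ (by linarith)
      nlinarith [hy1.2]
    · rw [hf, indicator_of_notMem hy1]; exact zero_le
  · congr 1
    have h3 : (1 - r) ^ (-(1 + t + s)) * ((1 - r) ^ (t + 1) / (t + 1)) = (1 - r) ^ (-s) / (t + 1) := by
      rw [mul_div_assoc', ← Real.rpow_add ha]; ring_nf
    rw [h3]; ring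

theorem psi_rpow_le {E : Type*} [NormedAddCommGroup E] (t : ℝ) {u : E} (hu : ‖u‖ < 1) :
    psi u ^ t ≤ 2 ^ |t| * (1 - ‖u‖) ^ t := by
  have h0 := norm_nonneg u
  have h1 : psi u = (1 + ‖u‖) * (1 - ‖u‖) := by simp only [psi]; ring
  rw [h1, Real.mul_rpow (by linarith) (by linarith)]
  have h3 : 0 < 1 - ‖u‖ := by linarith
  gcongr
  calc (1 + ‖u‖) ^ t ≤ (1 + ‖u‖) ^ |t| :=
        Real.rpow_le_rpow_of_exponent_le (by linarith) (le_abs_self t)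
    _ ≤ 2 ^ |t| := by gcongr; linarith

theorem lintegral_disc_le {t s : ℝ} (ht : -1 < t) (hs : 0 < s) : ∃ C : ℝ, 0 < C ∧
    ∀ r : ℝ, 0 ≤ r → r < 1 → ∫⁻ u in ball (0 : ℂ) 1, ENNReal.ofReal (psi u ^ t) *
      ENNReal.ofReal (‖1 - r * starRingEnd ℂ u‖ ^ (-(2 + t + s)))
      ≤ ENNReal.ofReal (C * (1 - r) ^ (-s)) := by
  have hb : 1 < 2 + t + s := by linarith
  have hb1 : 0 < 2 + t + s - 1 := by linarith
  have ht1 : 0 < t + 1 := by linarith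
  set K := 2 * (1 + Real.pi ^ (2 + t + s) / (2 + t + s - 1)) with hK
  have hK0 : 0 < K := by positivity
  refine ⟨2 ^ |t| * K * (1 / (t + 1) + 1 / s), by positivity, fun r hr0 hr1 => ?_⟩
  set F : ℝ → ℝ → ℝ≥0∞ := fun ρ θ => ENNReal.ofReal (2 ^ |t| * (1 - ρ) ^ t) *
      ENNReal.ofReal (‖1 - ((r * ρ : ℝ) : ℂ) * starRingEnd ℂ (Real.cos θ + Real.sin θ * Complex.I)‖
        ^ (-(2 + t + s))) with hF
  rw [← lintegral_indicator measurableSet_ball, ← Complex.lintegral_comp_polarCoord_symm,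
    polarCoord_target, Measure.volume_eq_prod, ← Measure.prod_restrict]
  refine (lintegral_prod_le _).trans ?_
  have h1 : ∀ ρ ∈ Ioi (0 : ℝ), ∀ θ : ℝ, ENNReal.ofReal ρ • (ball (0 : ℂ) 1).indicator
      (fun u => ENNReal.ofReal (psi u ^ t) *
        ENNReal.ofReal (‖1 - r * starRingEnd ℂ u‖ ^ (-(2 + t + s)))) (Complex.polarCoord.symm (ρ, θ))
      ≤ (Ioo (0 : ℝ) 1).indicator (fun ρ => F ρ θ) ρ := by
    intro ρ hρ θ
    have hρ0 : 0 < ρ := hρ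
    have hnorm : ‖Complex.polarCoord.symm (ρ, θ)‖ = ρ := by
      rw [Complex.norm_polarCoord_symm, abs_of_pos hρ0]
    by_cases hρ1 : ρ < 1
    · rw [indicator_of_mem (by rw [mem_ball_zero_iff, hnorm]; exact hρ1),
        indicator_of_mem (show ρ ∈ Ioo (0 : ℝ) 1 from ⟨hρ0, hρ1⟩), smul_eq_mul]
      -- The polar Jacobian ρ ≤ 1 is simply dropped.
      refine (mul_le_of_le_one_left zero_le (by simpa using hρ1.le)).trans ?_
      simp only [hF]
      refine mul_le_mul' (ENNReal.ofReal_le_ofReal ?_) (ENNReal.ofReal_le_ofReal (le_of_eq ?_))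
      · have := psi_rpow_le t (u := Complex.polarCoord.symm (ρ, θ)) (by rw [hnorm]; exact hρ1)
        rwa [hnorm] at this
      · rw [Complex.polarCoord_symm_apply]
        simp only [map_mul, Complex.conj_ofReal]
        congr 3
        push_cast; ring
    · rw [indicator_of_notMem (by rw [mem_ball_zero_iff, hnorm]; exact hρ1), smul_zero]
      exact zero_le
  calc _ ≤ ∫⁻ ρ in Ioi (0 : ℝ), ∫⁻ θ in Ioo (-Real.pi) Real.pi,
        (Ioo (0 : ℝ) 1).indicator (fun ρ => F ρ θ) ρ :=
        setLIntegral_mono' measurableSet_Ioi fun ρ hρ => lintegral_mono fun θ => h1 ρ hρ θ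
    _ ≤ ∫⁻ ρ in Ioi (0 : ℝ), (Ioo (0 : ℝ) 1).indicator (fun ρ => ENNReal.ofReal (2 ^ |t| * K) *
        ENNReal.ofReal ((1 - ρ) ^ t * (1 - r * ρ) ^ (-(1 + t + s)))) ρ := by
        refine lintegral_mono fun ρ => ?_
        by_cases hρ : ρ ∈ Ioo (0 : ℝ) 1
        · simp only [indicator_of_mem hρ, hF]
          have h2 : 0 < 1 - ρ := by linarith [hρ.2]
          have h3 : r * ρ < 1 := by nlinarith [hρ.1, hρ.2]
          have h4 : 0 < 1 - r * ρ := by linarith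
          rw [lintegral_const_mul' _ _ ENNReal.ofReal_ne_top]
          refine (mul_le_mul_right (lintegral_angle_le hb
            (mul_nonneg hr0 hρ.1.le) h3) _).trans (le_of_eq ?_)
          rw [← ENNReal.ofReal_mul (by positivity), ← ENNReal.ofReal_mul (by positivity), ← hK]
          congr 1
          rw [show -(2 + t + s - 1) = -(1 + t + s) by ring]
          ring
        · simp only [indicator_of_notMem hρ, lintegral_zero, le_refl]
    _ ≤ ∫⁻ ρ in Ioo 0 1, ENNReal.ofReal (2 ^ |t| * K) *
        ENNReal.ofReal ((1 - ρ) ^ t * (1 - r * ρ) ^ (-(1 + t + s))) := by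
        rw [← lintegral_indicator measurableSet_Ioo]
        exact setLIntegral_le_lintegral _ _
    _ ≤ _ := by
        rw [lintegral_const_mul' _ _ ENNReal.ofReal_ne_top]
        refine (mul_le_mul_right (lintegral_radius_le ht hs hr0 hr1) _).trans (le_of_eq ?_)
        rw [← ENNReal.ofReal_mul (by positivity)]
        congr 1; ring

/-- The Forelli-Rudin estimate. -/
theorem forelli_rudin {n : ℕ} (hn : 0 < n) {t s : ℝ} (ht : -1 < t) (hs : 0 < s) :
    ∃ C : ℝ, 0 < C ∧ ∀ z ∈ unitBall n,
      ∫⁻ w in unitBall n, ENNReal.ofReal (psi w ^ t * ‖1 - pairing z w‖ ^ (-(n + 1 + t + s)))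
        ≤ ENNReal.ofReal (C * psi z ^ (-s)) := by
  obtain ⟨m, rfl⟩ := Nat.exists_eq_succ_of_ne_zero hn.ne'
  have hm : (0 : ℝ) ≤ m := Nat.cast_nonneg m
  -- With n = m + 1, integrating out m variables turns the weight exponent t into m + t, and n + 1 +
  -- t + s = 2 + (m + t) + s.
  obtain ⟨C, hC, h⟩ := lintegral_disc_le (t := m + t) (s := s) (by linarith) hs
  set V := ∫⁻ v in unitBall m, ENNReal.ofReal (psi v ^ t) with hV
  have hVtop : V ≠ ∞ := (lintegral_psi_rpow_lt_top m ht).ne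
  refine ⟨(V.toReal + 1) * (C * 2 ^ s), by positivity, fun z hz => ?_⟩
  have hz1 := mem_unitBall.1 hz
  have hz0 := norm_nonneg z
  have h1 := lintegral_psi_mul_comp_pairing (m := m) t z
    (F := fun x => ENNReal.ofReal (‖1 - x‖ ^ (-(2 + (m + t) + s))))
    (((measurable_const.sub measurable_id).norm.pow_const _).ennreal_ofReal)
  calc _ = ∫⁻ w in unitBall (m + 1), ENNReal.ofReal (psi w ^ t) *
        ENNReal.ofReal (‖1 - pairing z w‖ ^ (-(2 + (m + t) + s))) := by
        refine setLIntegral_congr_fun measurableSet_unitBall fun w hw => ?_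
        have := psi_pos (mem_unitBall.1 hw)
        rw [ENNReal.ofReal_mul (by positivity)]
        congr 3
        push_cast; ring
    _ ≤ V * ENNReal.ofReal (C * (1 - ‖z‖) ^ (-s)) := by
        rw [h1]; gcongr; exact h _ hz0 hz1
    _ ≤ ENNReal.ofReal (V.toReal + 1) * ENNReal.ofReal (C * (2 ^ s * psi z ^ (-s))) := by
        refine mul_le_mul' ?_ (ENNReal.ofReal_le_ofReal ?_)
        · rw [← ENNReal.ofReal_toReal hVtop]
          exact ENNReal.ofReal_le_ofReal (by simp)
        · gcongr
          have h2 : 0 < 1 - ‖z‖ := by linarith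
          have h3 : psi z ≤ 2 * (1 - ‖z‖) := by simp only [psi]; nlinarith
          have h4 := psi_pos hz1
          calc (1 - ‖z‖) ^ (-s) = 2 ^ s * (2 * (1 - ‖z‖)) ^ (-s) := by
                rw [Real.mul_rpow (by norm_num) h2.le, ← mul_assoc, ← Real.rpow_add (by norm_num)]
                simp
            _ ≤ 2 ^ s * psi z ^ (-s) := by
                gcongr ?_ * ?_
                exact Real.rpow_le_rpow_of_nonpos h4 h3 (by linarith)
    _ = _ := by
        rw [← ENNReal.ofReal_mul (by positivity)]
        congr 1; ring

end

section

/-! ### Schur's test -/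

/-- Hölder with the auxiliary weight f, the core of Schur's test. The exponents 1 - 1/p and 1/p are
used so that p = 1 needs no separate treatment. -/
theorem lintegral_mul_rpow_le_weighted {α : Type*} [MeasurableSpace α] {μ : Measure α} {p : ℝ}
    (hp : 1 ≤ p) {κ f : α → ℝ} (hκ : Measurable κ) (hf : Measurable f)
    (hpos : ∀ᵐ w ∂μ, 0 < κ w ∧ 0 < f w) {u : α → ℝ≥0∞} (hu : AEMeasurable u μ) :
    (∫⁻ w, ENNReal.ofReal (κ w) * u w ∂μ) ^ p ≤ (∫⁻ w, ENNReal.ofReal (κ w * f w) ∂μ) ^ (p - 1) *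
      ∫⁻ w, ENNReal.ofReal (κ w * f w ^ (-(p - 1))) * u w ^ p ∂μ := by
  have hp0 : 0 < p := by linarith
  have hp1 : p⁻¹ ≤ 1 := inv_le_one_of_one_le₀ hp
  have h1 : ∫⁻ w, ENNReal.ofReal (κ w) * u w ∂μ
      = ∫⁻ w, ENNReal.ofReal (κ w * f w) ^ (1 - p⁻¹) *
        (ENNReal.ofReal (κ w * f w ^ (-(p - 1))) * u w ^ p) ^ p⁻¹ ∂μ := by
    refine lintegral_congr_ae ?_
    filter_upwards [hpos] with w ⟨hk, hfw⟩
    rw [ENNReal.mul_rpow_of_nonneg _ _ (by positivity), ← ENNReal.rpow_mul, mul_inv_cancel₀ hp0.ne',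
      ENNReal.rpow_one, ENNReal.ofReal_rpow_of_pos (by positivity),
      ENNReal.ofReal_rpow_of_pos (by positivity), ← mul_assoc, ← ENNReal.ofReal_mul (by positivity)]
    congr 2
    rw [Real.mul_rpow hk.le hfw.le, Real.mul_rpow hk.le (by positivity), ← Real.rpow_mul hfw.le]
    have e1 : κ w = κ w ^ (1 - p⁻¹) * κ w ^ p⁻¹ := by
      rw [← Real.rpow_add hk]; simp
    have e2 : f w ^ (1 - p⁻¹) * f w ^ (-(p - 1) * p⁻¹) = 1 := by
      rw [← Real.rpow_add hfw]
      have : 1 - p⁻¹ + -(p - 1) * p⁻¹ = 0 := by field_simp; ring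
      rw [this, Real.rpow_zero]
    calc κ w = κ w ^ (1 - p⁻¹) * κ w ^ p⁻¹ *
          (f w ^ (1 - p⁻¹) * f w ^ (-(p - 1) * p⁻¹)) := by rw [e2, mul_one, ← e1]
      _ = _ := by ring
  have h2 := ENNReal.lintegral_mul_norm_pow_le (μ := μ)
    (f := fun w => ENNReal.ofReal (κ w * f w))
    (g := fun w => ENNReal.ofReal (κ w * f w ^ (-(p - 1))) * u w ^ p)
    (hκ.mul hf).ennreal_ofReal.aemeasurable
    ((hκ.mul (hf.pow_const _)).ennreal_ofReal.aemeasurable.mul (hu.pow_const p))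
    (p := 1 - p⁻¹) (q := p⁻¹) (by linarith) (by positivity) (by ring)
  rw [h1]
  refine (ENNReal.rpow_le_rpow h2 hp0.le).trans (le_of_eq ?_)
  rw [ENNReal.mul_rpow_of_nonneg _ _ hp0.le, ← ENNReal.rpow_mul, ← ENNReal.rpow_mul,
    inv_mul_cancel₀ hp0.ne', ENNReal.rpow_one]
  congr 2
  field_simp

variable {n : ℕ}

/-- The kernel of the Schur test. -/
def schurKer (n : ℕ) (A B : ℝ) (z w : Cn n) : ℝ :=
  psi z ^ A * psi w ^ B * ‖1 - pairing z w‖ ^ (-(n + 1 + A + B))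

theorem measurable_schurKer (A B : ℝ) :
    Measurable fun q : Cn n × Cn n => schurKer n A B q.1 q.2 := by
  unfold schurKer
  exact (((measurable_psi.comp measurable_fst).pow_const A).mul
    ((measurable_psi.comp measurable_snd).pow_const B)).mul
    ((measurable_const.sub continuous_pairing.measurable).norm.pow_const _)

theorem measurable_schurKer_right (A B : ℝ) (z : Cn n) :
    Measurable fun w => schurKer n A B z w := by
  unfold schurKer
  exact (measurable_const.mul (measurable_psi.pow_const B)).mul
    ((measurable_const.sub (continuous_pairing_right z).measurable).norm.pow_const _)

theorem schurKer_pos (A B : ℝ) {z w : Cn n} (hz : z ∈ unitBall n) (hw : w ∈ unitBall n) :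
    0 < schurKer n A B z w := by
  have h1 := psi_pos (mem_unitBall.1 hz)
  have h2 := psi_pos (mem_unitBall.1 hw)
  have h3 := norm_one_sub_pairing_pos hz hw
  unfold schurKer
  positivity

theorem schurKer_comm (A B : ℝ) (z w : Cn n) : schurKer n A B z w = schurKer n B A w z := by
  have : ‖1 - pairing z w‖ = ‖1 - pairing w z‖ := by
    rw [← Complex.norm_conj, map_sub, map_one, conj_pairing]
  unfold schurKer
  rw [this, show (n + 1 + A + B : ℝ) = n + 1 + B + A by ring]
  ring

/-- The Forelli-Rudin estimate with t = B - τ and s = A + τ: powers ψ^{-τ} are test functions for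
the kernel. -/
theorem lintegral_schurKer_mul_psi_le (hn : 0 < n) {A B τ : ℝ} (h1 : -1 < B - τ) (h2 : 0 < A + τ) :
    ∃ C : ℝ, 0 < C ∧ ∀ z ∈ unitBall n,
      ∫⁻ w in unitBall n, ENNReal.ofReal (schurKer n A B z w * psi w ^ (-τ))
        ≤ ENNReal.ofReal (C * psi z ^ (-τ)) := by
  obtain ⟨C, hC, h⟩ := forelli_rudin hn h1 h2
  refine ⟨C, hC, fun z hz => ?_⟩
  have hψ := psi_pos (mem_unitBall.1 hz)
  calc _ = ∫⁻ w in unitBall n, ENNReal.ofReal (psi z ^ A) * ENNReal.ofReal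
        (psi w ^ (B - τ) * ‖1 - pairing z w‖ ^ (-(n + 1 + (B - τ) + (A + τ)))) := by
        refine setLIntegral_congr_fun measurableSet_unitBall fun w hw => ?_
        have hw' := psi_pos (mem_unitBall.1 hw)
        rw [← ENNReal.ofReal_mul (by positivity)]
        congr 1
        rw [schurKer, sub_eq_add_neg B, Real.rpow_add hw',
          show (n + 1 + (B + -τ) + (A + τ) : ℝ) = n + 1 + A + B by ring]
        ring
    _ ≤ ENNReal.ofReal (psi z ^ A) * ENNReal.ofReal (C * psi z ^ (-(A + τ))) := by
        rw [lintegral_const_mul' _ _ ENNReal.ofReal_ne_top]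
        gcongr
        exact h z hz
    _ = _ := by
        rw [← ENNReal.ofReal_mul (by positivity)]
        congr 1
        rw [mul_left_comm, ← Real.rpow_add hψ]
        ring_nf

/-- Integration in w uses the test function ψ^{-1/p}, integration in z uses ψ^{-(1-1/p)}. The four
conditions that Forelli-Rudin imposes collapse to A > -1/p and B > -1 + 1/p. -/
theorem schur_test (hn : 0 < n) {p A B : ℝ} (hp : 1 ≤ p) (hA : -p⁻¹ < A) (hB : -1 + p⁻¹ < B) :
    ∃ C : ℝ≥0∞, C ≠ ∞ ∧ ∀ u : Cn n → ℝ≥0∞, AEMeasurable u (volume.restrict (unitBall n)) →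
      ∫⁻ z in unitBall n, (∫⁻ w in unitBall n, ENNReal.ofReal (schurKer n A B z w) * u w) ^ p
        ≤ C * ∫⁻ w in unitBall n, u w ^ p := by
  have hp0 : 0 < p := by linarith
  have hp1 : 0 ≤ p - 1 := by linarith
  have hpp : p⁻¹ * (p - 1) = 1 - p⁻¹ := by field_simp
  obtain ⟨C₁, hC₁, h₁⟩ := lintegral_schurKer_mul_psi_le hn (A := A) (B := B) (τ := p⁻¹)
    (by linarith) (by linarith)
  obtain ⟨C₂, hC₂, h₂⟩ := lintegral_schurKer_mul_psi_le hn (A := B) (B := A) (τ := p⁻¹ * (p - 1))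
    (by rw [hpp]; linarith) (by rw [hpp]; linarith)
  refine ⟨ENNReal.ofReal (C₁ ^ (p - 1)) * ENNReal.ofReal C₂,
    ENNReal.mul_ne_top ENNReal.ofReal_ne_top ENNReal.ofReal_ne_top, fun u hu => ?_⟩
  set μ := volume.restrict (unitBall n) with hμ
  set G : Cn n → Cn n → ℝ≥0∞ := fun z w => ENNReal.ofReal (psi z ^ (-(p⁻¹ * (p - 1)))) *
    (ENNReal.ofReal (schurKer n A B z w) * ENNReal.ofReal (psi w ^ (p⁻¹ * (p - 1))) * u w ^ p) with hG
  have hstep : ∀ z ∈ unitBall n, (∫⁻ w, ENNReal.ofReal (schurKer n A B z w) * u w ∂μ) ^ p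
      ≤ ENNReal.ofReal (C₁ ^ (p - 1)) * ∫⁻ w, G z w ∂μ := fun z hz => by
    have hψ := psi_pos (mem_unitBall.1 hz)
    refine (lintegral_mul_rpow_le_weighted hp (measurable_schurKer_right A B z)
      (measurable_psi.pow_const (-p⁻¹)) ?_ hu).trans ?_
    · refine (ae_restrict_iff' measurableSet_unitBall).2 (.of_forall fun w hw => ?_)
      exact ⟨schurKer_pos A B hz hw, Real.rpow_pos_of_pos (psi_pos (mem_unitBall.1 hw)) _⟩
    · refine (mul_le_mul_left (ENNReal.rpow_le_rpow (h₁ z hz) hp1) _).trans (le_of_eq ?_)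
      rw [ENNReal.ofReal_rpow_of_pos (by positivity), Real.mul_rpow hC₁.le (by positivity),
        ← Real.rpow_mul hψ.le, ENNReal.ofReal_mul (by positivity), mul_assoc, neg_mul]
      congr 1
      rw [← lintegral_const_mul' _ _ ENNReal.ofReal_ne_top]
      refine setLIntegral_congr_fun measurableSet_unitBall fun w hw => ?_
      have hw' := psi_pos (mem_unitBall.1 hw)
      have hs := schurKer_pos A B hz hw
      simp only [hG]
      rw [← ENNReal.ofReal_mul hs.le, ← Real.rpow_mul hw'.le, neg_mul_neg]
  calc _ ≤ ∫⁻ z, ENNReal.ofReal (C₁ ^ (p - 1)) * ∫⁻ w, G z w ∂μ ∂μ :=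
        setLIntegral_mono' measurableSet_unitBall hstep
    _ = ENNReal.ofReal (C₁ ^ (p - 1)) * ∫⁻ w, ∫⁻ z, G z w ∂μ ∂μ := by
        rw [lintegral_const_mul' _ _ ENNReal.ofReal_ne_top, lintegral_lintegral_swap]
        simp only [hG, Function.uncurry_def]
        have m1 : Measurable fun q : Cn n × Cn n => ENNReal.ofReal (psi q.1 ^ (-(p⁻¹ * (p - 1)))) :=
          ((measurable_psi.comp measurable_fst).pow_const _).ennreal_ofReal
        have m2 : Measurable fun q : Cn n × Cn n => ENNReal.ofReal (psi q.2 ^ (p⁻¹ * (p - 1))) :=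
          ((measurable_psi.comp measurable_snd).pow_const _).ennreal_ofReal
        exact m1.aemeasurable.mul (((measurable_schurKer A B).ennreal_ofReal.mul m2).aemeasurable.mul
          ((hu.comp_quasiMeasurePreserving Measure.quasiMeasurePreserving_snd).pow_const p))
    _ ≤ ENNReal.ofReal (C₁ ^ (p - 1)) * ∫⁻ w, ENNReal.ofReal C₂ * u w ^ p ∂μ := by
        refine mul_le_mul_right (setLIntegral_mono' measurableSet_unitBall fun w hw => ?_) _
        have hw' := psi_pos (mem_unitBall.1 hw)
        have hval : ∫⁻ z, G z w ∂μ = (ENNReal.ofReal (psi w ^ (p⁻¹ * (p - 1))) * u w ^ p) *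
            ∫⁻ z, ENNReal.ofReal (schurKer n B A w z * psi z ^ (-(p⁻¹ * (p - 1)))) ∂μ := by
          have m3 : Measurable fun z =>
              ENNReal.ofReal (schurKer n B A w z * psi z ^ (-(p⁻¹ * (p - 1)))) :=
            ((measurable_schurKer_right B A w).mul (measurable_psi.pow_const _)).ennreal_ofReal
          rw [← lintegral_const_mul _ m3]
          refine setLIntegral_congr_fun measurableSet_unitBall fun z hz => ?_
          have hs := schurKer_pos B A hw hz
          simp only [hG]
          rw [schurKer_comm, ENNReal.ofReal_mul hs.le]
          ring
        rw [hval]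
        refine (mul_le_mul_right (h₂ w hw) _).trans (le_of_eq ?_)
        rw [mul_right_comm, ← ENNReal.ofReal_mul (by positivity)]
        congr 2
        rw [mul_left_comm, ← Real.rpow_add hw']
        simp
    _ ≤ _ := by
        rw [lintegral_const_mul' _ _ ENNReal.ofReal_ne_top, mul_assoc]

end

section

variable {n : ℕ} {p a : ℝ} {f g : Cn n → ℂ}

/-! ### Weighted Lebesgue spaces -/

/-- `(1 - |w|²)^a f(w)` belongs to `L^p` of the unit ball with respect to volume. -/
def WLp (p a : ℝ) (f : Cn n → ℂ) : Prop :=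
  MemLp (fun w => (psi w ^ a : ℝ) • f w) (ENNReal.ofReal p) (volume.restrict (unitBall n))

theorem ae_unitBall_of_forall {P : Cn n → Prop} (h : ∀ w ∈ unitBall n, P w) :
    ∀ᵐ w ∂(volume.restrict (unitBall n)), P w :=
  (ae_restrict_iff' measurableSet_unitBall).2 (.of_forall h)

theorem wlp_congr (h : ∀ w ∈ unitBall n, f w = g w) : WLp p a f ↔ WLp p a g :=
  memLp_congr_ae (ae_unitBall_of_forall fun w hw => by simp only [h w hw])

theorem WLp.add (hf : WLp p a f) (hg : WLp p a g) : WLp p a (fun w => f w + g w) := by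
  have := MemLp.add hf hg
  refine (memLp_congr_ae (.of_forall fun w => ?_)).1 this
  simp

theorem WLp.const_mul (hf : WLp p a f) (c : ℂ) : WLp p a (fun w => c * f w) := by
  have := MemLp.const_mul hf c
  refine (memLp_congr_ae (.of_forall fun w => ?_)).1 this
  simp only [Complex.real_smul]; ring

theorem WLp.sum {ι : Type*} (s : Finset ι) {F : ι → Cn n → ℂ} (hF : ∀ i ∈ s, WLp p a (F i)) :
    WLp p a (fun w => ∑ i ∈ s, F i w) := by
  have := memLp_finsetSum s hF
  refine (memLp_congr_ae (.of_forall fun w => ?_)).1 this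
  simp [Finset.mul_sum]

theorem aestronglyMeasurable_rpow_smul_iff :
    AEStronglyMeasurable (fun w => (psi w ^ a : ℝ) • f w) (volume.restrict (unitBall n)) ↔
      AEStronglyMeasurable f (volume.restrict (unitBall n)) := by
  refine ⟨fun h => ?_, fun h => (measurable_psi.pow_const a).aestronglyMeasurable.smul h⟩
  refine ((measurable_psi.pow_const (-a)).aestronglyMeasurable.smul h).congr
    (ae_unitBall_of_forall fun w hw => ?_)
  have := psi_pos (mem_unitBall.1 hw)
  change psi w ^ (-a) • psi w ^ a • f w = f w
  rw [smul_smul, ← Real.rpow_add this, neg_add_cancel, Real.rpow_zero, one_smul]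

theorem wlp_iff (hp : 1 ≤ p) : WLp p a f ↔
    AEStronglyMeasurable f (volume.restrict (unitBall n)) ∧
      ∫⁻ w in unitBall n, (ENNReal.ofReal (psi w ^ a) * ‖f w‖ₑ) ^ p < ∞ := by
  have hp0 : 0 < p := by linarith
  rw [WLp, MemLp, aestronglyMeasurable_rpow_smul_iff, eLpNorm_lt_top_iff_lintegral_rpow_enorm_lt_top
    (by simpa using hp0) ENNReal.ofReal_ne_top, ENNReal.toReal_ofReal hp0.le]
  have : ∫⁻ w in unitBall n, ‖(psi w ^ a : ℝ) • f w‖ₑ ^ p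
      = ∫⁻ w in unitBall n, (ENNReal.ofReal (psi w ^ a) * ‖f w‖ₑ) ^ p := by
    refine setLIntegral_congr_fun measurableSet_unitBall fun w hw => ?_
    have := psi_pos (mem_unitBall.1 hw)
    rw [enorm_smul, Real.enorm_of_nonneg (by positivity)]
  rw [this]

theorem WLp.aestronglyMeasurable (hf : WLp p a f) :
    AEStronglyMeasurable f (volume.restrict (unitBall n)) :=
  aestronglyMeasurable_rpow_smul_iff.1 hf.1

theorem WLp.mono {b : ℝ} (hf : WLp p a f) (hab : a ≤ b) : WLp p b f := by
  refine MemLp.mono hf (aestronglyMeasurable_rpow_smul_iff.2 hf.aestronglyMeasurable)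
    (ae_unitBall_of_forall fun w hw => ?_)
  have := psi_pos (mem_unitBall.1 hw)
  rw [norm_smul, norm_smul, Real.norm_of_nonneg (by positivity), Real.norm_of_nonneg (by positivity)]
  gcongr ?_ * _
  exact Real.rpow_le_rpow_of_exponent_ge this (psi_le_one w) hab

theorem WLp.mul_psi_cpow (hf : WLp p a f) (β : ℂ) :
    WLp p (a - β.re) (fun w => f w * (psi w : ℂ) ^ β) := by
  refine MemLp.mono hf (aestronglyMeasurable_rpow_smul_iff.2
    (hf.aestronglyMeasurable.mul (measurable_psi_cpow β).aestronglyMeasurable))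
    (ae_unitBall_of_forall fun w hw => ?_)
  have := psi_pos (mem_unitBall.1 hw)
  rw [norm_smul, norm_smul, norm_mul, norm_psi_cpow β hw, Real.norm_of_nonneg (by positivity),
    Real.norm_of_nonneg (by positivity), mul_left_comm, ← Real.rpow_add this, sub_add_cancel, mul_comm]

/-- Where the constant is an inverse integral, that integral is nonnegative, and `volConst_ne_zero`
excludes 0. Hence normalization never affects membership in a weighted space. -/
theorem normConst_pos (n : ℕ) (α : ℝ) : 0 < normConst n α := by
  unfold normConst
  split_ifs with h
  · have h1 : (volConst n (α : ℂ)) = ((∫ z in unitBall n, (1 - ‖z‖ ^ 2) ^ α : ℝ) : ℂ) := by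
      rw [volConst, ← integral_complex_ofReal]
      refine setIntegral_congr_fun measurableSet_unitBall fun w hw => ?_
      have := psi_pos (mem_unitBall.1 hw)
      rw [Complex.ofReal_cpow this.le]
    have h2 := volConst_ne_zero n (β := (α : ℂ)) (by simpa using h)
    rw [h1] at h2
    have h3 : 0 ≤ ∫ z in unitBall n, (1 - ‖z‖ ^ 2) ^ α :=
      setIntegral_nonneg measurableSet_unitBall fun w hw =>
        Real.rpow_nonneg (psi_pos (mem_unitBall.1 hw)).le _
    have h4 : (∫ z in unitBall n, (1 - ‖z‖ ^ 2) ^ α) ≠ 0 := fun h => h2 (by rw [h]; simp)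
    exact inv_pos.2 (lt_of_le_of_ne h3 h4.symm)
  · exact one_pos

/-- The weight is positive in the ball, so null sets agree with those of volume, and ψ^{Re λ} =
(ψ^{Re λ/p})^p can be absorbed into the function. -/
theorem memLpWeighted_iff (hp : 1 ≤ p) (lam : ℂ) : MemLpWeighted p lam f ↔ WLp p (lam.re / p) f := by
  have hp0 : 0 < p := by linarith
  set ρ : Cn n → ℝ≥0∞ := fun z => ENNReal.ofReal ((1 - ‖z‖ ^ 2) ^ lam.re) with hρ
  have hρm : Measurable ρ := (measurable_psi.pow_const _).ennreal_ofReal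
  have hc0 := normConst_pos n lam.re
  have hac1 : (volume.restrict (unitBall n)).withDensity ρ ≪ volume.restrict (unitBall n) :=
    withDensity_absolutelyContinuous _ _
  have hac2 : volume.restrict (unitBall n) ≪ (volume.restrict (unitBall n)).withDensity ρ :=
    withDensity_absolutelyContinuous' hρm.aemeasurable (ae_unitBall_of_forall fun w hw => by
      have := Real.rpow_pos_of_pos (psi_pos (mem_unitBall.1 hw)) lam.re
      simpa [hρ] using this)
  have h1 : MemLpWeighted p lam f ↔
      MemLp f (ENNReal.ofReal p) ((volume.restrict (unitBall n)).withDensity ρ) := by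
    unfold MemLpWeighted weightedMeasure
    refine ⟨fun h => ?_, fun h => h.smul_measure ENNReal.ofReal_ne_top⟩
    have := h.smul_measure (c := (ENNReal.ofReal (normConst n lam.re))⁻¹)
      (ENNReal.inv_ne_top.2 (by simpa using hc0))
    rwa [smul_smul, ENNReal.inv_mul_cancel (by simpa using hc0) ENNReal.ofReal_ne_top, one_smul]
      at this
  rw [h1, wlp_iff hp, MemLp, eLpNorm_lt_top_iff_lintegral_rpow_enorm_lt_top
    (by simpa using hp0) ENNReal.ofReal_ne_top, ENNReal.toReal_ofReal hp0.le]
  have h2 : AEStronglyMeasurable f ((volume.restrict (unitBall n)).withDensity ρ) ↔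
      AEStronglyMeasurable f (volume.restrict (unitBall n)) :=
    ⟨fun h => h.mono_ac hac2, fun h => h.mono_ac hac1⟩
  rw [h2]
  refine and_congr_right fun hf => ?_
  rw [lintegral_withDensity_eq_lintegral_mul₀ hρm.aemeasurable (hf.enorm.pow_const p)]
  have h3 : ∫⁻ w in unitBall n, (ρ * fun w => ‖f w‖ₑ ^ p) w
      = ∫⁻ w in unitBall n, (ENNReal.ofReal (psi w ^ (lam.re / p)) * ‖f w‖ₑ) ^ p := by
    refine setLIntegral_congr_fun measurableSet_unitBall fun w hw => ?_
    have := psi_pos (mem_unitBall.1 hw)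
    rw [ENNReal.mul_rpow_of_nonneg _ _ hp0.le, ENNReal.ofReal_rpow_of_pos (by positivity),
      ← Real.rpow_mul this.le, div_mul_cancel₀ _ hp0.ne']
    rfl
  rw [h3]

theorem wlp_iff_psi_pow_mul (hp : 1 ≤ p) (α : ℝ) (k : ℕ) :
    MemLpWeighted p (α : ℂ) (fun z => (((1 - ‖z‖ ^ 2) ^ k : ℝ) : ℂ) * f z) ↔
      WLp p (α / p + k) f := by
  rw [memLpWeighted_iff hp, Complex.ofReal_re]
  refine memLp_congr_ae (ae_unitBall_of_forall fun w hw => ?_)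
  have := psi_pos (mem_unitBall.1 hw)
  simp only
  rw [Real.rpow_add this, Real.rpow_natCast, mul_smul, ← Complex.real_smul]

/-! ### Boundedness of kernel integrals -/

/-- Weighted Hölder with auxiliary weight ψ^{-1/p} reduces this to integrability of ψ^{B-1/p}, which
is the condition on B. -/
theorem lintegral_psi_mul_lt_top (hp : 1 ≤ p) {B : ℝ} (hB : -1 + p⁻¹ < B) {u : Cn n → ℝ≥0∞}
    (hu : AEMeasurable u (volume.restrict (unitBall n)))
    (hfin : ∫⁻ w in unitBall n, u w ^ p < ∞) :
    ∫⁻ w in unitBall n, ENNReal.ofReal (psi w ^ B) * u w < ∞ := by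
  have hp0 : 0 < p := by linarith
  have hpi : 0 < p⁻¹ := by positivity
  have h := lintegral_mul_rpow_le_weighted (μ := volume.restrict (unitBall n)) hp
    (measurable_psi.pow_const B) (measurable_psi.pow_const (-p⁻¹)) (ae_unitBall_of_forall
      fun w hw => by
        have := psi_pos (mem_unitBall.1 hw)
        constructor <;> positivity) hu
  refine (ENNReal.rpow_lt_top_iff_of_pos hp0).1 (h.trans_lt (ENNReal.mul_lt_top ?_ ?_))
  · refine ENNReal.rpow_lt_top_of_nonneg (by linarith) (ne_of_lt ?_)
    refine lt_of_le_of_lt (le_of_eq ?_) (lintegral_psi_rpow_lt_top n (t := B - p⁻¹) (by linarith))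
    refine setLIntegral_congr_fun measurableSet_unitBall fun w hw => ?_
    have := psi_pos (mem_unitBall.1 hw)
    rw [← Real.rpow_add this, sub_eq_add_neg]
  · refine lt_of_le_of_lt (setLIntegral_mono' measurableSet_unitBall fun w hw => ?_) hfin
    have := psi_pos (mem_unitBall.1 hw)
    refine mul_le_of_le_one_left zero_le ?_
    rw [← Real.rpow_mul this.le, ← Real.rpow_add this, ENNReal.ofReal_le_one]
    refine Real.rpow_le_one this.le (psi_le_one w) ?_
    have : -p⁻¹ * -(p - 1) = 1 - p⁻¹ := by field_simp
    rw [this]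
    linarith

theorem ofReal_psi_rpow_mul_cancel {w : Cn n} (hw : w ∈ unitBall n) (B : ℝ) (x : ℝ≥0∞) :
    ENNReal.ofReal (psi w ^ B) * (ENNReal.ofReal (psi w ^ (-B)) * x) = x := by
  have := psi_pos (mem_unitBall.1 hw)
  rw [← mul_assoc, ← ENNReal.ofReal_mul (by positivity), ← Real.rpow_add this]
  simp

theorem WLp.aemeasurable_enorm (hf : WLp p a f) :
    AEMeasurable (fun w => ENNReal.ofReal (psi w ^ a) * ‖f w‖ₑ) (volume.restrict (unitBall n)) :=
  (measurable_psi.pow_const a).ennreal_ofReal.aemeasurable.mul hf.aestronglyMeasurable.enorm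

theorem WLp.integrableOn (hp : 1 ≤ p) {B : ℝ} (hB : -1 + p⁻¹ < B) (hf : WLp p (-B) f) :
    IntegrableOn f (unitBall n) := by
  refine ⟨hf.aestronglyMeasurable, lt_of_le_of_lt (le_of_eq ?_)
    (lintegral_psi_mul_lt_top hp hB hf.aemeasurable_enorm ((wlp_iff hp).1 hf).2)⟩
  exact setLIntegral_congr_fun measurableSet_unitBall fun w hw =>
    (ofReal_psi_rpow_mul_cancel hw B _).symm

theorem schur_abs (hn : 0 < n) {A B : ℝ} (hp : 1 ≤ p) (hA : -p⁻¹ < A) (hB : -1 + p⁻¹ < B)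
    (hf : WLp p (-B) f) :
    ∫⁻ z in unitBall n, (ENNReal.ofReal (psi z ^ A) * ∫⁻ w in unitBall n,
      ‖f w‖ₑ * ENNReal.ofReal (‖1 - pairing z w‖ ^ (-(n + 1 + A + B)))) ^ p < ∞ := by
  obtain ⟨C, hC, h⟩ := schur_test hn hp hA hB
  refine lt_of_le_of_lt (le_of_eq ?_) ((h _ hf.aemeasurable_enorm).trans_lt
    (ENNReal.mul_lt_top hC.lt_top ((wlp_iff hp).1 hf).2))
  refine setLIntegral_congr_fun measurableSet_unitBall fun z hz => ?_
  rw [← lintegral_const_mul' _ _ ENNReal.ofReal_ne_top]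
  congr 1
  refine setLIntegral_congr_fun measurableSet_unitBall fun w hw => ?_
  have h1 := psi_pos (mem_unitBall.1 hz)
  have h2 := psi_pos (mem_unitBall.1 hw)
  rw [schurKer, ENNReal.ofReal_mul (by positivity), ENNReal.ofReal_mul (by positivity)]
  conv_lhs => rw [← ofReal_psi_rpow_mul_cancel hw B ‖f w‖ₑ]
  ring

theorem enorm_kerInt_le {c : ℂ} {s : ℝ} (hs : c.re ≤ s) : ∃ C : ℝ, ∀ H : Cn n → ℂ,
    ∀ z ∈ unitBall n, ‖kerInt c H z‖ₑ ≤ ENNReal.ofReal C *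
      ∫⁻ w in unitBall n, ‖H w‖ₑ * ENNReal.ofReal (‖1 - pairing z w‖ ^ (-s)) := by
  obtain ⟨C, hC, h⟩ := norm_ker_le_rpow (n := n) c hs
  refine ⟨C, fun H z hz => ?_⟩
  refine (enorm_integral_le_lintegral_enorm _).trans ?_
  rw [← lintegral_const_mul' _ _ ENNReal.ofReal_ne_top]
  refine setLIntegral_mono' measurableSet_unitBall fun w hw => ?_
  rw [enorm_mul, mul_left_comm, ← ENNReal.ofReal_mul hC.le, ← ofReal_norm (ker c z w)]
  gcongr
  exact h z hz w hw

theorem wlp_kerInt (hn : 0 < n) {A B : ℝ} (hp : 1 ≤ p) (hA : -p⁻¹ < A) (hB : -1 + p⁻¹ < B)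
    (hf : WLp p (-B) f) {c : ℂ} (hc : c.re ≤ n + 1 + A + B) : WLp p A (kerInt c f) := by
  have hp0 : 0 < p := by linarith
  rw [wlp_iff hp]
  refine ⟨(differentiableOn_kerInt c (hf.integrableOn hp hB)).continuousOn.aestronglyMeasurable
    measurableSet_unitBall, ?_⟩
  obtain ⟨C, h⟩ := enorm_kerInt_le (n := n) hc
  have h1 := schur_abs hn hp hA hB hf
  refine lt_of_le_of_lt (setLIntegral_mono' measurableSet_unitBall fun z hz =>
    ENNReal.rpow_le_rpow (mul_le_mul_right (h f z hz) _) hp0.le) ?_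
  simp only [mul_left_comm _ (ENNReal.ofReal C), ENNReal.mul_rpow_of_nonneg (ENNReal.ofReal C) _ hp0.le]
  rw [lintegral_const_mul' _ _ (ENNReal.rpow_ne_top_of_nonneg hp0.le ENNReal.ofReal_ne_top)]
  exact ENNReal.mul_lt_top (ENNReal.rpow_lt_top_of_nonneg hp0.le ENNReal.ofReal_ne_top) h1

theorem wlp_of_norm_le {C L : ℝ} (hp : 1 ≤ p) (hf : ContinuousOn f (unitBall n))
    (hL : 0 ≤ L) (hbd : ∀ z ∈ unitBall n, ‖f z‖ ≤ C * (1 - ‖z‖) ^ (-L)) (ha : -1 < p * (a - L)) :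
    WLp p a f := by
  have hp0 : 0 < p := by linarith
  rw [wlp_iff hp]
  refine ⟨hf.aestronglyMeasurable measurableSet_unitBall, ?_⟩
  have h0 : 0 ≤ C := by
    have := (norm_nonneg _).trans (hbd 0 zero_mem_unitBall)
    simpa using this
  refine lt_of_le_of_lt (setLIntegral_mono' (g := fun z => ENNReal.ofReal ((C * 2 ^ L) ^ p) *
    ENNReal.ofReal (psi z ^ (p * (a - L)))) measurableSet_unitBall fun z hz => ?_) ?_
  · have hψ := psi_pos (mem_unitBall.1 hz)
    have h1 : 0 < 1 - ‖z‖ := by linarith [mem_unitBall.1 hz]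
    have h2 : psi z ≤ 2 * (1 - ‖z‖) := by
      simp only [psi]; nlinarith [mem_unitBall.1 hz, norm_nonneg z]
    rw [← ofReal_norm, ← ENNReal.ofReal_mul (by positivity), ← ENNReal.ofReal_mul (by positivity),
      ENNReal.ofReal_rpow_of_nonneg (by positivity) hp0.le]
    refine ENNReal.ofReal_le_ofReal ?_
    rw [mul_comm p, Real.rpow_mul hψ.le, ← Real.mul_rpow (by positivity) (by positivity)]
    refine Real.rpow_le_rpow (by positivity) ?_ hp0.le
    calc psi z ^ a * ‖f z‖ ≤ psi z ^ a * (C * (1 - ‖z‖) ^ (-L)) := by gcongr; exact hbd z hz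
      _ ≤ psi z ^ a * (C * (psi z / 2) ^ (-L)) := by
          gcongr _ * (_ * ?_)
          exact Real.rpow_le_rpow_of_nonpos (by positivity) (by linarith) (by linarith)
      _ = _ := by
          rw [Real.div_rpow hψ.le (by norm_num), Real.rpow_neg (by norm_num : (0 : ℝ) ≤ 2),
            sub_eq_add_neg, Real.rpow_add hψ, div_inv_eq_mul]
          ring
  · rw [lintegral_const_mul' _ _ ENNReal.ofReal_ne_top]
    exact ENNReal.mul_lt_top ENNReal.ofReal_lt_top (lintegral_psi_rpow_lt_top n ha)

end

section

variable {n : ℕ} {p a : ℝ} {f g : Cn n → ℂ}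

/-! ### The radial derivative of holomorphic functions -/

theorem radialDeriv_congr (h : ∀ w ∈ unitBall n, f w = g w) {z : Cn n} (hz : z ∈ unitBall n) :
    radialDeriv f z = radialDeriv g z := by
  have : f =ᶠ[𝓝 z] g := by
    filter_upwards [isOpen_unitBall.mem_nhds hz] with w hw using h w hw
  rw [radialDeriv_eq_fderiv, radialDeriv_eq_fderiv, this.fderiv_eq]

theorem radialDeriv_iterate_congr (h : ∀ w ∈ unitBall n, f w = g w) (k : ℕ) {z : Cn n}
    (hz : z ∈ unitBall n) : radialDeriv^[k] f z = radialDeriv^[k] g z := by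
  induction k generalizing z with
  | zero => exact h z hz
  | succ k ih =>
    rw [Function.iterate_succ_apply', Function.iterate_succ_apply']
    exact radialDeriv_congr (fun w hw => ih hw) hz

theorem DifferentiableOn.differentiableAt_of_mem_unitBall
    (hf : DifferentiableOn ℂ f (unitBall n)) {z : Cn n} (hz : z ∈ unitBall n) :
    DifferentiableAt ℂ f z :=
  hf.differentiableAt (isOpen_unitBall.mem_nhds hz)

theorem radialDeriv_const_mul (hf : DifferentiableOn ℂ f (unitBall n)) (c : ℂ) {z : Cn n}
    (hz : z ∈ unitBall n) : radialDeriv (fun w => c * f w) z = c * radialDeriv f z := by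
  have := DifferentiableOn.differentiableAt_of_mem_unitBall hf hz
  rw [radialDeriv_eq_fderiv, radialDeriv_eq_fderiv, fderiv_const_mul this]
  rfl

theorem radialDeriv_add (hf : DifferentiableOn ℂ f (unitBall n))
    (hg : DifferentiableOn ℂ g (unitBall n)) {z : Cn n} (hz : z ∈ unitBall n) :
    radialDeriv (fun w => f w + g w) z = radialDeriv f z + radialDeriv g z := by
  have h1 := DifferentiableOn.differentiableAt_of_mem_unitBall hf hz
  have h2 := DifferentiableOn.differentiableAt_of_mem_unitBall hg hz
  simp only [radialDeriv_eq_fderiv]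
  rw [show (fun w => f w + g w) = f + g from rfl, fderiv_add h1 h2]
  rfl

theorem radialDeriv_sum {ι : Type*} (s : Finset ι) (c : ι → ℂ) {F : ι → Cn n → ℂ}
    (hF : ∀ i ∈ s, DifferentiableOn ℂ (F i) (unitBall n)) {z : Cn n} (hz : z ∈ unitBall n) :
    radialDeriv (fun w => ∑ i ∈ s, c i * F i w) z = ∑ i ∈ s, c i * radialDeriv (F i) z := by
  have h1 : ∀ i ∈ s, DifferentiableAt ℂ (fun w => c i * F i w) z := fun i hi =>
    (DifferentiableOn.differentiableAt_of_mem_unitBall (hF i hi) hz).const_mul _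
  rw [radialDeriv_eq_fderiv, fderiv_fun_sum h1, sum_apply]
  refine Finset.sum_congr rfl fun i hi => ?_
  rw [← radialDeriv_eq_fderiv, radialDeriv_const_mul (hF i hi) _ hz]

/-- A dilate of f is holomorphic on a neighbourhood of the closed ball, hence integrable, and the
unweighted reproducing formula makes it a kernel integral. Its radial derivative is then a
combination of kernel integrals, and R commutes with dilations. -/
theorem differentiableOn_radialDeriv (hn : 0 < n) (hf : DifferentiableOn ℂ f (unitBall n)) :
    DifferentiableOn ℂ (radialDeriv f) (unitBall n) := by
  intro z hz
  obtain ⟨r, hr1, hr2⟩ := exists_between (mem_unitBall.1 hz)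
  have hr0 : 0 < r := (norm_nonneg z).trans_lt hr1
  have hrc : (r : ℂ) ≠ 0 := by exact_mod_cast hr0.ne'
  have hmem : ∀ w ∈ closedBall (0 : Cn n) 1, (r : ℂ) • w ∈ unitBall n := fun w hw => by
    rw [mem_closedBall_zero_iff] at hw
    rw [mem_unitBall, norm_smul, Complex.norm_real, Real.norm_of_nonneg hr0.le]
    nlinarith
  set h : Cn n → ℂ := fun w => f ((r : ℂ) • w) with hh
  have hd : DifferentiableOn ℂ h (closedBall 0 1) :=
    hf.comp (f := fun w : Cn n => (r : ℂ) • w) (by fun_prop) hmem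
  have hd' : DifferentiableOn ℂ h (unitBall n) := hd.mono ball_subset_closedBall
  have hint : IntegrableOn h (unitBall n) :=
    (hd.continuousOn.integrableOn_compact (isCompact_closedBall 0 1)).mono_set ball_subset_closedBall
  have hC := volConst_ne_zero n (β := 0) (by simp)
  have hrep : ∀ w ∈ unitBall n, h w = (volConst n 0)⁻¹ * kerInt (n + 1) h w := fun w hw => by
    have := kerInt_reproducing hn (β := 0) (by simp) hd' (by simpa using hint) hw
    simp only [Complex.cpow_zero, mul_one, add_zero] at this
    rw [this, inv_mul_cancel_left₀ hC]
  have hR : ∀ w ∈ unitBall n, radialDeriv h w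
      = (volConst n 0)⁻¹ * ((n + 1) * (kerInt (n + 1 + 1) h w - kerInt (n + 1) h w)) :=
    fun w hw => by
      rw [radialDeriv_congr hrep hw, radialDeriv_const_mul (differentiableOn_kerInt _ hint) _ hw,
        radialDeriv_kerInt _ hint hw]
  have hRd : DifferentiableOn ℂ (radialDeriv h) (unitBall n) := by
    refine DifferentiableOn.congr ?_ hR
    exact (((differentiableOn_kerInt _ hint).sub (differentiableOn_kerInt _ hint)).const_mul
      _).const_mul _
  have hscale : ∀ w ∈ ball (0 : Cn n) r, radialDeriv f w = radialDeriv h ((r : ℂ)⁻¹ • w) ∧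
      (r : ℂ)⁻¹ • w ∈ unitBall n := fun w hw => by
    have hw' : ‖w‖ < r := by simpa using hw
    have h1 : (r : ℂ)⁻¹ • w ∈ unitBall n := by
      rw [mem_unitBall, norm_smul, norm_inv, Complex.norm_real, Real.norm_of_nonneg hr0.le,
        inv_mul_lt_one₀ hr0]
      exact hw'
    refine ⟨?_, h1⟩
    have h2 : w ∈ unitBall n := mem_unitBall.2 (hw'.trans hr2)
    have h3 : HasFDerivAt h ((r : ℂ) • fderiv ℂ f w) ((r : ℂ)⁻¹ • w) := by
      have h4 : HasFDerivAt f (fderiv ℂ f w) ((r : ℂ) • (r : ℂ)⁻¹ • w) := by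
        rw [smul_inv_smul₀ hrc]
        exact (DifferentiableOn.differentiableAt_of_mem_unitBall hf h2).hasFDerivAt
      have h5 : HasFDerivAt (fun w : Cn n => (r : ℂ) • w)
          ((r : ℂ) • ContinuousLinearMap.id ℂ (Cn n)) ((r : ℂ)⁻¹ • w) :=
        ((r : ℂ) • ContinuousLinearMap.id ℂ (Cn n)).hasFDerivAt
      refine (h4.comp _ h5).congr_fderiv ?_
      ext v; simp
    rw [radialDeriv_eq_fderiv, radialDeriv_eq_fderiv, h3.fderiv]
    simp [hrc]
  have hcomp : DifferentiableOn ℂ (fun w => radialDeriv h ((r : ℂ)⁻¹ • w)) (ball 0 r) :=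
    hRd.comp (f := fun w : Cn n => (r : ℂ)⁻¹ • w) (by fun_prop) fun w hw => (hscale w hw).2
  have hfin := hcomp.congr fun w hw => (hscale w hw).1
  exact (hfin.differentiableAt (isOpen_ball.mem_nhds (by simpa using hr1))).differentiableWithinAt

theorem differentiableOn_radialDeriv_iterate (hn : 0 < n)
    (hf : DifferentiableOn ℂ f (unitBall n)) (k : ℕ) :
    DifferentiableOn ℂ (radialDeriv^[k] f) (unitBall n) := by
  induction k with
  | zero => exact hf
  | succ k ih =>
    rw [Function.iterate_succ_apply']
    exact differentiableOn_radialDeriv hn ih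

/-- A holomorphic function with `Rφ = -aφ` vanishes unless `-a` is a natural number. -/
theorem eq_zero_of_radialDeriv_eq {φ : Cn n → ℂ} (hφ : DifferentiableOn ℂ φ (unitBall n)) {a : ℂ}
    (ha : ∀ m : ℕ, a ≠ -m) (h : ∀ z ∈ unitBall n, radialDeriv φ z + a * φ z = 0) :
    ∀ z ∈ unitBall n, φ z = 0 := by
  intro z hz
  set U : Set ℂ := (fun ζ : ℂ => ζ • z) ⁻¹' unitBall n with hU
  have hUo : IsOpen U := isOpen_unitBall.preimage (by fun_prop)
  have hUc : IsPreconnected U := by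
    have : Convex ℝ U := by
      have := (convex_ball (0 : Cn n) 1).linear_preimage
        (((LinearMap.toSpanSingleton ℂ (Cn n) z)).restrictScalars ℝ)
      exact this
    exact this.isPreconnected
  have h0U : (0 : ℂ) ∈ U := by simp [hU, mem_unitBall]
  have h1U : (1 : ℂ) ∈ U := by simpa [hU] using hz
  set G : ℂ → ℂ := fun ζ => φ (ζ • z) with hG
  have hGd : DifferentiableOn ℂ G U :=
    hφ.comp (f := fun ζ : ℂ => ζ • z) (by fun_prop) fun _ h => h
  have hGan : AnalyticOnNhd ℂ G U := hGd.analyticOnNhd hUo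
  have hode : ∀ ζ ∈ U, ζ * deriv G ζ = -a * G ζ := fun ζ hζ => by
    have h2 := (DifferentiableOn.differentiableAt_of_mem_unitBall hφ hζ).hasFDerivAt
    have h3 : HasDerivAt (fun ζ : ℂ => ζ • z) z ζ := by
      simpa using (hasDerivAt_id ζ).smul_const z
    have h4 : HasDerivAt G (fderiv ℂ φ (ζ • z) z) ζ := h2.comp_hasDerivAt ζ h3
    have h5 := h _ hζ
    rw [radialDeriv_eq_fderiv, map_smul, smul_eq_mul] at h5
    rw [h4.deriv]
    linear_combination h5
  have hev : ∀ᶠ ζ in 𝓝 (0 : ℂ), G ζ = 0 := by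
    -- If G does not vanish near 0, write G = ζ^m ψ(ζ) with ψ(0) ≠ 0. Dividing the equation ζG' =
    -- -aG by ζ^m and letting ζ → 0 gives m + a = 0.
    by_contra hne
    obtain ⟨m, ψ, hψ, hψ0, heq⟩ := (hGan 0 h0U).exists_eventuallyEq_pow_smul_nonzero_iff.2 hne
    simp only [sub_zero, smul_eq_mul] at heq
    have heq' : ∀ᶠ ζ in 𝓝 (0 : ℂ), deriv G ζ = m * ζ ^ (m - 1) * ψ ζ + ζ ^ m * deriv ψ ζ := by
      filter_upwards [heq.eventually_nhds, hψ.eventually_analyticAt] with ζ h1 h2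
      rw [Filter.EventuallyEq.deriv_eq h1]
      exact ((hasDerivAt_pow m ζ).mul h2.differentiableAt.hasDerivAt).deriv
    have hzero : ∀ᶠ ζ in 𝓝[≠] (0 : ℂ), (m + a) * ψ ζ + ζ * deriv ψ ζ = 0 := by
      filter_upwards [heq.filter_mono nhdsWithin_le_nhds, heq'.filter_mono nhdsWithin_le_nhds,
        nhdsWithin_le_nhds (hUo.mem_nhds h0U), self_mem_nhdsWithin] with ζ h1 h2 h3 h4
      have h5 := hode ζ h3
      have h4' : ζ ≠ 0 := h4
      rw [h1, h2] at h5
      have h6 : (m : ℂ) * ζ ^ (m - 1) * ζ = m * ζ ^ m := by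
        rcases m with _ | m
        · simp
        · rw [Nat.add_sub_cancel, pow_succ]; ring
      refine mul_left_cancel₀ (pow_ne_zero m h4') ?_
      rw [mul_zero]
      linear_combination h5 - ψ ζ * h6
    have hcont : ContinuousAt (fun ζ => (m + a) * ψ ζ + ζ * deriv ψ ζ) 0 :=
      (continuousAt_const.mul hψ.continuousAt).add (continuousAt_id.mul hψ.deriv.continuousAt)
    have hlim := tendsto_nhds_unique ((hcont.tendsto.mono_left nhdsWithin_le_nhds).congr' hzero)
      (tendsto_const_nhds (x := (0 : ℂ)))
    simp only [zero_mul, add_zero, mul_eq_zero, hψ0, or_false] at hlim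
    exact ha m (by linear_combination hlim)
  have := hGan.eqOn_zero_of_preconnected_of_eventuallyEq_zero hUc h0U hev h1U
  simpa [hG] using this

/-! ### Shifted radial derivatives -/

/-- The differential operators `∏_{i < j} (1 + (c + i)⁻¹ R)`. -/
def shiftDeriv (c : ℂ) : ℕ → (Cn n → ℂ) → Cn n → ℂ
  | 0, f => f
  | j + 1, f => fun z => shiftDeriv c j f z + (c + j)⁻¹ * radialDeriv (shiftDeriv c j f) z

theorem shiftDeriv_succ (c : ℂ) (j : ℕ) (f : Cn n → ℂ) (z : Cn n) : shiftDeriv c (j + 1) f z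
    = shiftDeriv c j f z + (c + j)⁻¹ * radialDeriv (shiftDeriv c j f) z := rfl

theorem differentiableOn_shiftDeriv (hn : 0 < n) (c : ℂ) (j : ℕ)
    (hf : DifferentiableOn ℂ f (unitBall n)) :
    DifferentiableOn ℂ (shiftDeriv c j f) (unitBall n) := by
  induction j with
  | zero => exact hf
  | succ j ih => exact ih.add ((differentiableOn_radialDeriv hn ih).const_mul _)

/-- Each factor 1 + (c + j)⁻¹R moves the exponent from c + j to c + j + 1; the divisions are
legitimate because c is not a nonpositive integer. -/
theorem shiftDeriv_kerInt {c : ℂ} (hc : ∀ m : ℕ, c ≠ -m) {H : Cn n → ℂ}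
    (hH : IntegrableOn H (unitBall n)) (j : ℕ) :
    ∀ z ∈ unitBall n, shiftDeriv c j (kerInt c H) z = kerInt (c + j) H z := by
  induction j with
  | zero => intro z _; simp [shiftDeriv]
  | succ j ih =>
    intro z hz
    have h0 : c + j ≠ 0 := fun h => hc j (by linear_combination h)
    rw [shiftDeriv_succ, ih z hz, radialDeriv_congr ih hz, radialDeriv_kerInt _ hH hz,
      inv_mul_cancel_left₀ h0]
    push_cast
    rw [add_assoc c j 1]; ring

theorem shiftDeriv_eq_sum (hn : 0 < n) (c : ℂ) (j : ℕ) : ∃ e : ℕ → ℂ, ∀ f : Cn n → ℂ,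
    DifferentiableOn ℂ f (unitBall n) → ∀ z ∈ unitBall n,
      shiftDeriv c j f z = ∑ i ∈ Finset.range (j + 1), e i * radialDeriv^[i] f z := by
  induction j with
  | zero => exact ⟨fun _ => 1, fun f _ z _ => by simp [shiftDeriv]⟩
  | succ j ih =>
    obtain ⟨e, he⟩ := ih
    refine ⟨fun i => (if i < j + 1 then e i else 0) +
      (c + j)⁻¹ * (if i = 0 then 0 else e (i - 1)), fun f hf z hz => ?_⟩
    have h1 : radialDeriv (shiftDeriv c j f) z
        = ∑ i ∈ Finset.range (j + 1), e i * radialDeriv^[i + 1] f z := by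
      rw [radialDeriv_congr (he f hf) hz, radialDeriv_sum _ _
        (fun i _ => differentiableOn_radialDeriv_iterate hn hf i) hz]
      simp only [Function.iterate_succ_apply']
    rw [shiftDeriv_succ, he f hf z hz, h1]
    simp only [add_mul, Finset.sum_add_distrib]
    congr 1
    · rw [Finset.sum_range_succ _ (j + 1)]
      simp only [lt_self_iff_false, if_false, zero_mul, add_zero]
      refine Finset.sum_congr rfl fun i hi => ?_
      rw [if_pos (Finset.mem_range.1 hi)]
    · rw [Finset.sum_range_succ' _ (j + 1), Finset.mul_sum]
      simp only [if_true, mul_zero, zero_mul, add_zero, Nat.add_eq_zero_iff, one_ne_zero, and_false,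
        if_false, Nat.add_sub_cancel, mul_assoc]

/-- The factors are peeled off one at a time: a holomorphic kernel element of R + (c + j) vanishes,
since homogeneous components have degrees in ℕ and c + j is never minus a natural number. -/
theorem shiftDeriv_injective (hn : 0 < n) {c : ℂ} (hc : ∀ m : ℕ, c ≠ -m) (K : ℂ)
    (hf : DifferentiableOn ℂ f (unitBall n)) (hg : DifferentiableOn ℂ g (unitBall n)) (j : ℕ)
    (h : ∀ z ∈ unitBall n, shiftDeriv c j f z = K * shiftDeriv c j g z) :
    ∀ z ∈ unitBall n, f z = K * g z := by
  induction j with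
  | zero => exact h
  | succ j ih =>
    have h0 : c + j ≠ 0 := fun h => hc j (by linear_combination h)
    refine ih fun z hz => ?_
    have hfj := differentiableOn_shiftDeriv hn c j hf
    have hgj := differentiableOn_shiftDeriv hn c j hg
    have := eq_zero_of_radialDeriv_eq (φ := fun z => shiftDeriv c j f z + -K * shiftDeriv c j g z)
      (hfj.add (hgj.const_mul _)) (a := c + j)
      (fun m hm => hc (j + m) (by push_cast; linear_combination hm)) (fun z hz => by
        rw [radialDeriv_add hfj (hgj.const_mul _) hz, radialDeriv_const_mul hgj _ hz]
        have h1 := h z hz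
        simp only [shiftDeriv_succ] at h1
        field_simp at h1
        linear_combination h1) z hz
    linear_combination this

theorem radialDeriv_iterate_kerInt (c : ℂ) (k : ℕ) : ∃ e : ℕ → ℂ, ∀ H : Cn n → ℂ,
    IntegrableOn H (unitBall n) → ∀ z ∈ unitBall n, radialDeriv^[k] (kerInt c H) z
      = ∑ i ∈ Finset.range (k + 1), e i * kerInt (c + i) H z := by
  induction k with
  | zero => exact ⟨fun _ => 1, fun f _ z _ => by simp⟩
  | succ k ih =>
    obtain ⟨e, he⟩ := ih
    refine ⟨fun i => (if i < k + 1 then -(e i * (c + i)) else 0) +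
      (if i = 0 then 0 else e (i - 1) * (c + (i - 1 : ℕ))), fun H hH z hz => ?_⟩
    rw [Function.iterate_succ_apply', radialDeriv_congr (he H hH) hz, radialDeriv_sum _ _
      (fun i _ => differentiableOn_kerInt _ hH) hz]
    simp only [add_mul, Finset.sum_add_distrib]
    rw [Finset.sum_range_succ _ (k + 1), Finset.sum_range_succ' _ (k + 1)]
    simp only [lt_self_iff_false, if_false, zero_mul, add_zero, if_true, Nat.add_sub_cancel,
      Nat.add_eq_zero_iff, one_ne_zero, and_false]
    rw [← Finset.sum_add_distrib]
    refine Finset.sum_congr rfl fun i hi => ?_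
    rw [if_pos (Finset.mem_range.1 hi), radialDeriv_kerInt _ hH hz]
    push_cast
    rw [add_assoc c i 1]; ring

/-! ### Growth of holomorphic functions -/

/-- Reproduce f with weight exponent a + 1, differentiate the kernel, and apply the Schur bound with
A = a + 1 and B = 1; one derivative costs one power of ψ. -/
theorem wlp_radialDeriv (hn : 0 < n) (hp : 1 ≤ p) (hf : DifferentiableOn ℂ f (unitBall n))
    (ha : -p⁻¹ < a) (h : WLp p a f) : WLp p (a + 1) (radialDeriv f) := by
  have hp0 : 0 < p := by linarith
  have hp1 : p⁻¹ ≤ 1 := inv_le_one_of_one_le₀ hp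
  set β : ℂ := ((a + 1 : ℝ) : ℂ) with hβ
  have hβre : β.re = a + 1 := Complex.ofReal_re _
  have hβ1 : -1 < β.re := by rw [hβre]; linarith
  have hH := h.mul_psi_cpow β
  set H : Cn n → ℂ := fun w => f w * (psi w : ℂ) ^ β with hHdef
  rw [hβre, show a - (a + 1) = -1 by ring] at hH
  have hB : -1 + p⁻¹ < 1 := by linarith
  have hHi := hH.integrableOn hp hB
  have hC := volConst_ne_zero n hβ1
  have hrep : ∀ w ∈ unitBall n, f w = (volConst n β)⁻¹ * kerInt (n + 1 + β) H w := fun w hw => by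
    rw [kerInt_reproducing hn hβ1 hf hHi hw, inv_mul_cancel_left₀ hC]
  have hd := differentiableOn_kerInt (n + 1 + β) hHi
  refine (wlp_congr fun w hw => ?_).2 (((wlp_kerInt hn hp (A := a + 1) (by linarith) hB hH
    (c := n + 1 + β + 1) ?_).add ((wlp_kerInt hn hp (A := a + 1) (by linarith) hB hH
    (c := n + 1 + β) ?_).const_mul (-1))).const_mul ((volConst n β)⁻¹ * (n + 1 + β)))
  · rw [radialDeriv_congr hrep hw, radialDeriv_const_mul hd _ hw, radialDeriv_kerInt _ hHi hw]
    ring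
  · simp [hβre]
  · simp [hβre]

theorem wlp_radialDeriv_iterate (hn : 0 < n) (hp : 1 ≤ p) (hf : DifferentiableOn ℂ f (unitBall n))
    (ha : -p⁻¹ < a) (h : WLp p a f) (i : ℕ) : WLp p (a + i) (radialDeriv^[i] f) := by
  induction i with
  | zero => simpa using h
  | succ i ih =>
    rw [Function.iterate_succ_apply']
    push_cast
    rw [← add_assoc]
    have : (0 : ℝ) ≤ i := Nat.cast_nonneg i
    exact wlp_radialDeriv hn hp (differentiableOn_radialDeriv_iterate hn hf i) (by linarith) ih

/-- Polynomial growth at the boundary of the ball. -/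
def PolyGrowth (f : Cn n → ℂ) : Prop :=
  ∃ C L : ℝ, 0 < C ∧ 0 ≤ L ∧ ∀ z ∈ unitBall n, ‖f z‖ ≤ C * (1 - ‖z‖) ^ (-L)

/-- Reproduce f with a weight exponent so large that fψ^β is integrable; the kernel itself grows
only polynomially. -/
theorem WLp.polyGrowth (hn : 0 < n) (hp : 1 ≤ p) (hf : DifferentiableOn ℂ f (unitBall n))
    (h : WLp p a f) : PolyGrowth f := by
  have hp1 : p⁻¹ ≤ 1 := inv_le_one_of_one_le₀ hp
  set β : ℂ := ((|a| + 1 : ℝ) : ℂ) with hβ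
  have hβre : β.re = |a| + 1 := Complex.ofReal_re _
  have hβ1 : -1 < β.re := by rw [hβre]; linarith [abs_nonneg a]
  have hH := h.mul_psi_cpow β
  rw [hβre, show a - (|a| + 1) = -(|a| + 1 - a) by ring] at hH
  have hHi := hH.integrableOn hp (by linarith [le_abs_self a])
  have hC := volConst_ne_zero n hβ1
  obtain ⟨C, L, hC0, hL, hb⟩ := norm_kerInt_le (n + 1 + β) hHi
  refine ⟨‖volConst n β‖⁻¹ * C, L, by positivity, hL, fun z hz => ?_⟩
  have := hb z hz
  rw [kerInt_reproducing hn hβ1 hf hHi hz, norm_mul] at this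
  rw [mul_assoc, ← div_eq_inv_mul, le_div_iff₀ (by positivity), mul_comm]
  exact this

/-- Integrate along the radius from the sphere |z| = 1/2, where compactness bounds f. There Rf(tz)
is t times the derivative along the ray and t > 1/2, whence the factor 2. -/
theorem PolyGrowth.of_radialDeriv (hf : DifferentiableOn ℂ f (unitBall n))
    (h : PolyGrowth (radialDeriv f)) : PolyGrowth f := by
  obtain ⟨C, L, hC, hL, hb⟩ := h
  have hsub : closedBall (0 : Cn n) (1 / 2) ⊆ unitBall n := closedBall_subset_ball (by norm_num)
  obtain ⟨K, hK⟩ := (isCompact_closedBall (0 : Cn n) (1 / 2)).exists_bound_of_continuousOn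
    (hf.continuousOn.mono hsub)
  have hK0 : 0 ≤ K := (norm_nonneg _).trans (hK 0 (by simp))
  refine ⟨K + 2 * C, L, by positivity, hL, fun z hz => ?_⟩
  have hz1 := mem_unitBall.1 hz
  have hone : 1 ≤ (1 - ‖z‖) ^ (-L) :=
    Real.one_le_rpow_of_pos_of_le_one_of_nonpos (by linarith) (by linarith [norm_nonneg z])
      (by linarith)
  rcases le_or_gt ‖z‖ (1 / 2) with hz2 | hz2
  · calc ‖f z‖ ≤ K := hK z (by simpa using hz2)
      _ ≤ K * (1 - ‖z‖) ^ (-L) := le_mul_of_one_le_right hK0 hone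
      _ ≤ _ := by gcongr; linarith
  · have hzpos : 0 < ‖z‖ := by linarith
    set t₀ : ℝ := 1 / 2 / ‖z‖ with ht₀
    have ht1 : t₀ < 1 := by rw [ht₀, div_lt_one hzpos]; exact hz2
    have ht2 : 1 / 2 < t₀ := by rw [ht₀, lt_div_iff₀ hzpos]; linarith
    have hmem : ∀ t ∈ Icc t₀ 1, t • z ∈ unitBall n := fun t ht => by
      rw [mem_unitBall, norm_smul, Real.norm_of_nonneg (by linarith [ht.1])]
      exact (mul_le_of_le_one_left (norm_nonneg _) ht.2).trans_lt hz1
    have hder : ∀ t ∈ Icc t₀ 1, HasDerivWithinAt (fun t : ℝ => f (t • z))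
        (fderiv ℂ f (t • z) z) (Icc t₀ 1) t := fun t ht => by
      have h1 := ((DifferentiableOn.differentiableAt_of_mem_unitBall hf
        (hmem t ht)).hasFDerivAt.restrictScalars ℝ)
      have h2 : HasDerivAt (fun t : ℝ => t • z) z t := by
        simpa using (hasDerivAt_id t).smul_const z
      exact (h1.comp_hasDerivAt t h2).hasDerivWithinAt
    have hbd : ∀ t ∈ Ico t₀ 1, ‖fderiv ℂ f (t • z) z‖ ≤ 2 * C * (1 - ‖z‖) ^ (-L) := fun t ht => by
      have ht' : 1 / 2 < t := ht2.trans_le ht.1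
      have h1 := hb _ (hmem t ⟨ht.1, ht.2.le⟩)
      have h2 : radialDeriv f (t • z) = (t : ℂ) * fderiv ℂ f (t • z) z := by
        rw [radialDeriv_eq_fderiv]
        conv_lhs => rw [← Complex.coe_smul t z]
        rw [map_smul, Complex.coe_smul]; rfl
      rw [h2, norm_mul, Complex.norm_real, Real.norm_of_nonneg (by linarith)] at h1
      have h3 : (1 - ‖t • z‖) ^ (-L) ≤ (1 - ‖z‖) ^ (-L) := by
        refine Real.rpow_le_rpow_of_nonpos (by linarith) ?_ (by linarith)
        rw [norm_smul, Real.norm_of_nonneg (by linarith)]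
        have := mul_le_of_le_one_left (norm_nonneg z) ht.2.le
        linarith
      have h4 : t * ‖fderiv ℂ f (t • z) z‖ ≤ C * (1 - ‖z‖) ^ (-L) := h1.trans (by gcongr)
      have h5 := norm_nonneg (fderiv ℂ f (t • z) z)
      nlinarith
    have hmv := norm_image_sub_le_of_norm_deriv_le_segment' hder hbd 1 ⟨ht1.le, le_rfl⟩
    simp only [one_smul] at hmv
    have h6 : ‖f (t₀ • z)‖ ≤ K := by
      refine hK _ ?_
      rw [mem_closedBall_zero_iff, norm_smul, Real.norm_of_nonneg (by linarith), ht₀,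
        div_mul_cancel₀ _ hzpos.ne']
    have h7 : 0 ≤ 2 * C * (1 - ‖z‖) ^ (-L) := by positivity
    calc ‖f z‖ = ‖(f z - f (t₀ • z)) + f (t₀ • z)‖ := by rw [sub_add_cancel]
      _ ≤ 2 * C * (1 - ‖z‖) ^ (-L) * (1 - t₀) + K := (norm_add_le _ _).trans (add_le_add hmv h6)
      _ ≤ 2 * C * (1 - ‖z‖) ^ (-L) * 1 + K * (1 - ‖z‖) ^ (-L) := by
          gcongr
          · linarith
          · exact le_mul_of_one_le_right hK0 hone
      _ = _ := by ring

theorem PolyGrowth.of_radialDeriv_iterate (hn : 0 < n) (hf : DifferentiableOn ℂ f (unitBall n))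
    {k : ℕ} (h : PolyGrowth (radialDeriv^[k] f)) : ∀ j ≤ k, PolyGrowth (radialDeriv^[j] f) := by
  intro j hj
  induction hj using Nat.decreasingInduction with
  | of_succ j _ ih =>
    rw [Function.iterate_succ_apply'] at ih
    exact PolyGrowth.of_radialDeriv (differentiableOn_radialDeriv_iterate hn hf j) ih
  | self => exact h

/-- For large `M` the functions `(1 - |z|²)^M R^j f`, `j ≤ M`, are in `L^p(dv_α)`. -/
theorem MemBergman.exists_wlp (hn : 0 < n) (hp : 1 ≤ p) {α : ℝ} (h : MemBergman p α f) :
    ∃ M₀ : ℕ, ∀ M ≥ M₀, ∀ j ≤ M, WLp p (α / p + M) (radialDeriv^[j] f) := by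
  have hp0 : 0 < p := by linarith
  obtain ⟨hf, k, hk, hmem⟩ := h
  rw [wlp_iff_psi_pow_mul hp] at hmem
  have hk' : -p⁻¹ < α / p + k := by
    have := (div_lt_div_iff_of_pos_right hp0).2 hk
    rw [add_div, mul_div_cancel_left₀ _ hp0.ne', neg_div, one_div] at this
    linarith
  have hfk := differentiableOn_radialDeriv_iterate hn hf k
  -- Orders up to k have only polynomial growth to rely on, so M must be taken large.
  have hsmall : ∀ j : ℕ, ∃ M₀ : ℕ, j ≤ k → ∀ M ≥ M₀,
      WLp p (α / p + M) (radialDeriv^[j] f) := fun j => by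
    by_cases hj : j ≤ k
    · obtain ⟨C, L, -, hL, hb⟩ :=
        PolyGrowth.of_radialDeriv_iterate hn hf (hmem.polyGrowth hn hp hfk) j hj
      obtain ⟨M₀, hM₀⟩ := exists_nat_ge (L - α / p)
      refine ⟨M₀, fun _ M hM => ?_⟩
      refine wlp_of_norm_le hp (differentiableOn_radialDeriv_iterate hn hf j).continuousOn hL hb ?_
      have h1 : (M₀ : ℝ) ≤ M := Nat.cast_le.2 hM
      have : 0 ≤ p * (α / p + M - L) := mul_nonneg hp0.le (by linarith)
      linarith
    · exact ⟨0, fun h => absurd h hj⟩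
  choose M₀ hM₀ using hsmall
  refine ⟨∑ j ∈ Finset.range (k + 1), M₀ j, fun M hM j hj => ?_⟩
  rcases le_or_gt j k with hjk | hjk
  · refine hM₀ j hjk M (le_trans ?_ hM)
    exact Finset.single_le_sum (f := M₀) (fun _ _ => Nat.zero_le _)
      (Finset.mem_range.2 (Nat.lt_succ_of_le hjk))
  -- Orders above k each cost one power of ψ, which is affordable as j ≤ M.
  · obtain ⟨i, rfl⟩ := Nat.exists_eq_add_of_le hjk.le
    have h1 := wlp_radialDeriv_iterate hn hp hfk hk' hmem i
    rw [← Function.iterate_add_apply, add_comm i k] at h1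
    refine h1.mono ?_
    have : ((k + i : ℕ) : ℝ) ≤ M := Nat.cast_le.2 hj
    push_cast at this
    linarith

end

section

variable {n : ℕ} {p : ℝ} {f g : Cn n → ℂ}

/-! ### The integral representation in terms of `kerInt` -/

/-- The density against which the kernel is integrated. -/
def density (γ : ℂ) (g : Cn n → ℂ) (w : Cn n) : ℂ := normConst n γ.re * (g w * (psi w : ℂ) ^ γ)

theorem kernelIntegrand_eq (γ c : ℂ) (g : Cn n → ℂ) (z w : Cn n) :
    kernelIntegrand γ c g z w = g w * (psi w : ℂ) ^ γ * ker c z w := by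
  rw [kernelIntegrand, ker, Complex.cpow_neg, div_eq_mul_inv]
  ring

theorem kernelIntegral_eq (γ c : ℂ) (g : Cn n → ℂ) :
    kernelIntegral γ c g = kerInt c (density γ g) := by
  ext z
  rw [kernelIntegral, kerInt, ← integral_const_mul]
  simp only [kernelIntegrand_eq, density, mul_assoc]

theorem integrableOn_of_kernelConverges {γ c : ℂ} (h : KernelConverges γ c g 0) :
    IntegrableOn (fun w => g w * (psi w : ℂ) ^ γ) (unitBall n) := by
  refine Integrable.congr h (.of_forall fun w => ?_)
  rw [kernelIntegrand_eq]
  simp [ker]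

theorem kernelConverges_of_integrableOn {γ c : ℂ}
    (h : IntegrableOn (fun w => g w * (psi w : ℂ) ^ γ) (unitBall n)) {z : Cn n}
    (hz : z ∈ unitBall n) : KernelConverges γ c g z :=
  (integrableOn_mul_ker c h hz).congr (.of_forall fun _ => (kernelIntegrand_eq _ _ _ _ _).symm)

theorem integrableOn_density {γ : ℂ}
    (h : IntegrableOn (fun w => g w * (psi w : ℂ) ^ γ) (unitBall n)) :
    IntegrableOn (density γ g) (unitBall n) :=
  Integrable.const_mul h _

theorem WLp.density {γ : ℂ} {b : ℝ} (h : WLp p b g) : WLp p (b - γ.re) (density γ g) :=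
  (h.mul_psi_cpow γ).const_mul _

/-! ### Kernel integrals belong to the Bergman space -/

/-- The derivatives are combinations of kernel integrals of exponents c + i with i ≤ j ≤ k, all
covered by one Schur bound with A = α/p + k. -/
theorem wlp_radialDeriv_iterate_kerInt (hn : 0 < n) (hp : 1 ≤ p) {B α : ℝ} (hB : -1 + p⁻¹ < B)
    {H : Cn n → ℂ} (hH : WLp p (-B) H) {c : ℂ} (hc : c.re = n + 1 + α / p + B) {k : ℕ}
    (hk : -1 < p * k + α) : ∀ j ≤ k, WLp p (α / p + k) (radialDeriv^[j] (kerInt c H)) := by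
  intro j hj
  have hp0 : 0 < p := by linarith
  have hA : -p⁻¹ < α / p + k := by
    have := (div_lt_div_iff_of_pos_right hp0).2 hk
    rw [add_div, mul_div_cancel_left₀ _ hp0.ne', neg_div, one_div] at this
    linarith
  obtain ⟨e, he⟩ := radialDeriv_iterate_kerInt (n := n) c j
  refine (wlp_congr (he H (hH.integrableOn hp hB))).2 (WLp.sum _ fun i hi => ?_)
  refine (wlp_kerInt hn hp hA hB hH ?_).const_mul _
  have h1 : (i : ℝ) ≤ k := Nat.cast_le.2 ((Nat.lt_succ_iff.1 (Finset.mem_range.1 hi)).trans hj)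
  simp only [Complex.add_re, Complex.natCast_re, hc]
  linarith

theorem exists_nat_lt_mul_add (hp : 1 ≤ p) (α : ℝ) : ∃ k : ℕ, -1 < p * k + α := by
  obtain ⟨k, hk⟩ := exists_nat_ge (-α)
  refine ⟨k, ?_⟩
  have : (k : ℝ) ≤ p * k := le_mul_of_one_le_left (Nat.cast_nonneg k) hp
  linarith

theorem memBergman_kerInt (hn : 0 < n) (hp : 1 ≤ p) {B α : ℝ} (hB : -1 + p⁻¹ < B)
    {H : Cn n → ℂ} (hH : WLp p (-B) H) {c : ℂ} (hc : c.re = n + 1 + α / p + B) :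
    MemBergman p α (kerInt c H) := by
  obtain ⟨k, hk⟩ := exists_nat_lt_mul_add hp α
  exact ⟨differentiableOn_kerInt c (hH.integrableOn hp hB), k, hk,
    (wlp_iff_psi_pow_mul hp α k).2 (wlp_radialDeriv_iterate_kerInt hn hp hB hH hc hk k le_rfl)⟩

theorem MemBergman.congr {α : ℝ} (h : ∀ z ∈ unitBall n, f z = g z) (hp : 1 ≤ p)
    (hf : MemBergman p α f) : MemBergman p α g := by
  obtain ⟨hd, k, hk, hm⟩ := hf
  refine ⟨hd.congr fun z hz => (h z hz).symm, k, hk, ?_⟩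
  rw [wlp_iff_psi_pow_mul hp] at hm ⊢
  exact (wlp_congr fun z hz => radialDeriv_iterate_congr h k hz).1 hm

/-! ### Bergman functions are kernel integrals -/

/-- After conjugation this is the reproducing formula at v for a kernel holomorphic in w. -/
theorem integral_psi_mul_ker_mul_ker (hn : 0 < n) {β : ℝ} (hβ : -1 < β) (c : ℂ) {z v : Cn n}
    (hz : z ∈ unitBall n) (hv : v ∈ unitBall n) :
    ∫ w in unitBall n, ker (n + 1 + β) w v * ((psi w : ℂ) ^ (β : ℂ) * ker c z w)
      = starRingEnd ℂ (volConst n β) * ker c z v := by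
  have hβ' : -1 < (β : ℂ).re := by simpa using hβ
  have hd : DifferentiableOn ℂ (fun w => ker (starRingEnd ℂ c) w z) (unitBall n) := fun w hw =>
    (hasFDerivAt_ker _ hw hz).differentiableAt.differentiableWithinAt
  have hconj : ∀ w ∈ unitBall n, starRingEnd ℂ (ker (n + 1 + β) w v * ((psi w : ℂ) ^ (β : ℂ) *
      ker c z w)) = ker (starRingEnd ℂ c) w z * (psi w : ℂ) ^ (β : ℂ) * ker (n + 1 + β) v w := by
    intro w hw
    have h1 := psi_pos (mem_unitBall.1 hw)
    rw [map_mul, map_mul, conj_ker _ hw hv, conj_ker _ hz hw, ← Complex.ofReal_cpow h1.le,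
      Complex.conj_ofReal]
    simp only [map_add, map_natCast, map_one, Complex.conj_ofReal]
    ring
  have hint : IntegrableOn (fun w => ker (starRingEnd ℂ c) w z * (psi w : ℂ) ^ (β : ℂ))
      (unitBall n) := by
    have h1 := integrableOn_mul_ker c (integrableOn_psi_cpow n hβ') hz
    refine Integrable.mono h1 ?_ (ae_unitBall_of_forall fun w hw => ?_)
    · exact ((measurable_ker_left _ z).mul (measurable_psi_cpow _)).aestronglyMeasurable
    · rw [norm_mul, norm_mul, ← conj_ker c hz hw, Complex.norm_conj, mul_comm]
  have hrep := kerInt_reproducing hn hβ' hd hint hv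
  rw [← Complex.conj_conj (∫ w in unitBall n, _), ← integral_conj,
    setIntegral_congr_fun measurableSet_unitBall hconj]
  change starRingEnd ℂ (kerInt (n + 1 + β) _ v) = _
  rw [hrep, map_mul, conj_ker _ hv hz, Complex.conj_conj]

/-- Fubini, then the preceding identity for the inner integral: projecting the density onto
holomorphic functions does not change its kernel integral. Absolute convergence holds because the
Schur bound puts ψ^A times the inner absolute integral in L^p, and B > -1 + 1/p makes ψ^B times an
L^p function integrable. -/
theorem kerInt_kerInt (hn : 0 < n) (hp : 1 ≤ p) {A B : ℝ} (hA : -p⁻¹ < A) (hB : -1 + p⁻¹ < B)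
    {H : Cn n → ℂ} (hH : WLp p (-B) H) (c : ℂ) {z : Cn n} (hz : z ∈ unitBall n) :
    kerInt c (fun w => kerInt (n + 1 + (A + B : ℝ)) H w * (psi w : ℂ) ^ ((A + B : ℝ) : ℂ)) z
      = starRingEnd ℂ (volConst n (A + B : ℝ)) * kerInt c H z := by
  have hβ : -1 < A + B := by linarith
  set μ := volume.restrict (unitBall n) with hμ
  set b : ℂ := n + 1 + (A + B : ℝ) with hb
  set F : Cn n → Cn n → ℂ := fun w v =>
    H v * (ker b w v * ((psi w : ℂ) ^ ((A + B : ℝ) : ℂ) * ker c z w)) with hF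
  have hint : Integrable (Function.uncurry F) (μ.prod μ) := by
    have hm : AEStronglyMeasurable (Function.uncurry F) (μ.prod μ) := by
      have m1 : AEStronglyMeasurable (fun q : Cn n × Cn n => H q.2) (μ.prod μ) :=
        hH.aestronglyMeasurable.comp_snd
      have m2 : Measurable fun q : Cn n × Cn n =>
          ker b q.1 q.2 * ((psi q.1 : ℂ) ^ ((A + B : ℝ) : ℂ) * ker c z q.1) :=
        (measurable_ker b).mul (((measurable_psi_cpow _).comp measurable_fst).mul
          ((measurable_ker_right c z).comp measurable_fst))
      exact m1.mul m2.aestronglyMeasurable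
    refine ⟨hm, ?_⟩
    obtain ⟨C₁, hC₁, h₁⟩ := norm_ker_le_rpow (n := n) b (s := n + 1 + A + B)
      (by simp [hb, add_assoc])
    obtain ⟨C₂, L, hC₂, -, h₂⟩ := norm_ker_le (n := n) c
    set D : ℝ := C₂ * (1 - ‖z‖) ^ (-L) with hD
    set S : Cn n → ℝ≥0∞ := fun w => ENNReal.ofReal (psi w ^ A) * ∫⁻ v in unitBall n,
      ‖H v‖ₑ * ENNReal.ofReal (‖1 - pairing w v‖ ^ (-(n + 1 + A + B))) with hS
    have hSm : AEMeasurable S μ := by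
      refine (measurable_psi.pow_const A).ennreal_ofReal.aemeasurable.mul ?_
      refine AEMeasurable.lintegral_prod_right' (f := fun q : Cn n × Cn n =>
        ‖H q.2‖ₑ * ENNReal.ofReal (‖1 - pairing q.1 q.2‖ ^ (-(n + 1 + A + B)))) ?_
      have m1 : AEMeasurable (fun q : Cn n × Cn n => ‖H q.2‖ₑ) (μ.prod μ) :=
        hH.aestronglyMeasurable.comp_snd.enorm
      have m2 : Measurable fun q : Cn n × Cn n =>
          ENNReal.ofReal (‖1 - pairing q.1 q.2‖ ^ (-(n + 1 + A + B) : ℝ)) :=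
        ((measurable_const.sub continuous_pairing.measurable).norm.pow_const _).ennreal_ofReal
      exact m1.mul m2.aemeasurable
    have hfin := lintegral_psi_mul_lt_top hp hB hSm (schur_abs hn hp hA hB hH)
    rw [HasFiniteIntegral, lintegral_prod _ hm.enorm]
    refine lt_of_le_of_lt (setLIntegral_mono' (g := fun w => ENNReal.ofReal (D * C₁) *
      (ENNReal.ofReal (psi w ^ B) * S w)) measurableSet_unitBall fun w hw => ?_) ?_
    · have hψ := psi_pos (mem_unitBall.1 hw)
      have hD0 : 0 ≤ D := (norm_nonneg _).trans (h₂ z hz w hw)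
      have h3 : ENNReal.ofReal (D * C₁) * (ENNReal.ofReal (psi w ^ B) * S w)
          = ∫⁻ v in unitBall n, ENNReal.ofReal (D * C₁) * (ENNReal.ofReal (psi w ^ (A + B)) *
            (‖H v‖ₑ * ENNReal.ofReal (‖1 - pairing w v‖ ^ (-(n + 1 + A + B))))) := by
        rw [lintegral_const_mul' _ _ ENNReal.ofReal_ne_top,
          lintegral_const_mul' _ _ ENNReal.ofReal_ne_top, hS, ← mul_assoc (ENNReal.ofReal (psi w ^ B)),
          ← ENNReal.ofReal_mul (by positivity), ← Real.rpow_add hψ, add_comm B A]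
      rw [h3]
      refine setLIntegral_mono' measurableSet_unitBall fun v hv => ?_
      simp only [Function.uncurry, hF, enorm_mul]
      have e1 : ‖ker b w v‖ₑ ≤ ENNReal.ofReal C₁ *
          ENNReal.ofReal (‖1 - pairing w v‖ ^ (-(n + 1 + A + B))) := by
        rw [← ENNReal.ofReal_mul hC₁.le, ← ofReal_norm]
        exact ENNReal.ofReal_le_ofReal (h₁ w hw v hv)
      have e2 : ‖ker c z w‖ₑ ≤ ENNReal.ofReal D := by
        rw [← ofReal_norm]; exact ENNReal.ofReal_le_ofReal (h₂ z hz w hw)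
      have e3 : ‖(psi w : ℂ) ^ ((A + B : ℝ) : ℂ)‖ₑ = ENNReal.ofReal (psi w ^ (A + B)) := by
        rw [← ofReal_norm, norm_psi_cpow _ hw, Complex.ofReal_re]
      calc _ ≤ ‖H v‖ₑ * (ENNReal.ofReal C₁ *
            ENNReal.ofReal (‖1 - pairing w v‖ ^ (-(n + 1 + A + B))) *
            (ENNReal.ofReal (psi w ^ (A + B)) * ENNReal.ofReal D)) := by
            rw [e3]; gcongr
        _ = _ := by rw [ENNReal.ofReal_mul hD0]; ring
    · rw [lintegral_const_mul' _ _ ENNReal.ofReal_ne_top]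
      exact ENNReal.mul_lt_top ENNReal.ofReal_lt_top hfin
  have hswap := integral_integral_swap hint
  calc _ = ∫ w, ∫ v, F w v ∂μ ∂μ := by
        refine setIntegral_congr_fun measurableSet_unitBall fun w _ => ?_
        simp only [hF, kerInt]
        rw [mul_assoc, ← integral_mul_const]
        refine integral_congr_ae (.of_forall fun v => ?_)
        ring
    _ = ∫ v, ∫ w, F w v ∂μ ∂μ := hswap
    _ = ∫ v in unitBall n, starRingEnd ℂ (volConst n (A + B : ℝ)) * (H v * ker c z v) := by
        refine setIntegral_congr_fun measurableSet_unitBall fun v hv => ?_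
        simp only [hF]
        rw [integral_const_mul, integral_psi_mul_ker_mul_ker hn hβ c hz hv]
        ring
    _ = _ := integral_const_mul _ _

theorem MemBergman.exists_representation (hn : 0 < n) (hp : 1 ≤ p) {α : ℝ} {γ lam c : ℂ}
    (hB : -1 + p⁻¹ < γ.re - lam.re / p) (hc : ∀ m : ℕ, c ≠ -m)
    (hcre : c.re = n + 1 + α / p + (γ.re - lam.re / p)) (hf : MemBergman p α f) :
    ∃ g : Cn n → ℂ, WLp p (lam.re / p) g ∧ ∀ z ∈ unitBall n, f z = kerInt c (density γ g) z := by
  set B := γ.re - lam.re / p with hBdef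
  obtain ⟨M₀, hM₀⟩ := hf.exists_wlp hn hp
  -- M₀ controls the derivatives of f, while M₁ ensures Re β₂ > -1.
  obtain ⟨M₁, hM₁⟩ := exists_nat_gt (-(α / p + B) - 1)
  set M := max M₀ M₁ with hM
  have hM1 : (M₁ : ℝ) ≤ M := Nat.cast_le.2 (le_max_right _ _)
  obtain ⟨N, hN⟩ := exists_nat_gt (-p⁻¹ - lam.re / p)
  set A : ℝ := N + lam.re / p with hA
  have hA1 : -p⁻¹ < A := by linarith
  have hd := hf.1
  -- Chosen so that the reproducing kernel of weight β₂ has exponent n + 1 + β₂ = c + M.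
  set β₂ : ℂ := c + M - n - 1 with hβ₂
  have hβ₂re : β₂.re = α / p + B + M := by
    simp [hβ₂, hcre]; ring
  have hβ₂1 : -1 < β₂.re := by rw [hβ₂re]; linarith
  set h := shiftDeriv c M f with hh
  have hhd : DifferentiableOn ℂ h (unitBall n) := differentiableOn_shiftDeriv hn c M hd
  have hhW : WLp p (α / p + M) h := by
    obtain ⟨e, he⟩ := shiftDeriv_eq_sum hn c M
    refine (wlp_congr (he f hd)).2 (WLp.sum _ fun i hi => ?_)
    exact (hM₀ M (le_max_left _ _) i (Nat.lt_succ_iff.1 (Finset.mem_range.1 hi))).const_mul _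
  have hH2 := hhW.mul_psi_cpow β₂
  set H₂ : Cn n → ℂ := fun w => h w * (psi w : ℂ) ^ β₂ with hH₂
  rw [hβ₂re, show α / p + M - (α / p + B + M) = -B by ring] at hH2
  have hi2 := hH2.integrableOn hp hB
  have hK1 : starRingEnd ℂ (volConst n (A + B : ℝ)) ≠ 0 := by
    simpa using volConst_ne_zero n (β := ((A + B : ℝ) : ℂ)) (by rw [Complex.ofReal_re]; linarith)
  have hK2 := volConst_ne_zero n hβ₂1
  have hK3 : (normConst n γ.re : ℂ) ≠ 0 := by exact_mod_cast (normConst_pos n γ.re).ne'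
  have hinv : ∀ z ∈ unitBall n, kerInt c H₂ z = volConst n β₂ * f z := by
    refine shiftDeriv_injective hn hc _ (differentiableOn_kerInt c hi2) hd M fun z hz => ?_
    rw [shiftDeriv_kerInt hc hi2 M z hz, ← kerInt_reproducing hn hβ₂1 hhd hi2 hz,
      show c + M = n + 1 + β₂ by rw [hβ₂]; ring]
  -- `H₂` already represents a multiple of f. Projecting it once more gives a g that is a
  -- holomorphic function times a power of ψ.
  set G := kerInt (n + 1 + (A + B : ℝ)) H₂ with hG
  have hGW : WLp p A G := wlp_kerInt hn hp hA1 hB hH2 (by simp [add_assoc])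
  -- The imaginary part is chosen to make θ + γ the real number A + B required by `kerInt_kerInt`;
  -- the real part N lowers the weight from A to Re λ/p.
  set θ : ℂ := N - γ.im * Complex.I with hθ
  have hθre : θ.re = N := by simp [hθ]
  have hθγ : θ + γ = ((A + B : ℝ) : ℂ) := by
    apply Complex.ext <;> simp [hθ, hA, hBdef]
  set K := (normConst n γ.re : ℂ) * starRingEnd ℂ (volConst n (A + B : ℝ)) * volConst n β₂ with hK
  have hK0 : K ≠ 0 := mul_ne_zero (mul_ne_zero hK3 hK1) hK2
  refine ⟨fun w => K⁻¹ * (G w * (psi w : ℂ) ^ θ), ?_, fun z hz => ?_⟩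
  · have := (hGW.mul_psi_cpow θ).const_mul K⁻¹
    rwa [hθre, show A - N = lam.re / p by rw [hA]; ring] at this
  · have hdens : ∀ w ∈ unitBall n, density γ (fun w => K⁻¹ * (G w * (psi w : ℂ) ^ θ)) w * ker c z w
        = (normConst n γ.re * K⁻¹) * ((G w * (psi w : ℂ) ^ ((A + B : ℝ) : ℂ)) * ker c z w) := by
      intro w hw
      have h0 : (psi w : ℂ) ≠ 0 := by exact_mod_cast (psi_pos (mem_unitBall.1 hw)).ne'
      rw [density, ← hθγ, Complex.cpow_add _ _ h0]
      ring
    rw [kerInt, setIntegral_congr_fun measurableSet_unitBall hdens, integral_const_mul]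
    have := kerInt_kerInt hn hp hA1 hB hH2 c hz
    rw [kerInt] at this
    rw [this, hinv z hz]
    have : (normConst n γ.re : ℂ) * K⁻¹ * (starRingEnd ℂ (volConst n (A + B : ℝ)) *
        (volConst n β₂ * f z)) = K⁻¹ * K * f z := by rw [hK]; ring
    rw [this, inv_mul_cancel₀ hK0, one_mul]

/-! ### Sharpness of the condition on the exponent of the kernel -/

theorem hasFDerivAt_coord_pow (i : Fin n) (M : ℕ) (z : Cn n) :
    radialDeriv (fun w : Cn n => w i ^ M) z = M * z i ^ M := by
  have h1 : HasFDerivAt (fun w : Cn n => w i) (EuclideanSpace.proj (𝕜 := ℂ) i) z :=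
    (EuclideanSpace.proj (𝕜 := ℂ) i).hasFDerivAt
  rw [radialDeriv_eq_fderiv, (h1.pow M).fderiv]
  rcases M with _ | M
  · simp
  · simp [pow_succ]; ring

theorem differentiable_coord_pow (i : Fin n) (M : ℕ) :
    Differentiable ℂ (fun w : Cn n => w i ^ M) := by
  fun_prop

/-- On z_i^M the operator R acts as M, and R - (m + 1) sends a kernel integral of exponent -(m + 1)
to one of exponent -m. Descending to exponent 0, where the integral is constant, multiplies C only
by nonzero factors as M > m. -/
theorem coord_pow_eq_kerInt_neg (i : Fin n) (m : ℕ) : ∀ M > m, ∀ (C : ℂ) (H : Cn n → ℂ),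
    IntegrableOn H (unitBall n) →
    (∀ z ∈ unitBall n, C * z i ^ M = kerInt (-m) H z) → C = 0 := by
  have hz₀ : EuclideanSpace.single i (1 / 2 : ℂ) ∈ unitBall n := by
    rw [mem_unitBall]; simp; norm_num
  have hder : ∀ (C : ℂ) (M : ℕ), ∀ z ∈ unitBall n,
      radialDeriv (fun w : Cn n => C * w i ^ M) z = M * (C * z i ^ M) := fun C M z hz => by
    rw [radialDeriv_const_mul (differentiable_coord_pow i M).differentiableOn _ hz,
      hasFDerivAt_coord_pow]
    ring
  induction m with
  | zero =>
    intro M hM C H hH h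
    have h1 := hder C M _ hz₀
    rw [radialDeriv_congr h hz₀, radialDeriv_kerInt _ hH hz₀] at h1
    have hM' : (M : ℂ) ≠ 0 := by exact_mod_cast hM.ne'
    simpa [hM', hM.ne'] using h1
  | succ m ih =>
    intro M hM C H hH h
    have h1 : ∀ z ∈ unitBall n, ((M - (m + 1)) * C) * z i ^ M
        = kerInt (-m) (fun w => -(m + 1) * H w) z := fun z hz => by
      have h2 := hder C M z hz
      rw [radialDeriv_congr h hz, radialDeriv_kerInt _ hH hz, ← h z hz] at h2
      have h3 : kerInt (-m) (fun w => -(m + 1) * H w) z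
          = -(m + 1) * kerInt (-(m + 1 : ℕ) + 1) H z := by
        rw [kerInt, kerInt, ← integral_const_mul,
          show (-(m + 1 : ℕ) + 1 : ℂ) = -m by push_cast; ring]
        simp only [mul_assoc]
      rw [h3]
      push_cast at h2 ⊢
      linear_combination -h2
    have h2 := ih M (by omega) _ _ (hH.const_mul _) h1
    have h3 : (M - (m + 1) : ℂ) ≠ 0 := by
      rw [sub_ne_zero]; exact_mod_cast hM.ne'
    exact (mul_eq_zero.1 h2).resolve_left h3

theorem memBergman_coord_pow (hp : 1 ≤ p) (α : ℝ) (i : Fin n) (M : ℕ) :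
    MemBergman p α (fun w : Cn n => w i ^ M) := by
  have hp0 : 0 < p := by linarith
  obtain ⟨k, hk⟩ := exists_nat_lt_mul_add hp α
  have hR : ∀ k : ℕ, ∀ z ∈ unitBall n,
      radialDeriv^[k] (fun w : Cn n => w i ^ M) z = (M : ℂ) ^ k * z i ^ M := fun k => by
    induction k with
    | zero => intro z _; simp
    | succ k ih =>
      intro z hz
      rw [Function.iterate_succ_apply', radialDeriv_congr ih hz,
        radialDeriv_const_mul (differentiable_coord_pow i M).differentiableOn _ hz,
        hasFDerivAt_coord_pow]
      ring
  refine ⟨(differentiable_coord_pow i M).differentiableOn, k, hk, ?_⟩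
  rw [wlp_iff_psi_pow_mul hp, wlp_congr (hR k)]
  refine WLp.const_mul (wlp_of_norm_le (C := 1) (L := 0) hp
    (differentiable_coord_pow i M).continuous.continuousOn le_rfl (fun z hz => ?_) ?_) _
  · rw [neg_zero, Real.rpow_zero, mul_one, norm_pow]
    exact pow_le_one₀ (norm_nonneg _) ((PiLp.norm_apply_le z i).trans (mem_unitBall.1 hz).le)
  · have : p * (α / p + k - 0) = p * k + α := by field_simp; ring
    rw [this]; exact hk

end

section

variable {n : ℕ} {p : ℝ} {f g : Cn n → ℂ}

/-! ### Radial weights at the borderline of integrability -/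

theorem integrableOn_unitBall_fun_norm_iff (hn : 0 < n) (F : ℝ → ℝ) :
    IntegrableOn (fun w : Cn n => F ‖w‖) (unitBall n) ↔
      IntegrableOn (fun y : ℝ => y ^ (2 * n - 1) * F y) (Ioo 0 1) := by
  have : Nontrivial (Cn n) := by
    have : Nonempty (Fin n) := ⟨⟨0, hn⟩⟩
    infer_instance
  have h := integrableOn_ball_fun_norm_iff (volume : Measure (Cn n)) F
  have hd : Module.finrank ℝ (Cn n) = 2 * n := by
    rw [← Module.finrank_mul_finrank ℝ ℂ (Cn n), Complex.finrank_real_complex,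
      finrank_euclideanSpace_fin]
  rw [hd] at h
  exact h

theorem one_sub_sq_pos {y : ℝ} (hy : y ∈ Ioo (0 : ℝ) 1) : 0 < 1 - y ^ 2 := by
  nlinarith [hy.1, hy.2]

theorem one_le_one_sub_log {x : ℝ} (h0 : 0 < x) (h1 : x ≤ 1) : 1 ≤ 1 - Real.log x := by
  linarith [Real.log_nonpos h0.le h1]

theorem hasDerivAt_one_sub_log {y : ℝ} (hy : 1 - y ^ 2 ≠ 0) :
    HasDerivAt (fun y : ℝ => 1 - Real.log (1 - y ^ 2)) (2 * y / (1 - y ^ 2)) y := by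
  have h1 : HasDerivAt (fun y : ℝ => 1 - y ^ 2) (-(2 * y)) y := by
    simpa using (hasDerivAt_pow 2 y).const_sub 1
  refine ((h1.log hy).const_sub 1).congr_deriv ?_
  ring

theorem tendsto_one_sub_log : Tendsto (fun y : ℝ => 1 - Real.log (1 - y ^ 2)) (𝓝[<] 1) atTop := by
  have h1 : Tendsto (fun y : ℝ => 1 - y ^ 2) (𝓝[<] 1) (𝓝[>] 0) := by
    refine tendsto_nhdsWithin_iff.2 ⟨?_, ?_⟩
    · have : Continuous fun y : ℝ => 1 - y ^ 2 := by fun_prop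
      simpa using (this.tendsto 1).mono_left nhdsWithin_le_nhds
    · filter_upwards [Ioo_mem_nhdsLT (show (0 : ℝ) < 1 by norm_num)] with y hy
      exact one_sub_sq_pos hy
  have h2 := Real.tendsto_log_nhdsGT_zero.comp h1
  exact tendsto_atTop_add_const_left _ 1 (tendsto_neg_atBot_atTop.comp h2)

/-- In the radial variable, log(1 - log(1 - y²)) tends to infinity at y = 1 and its derivative is
comparable to the integrand there. -/
theorem not_integrableOn_psi_mul_log (hn : 0 < n) :
    ¬ IntegrableOn (fun w : Cn n => (psi w * (1 - Real.log (psi w)))⁻¹) (unitBall n) := by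
  rw [integrableOn_unitBall_fun_norm_iff hn fun y => ((1 - y ^ 2) * (1 - Real.log (1 - y ^ 2)))⁻¹]
  have hev : ∀ᶠ y : ℝ in 𝓝[<] 1, y ∈ Ioo (1 / 2 : ℝ) 1 := Ioo_mem_nhdsLT (by norm_num)
  have hder : ∀ y ∈ Ioo (1 / 2 : ℝ) 1, HasDerivAt
      (fun y : ℝ => Real.log (1 - Real.log (1 - y ^ 2)))
      (2 * y / (1 - y ^ 2) / (1 - Real.log (1 - y ^ 2))) y := fun y hy => by
    have h1 := one_sub_sq_pos ⟨by linarith [hy.1], hy.2⟩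
    have h2 := one_le_one_sub_log h1 (by nlinarith)
    exact (hasDerivAt_one_sub_log h1.ne').log (by linarith)
  refine not_integrableOn_of_tendsto_norm_atTop_of_deriv_isBigO_filter
    (f := fun y : ℝ => Real.log (1 - Real.log (1 - y ^ 2))) (𝓝[<] 1)
    (Ioo_mem_nhdsLT (by norm_num)) (hev.mono fun y hy => (hder y hy).differentiableAt)
    (tendsto_norm_atTop_atTop.comp (Real.tendsto_log_atTop.comp tendsto_one_sub_log)) ?_
  refine Asymptotics.IsBigO.of_bound (2 * 2 ^ (2 * n - 1)) (hev.mono fun y hy => ?_)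
  have h1 := one_sub_sq_pos ⟨by linarith [hy.1], hy.2⟩
  have h2 := one_le_one_sub_log h1 (by nlinarith)
  have hy0 : 0 < y := by linarith [hy.1]
  have h3 : (0 : ℝ) < 1 - Real.log (1 - y ^ 2) := by linarith
  have h4 : 1 ≤ 2 ^ (2 * n - 1) * y ^ (2 * n - 1) := by
    rw [← mul_pow]; exact one_le_pow₀ (by linarith [hy.1])
  rw [(hder y hy).deriv, Real.norm_of_nonneg (by positivity), Real.norm_of_nonneg (by positivity),
    div_div, div_eq_mul_inv, ← mul_assoc]
  refine mul_le_mul_of_nonneg_right ?_ (by positivity)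
  rw [mul_assoc]
  nlinarith [hy.2]

theorem integrableOn_psi_mul_log_rpow (hn : 0 < n) (hp : 1 < p) :
    IntegrableOn (fun w : Cn n => (psi w)⁻¹ * (1 - Real.log (psi w)) ^ (-p)) (unitBall n) := by
  rw [integrableOn_unitBall_fun_norm_iff hn
    fun y => (1 - y ^ 2)⁻¹ * (1 - Real.log (1 - y ^ 2)) ^ (-p)]
  have key : IntegrableOn (fun y : ℝ => y * ((1 - y ^ 2)⁻¹ * (1 - Real.log (1 - y ^ 2)) ^ (-p)))
      (Ioc 0 1) := by
    -- The antiderivative tends to 0 at y = 1. Since log 0 = 0 by convention, the formula has the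
    -- wrong value there and must be updated for continuity.
    refine intervalIntegral.integrableOn_deriv_of_nonneg
      (g := Function.update (fun y => -(1 - Real.log (1 - y ^ 2)) ^ (1 - p) / (2 * (p - 1))) 1 0)
      ?_ ?_ ?_
    · intro y hy
      rcases hy.2.eq_or_lt with rfl | hy1
      · rw [continuousWithinAt_update_same]
        have h1 : Tendsto (fun y : ℝ => -(1 - Real.log (1 - y ^ 2)) ^ (1 - p) / (2 * (p - 1)))
            (𝓝[<] 1) (𝓝 0) := by
          have := ((tendsto_rpow_neg_atTop (show 0 < p - 1 by linarith)).comp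
            tendsto_one_sub_log).neg.div_const (2 * (p - 1))
          simpa [Function.comp_def] using this
        refine h1.mono_left (nhdsWithin_mono _ fun x hx => lt_of_le_of_ne hx.1.2 hx.2)
      · have h1 : 0 < 1 - y ^ 2 := by nlinarith [hy.1]
        have h2 := one_le_one_sub_log h1 (by nlinarith)
        have : ContinuousAt (fun y : ℝ => -(1 - Real.log (1 - y ^ 2)) ^ (1 - p) / (2 * (p - 1))) y :=
          (((hasDerivAt_one_sub_log h1.ne').continuousAt.rpow_const
            (Or.inl (by linarith))).neg).div_const _
        exact ((continuousAt_update_of_ne hy1.ne).2 this).continuousWithinAt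
    · intro y hy
      have h1 := one_sub_sq_pos hy
      have h2 := one_le_one_sub_log h1 (by nlinarith)
      have h3 : HasDerivAt (fun y => -(1 - Real.log (1 - y ^ 2)) ^ (1 - p) / (2 * (p - 1)))
          (y * ((1 - y ^ 2)⁻¹ * (1 - Real.log (1 - y ^ 2)) ^ (-p))) y := by
        refine ((((hasDerivAt_one_sub_log h1.ne').rpow_const (p := 1 - p)
          (Or.inl (by linarith))).neg).div_const (2 * (p - 1))).congr_deriv ?_
        rw [show 1 - p - 1 = -p by ring]
        have : p - 1 ≠ 0 := by linarith
        field_simp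
        ring
      refine h3.congr_of_eventuallyEq ?_
      filter_upwards [isOpen_Ioo.mem_nhds hy] with x hx
      rw [Function.update_of_ne hx.2.ne]
    · intro y hy
      have h1 := one_sub_sq_pos hy
      have h2 := one_le_one_sub_log h1 (by nlinarith)
      have h3 := hy.1
      have : (0 : ℝ) < 1 - Real.log (1 - y ^ 2) := by linarith
      positivity
  refine Integrable.mono (key.mono_set Ioo_subset_Ioc_self) (Measurable.aestronglyMeasurable ?_) ?_
  · fun_prop
  · refine (ae_restrict_iff' measurableSet_Ioo).2 (.of_forall fun y hy => ?_)
    rw [norm_mul, norm_mul _ ((1 - y ^ 2)⁻¹ * _)]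
    refine mul_le_mul_of_nonneg_right ?_ (norm_nonneg _)
    rw [norm_pow, Real.norm_of_nonneg hy.1.le]
    exact pow_le_of_le_one hy.1.le hy.2.le (by omega)

end

section

variable {n : ℕ} {p : ℝ} {f g : Cn n → ℂ}

/-! ### Failure of the boundary case for `p = 1` -/

/-- The discs about 1 - 2^{-j} of radius 2^{-j}/8 are pairwise disjoint. On each, both 1 - |u|² and
|1 - u| are comparable to 2^{-j}, so every disc contributes at least the same positive amount κ. -/
theorem lintegral_disc_psi_mul_eq_top (s : ℝ) :
    ∫⁻ u in ball (0 : ℂ) 1, ENNReal.ofReal (psi u ^ s) *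
      ENNReal.ofReal (‖1 - starRingEnd ℂ u‖ ^ (-(2 + s))) = ∞ := by
  set δ : ℕ → ℝ := fun j => (1 / 2) ^ j with hδ
  have hδ0 : ∀ j, 0 < δ j := fun j => by positivity
  have hδ1 : ∀ j, δ j ≤ 1 := fun j => pow_le_one₀ (by norm_num) (by norm_num)
  set E : ℕ → Set ℂ := fun j => ball ((1 - δ j : ℝ) : ℂ) (δ j / 8) with hE
  have hdisj_lt : ∀ j k, j < k → Disjoint (E j) (E k) := fun j k hjk => by
    refine ball_disjoint_ball ?_
    have h1 : δ k ≤ δ j / 2 := by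
      have : δ k ≤ δ (j + 1) := pow_le_pow_of_le_one (by norm_num) (by norm_num) hjk
      rw [hδ] at this ⊢
      simp only [pow_succ] at this ⊢
      linarith
    rw [Complex.dist_eq, ← Complex.ofReal_sub, Complex.norm_real, Real.norm_eq_abs, abs_sub_comm]
    refine le_trans ?_ (le_abs_self _)
    linarith [hδ0 j]
  have hdisj : Pairwise (Function.onFun Disjoint E) := fun j k hjk => by
    rcases lt_or_gt_of_ne hjk with h | h
    · exact hdisj_lt j k h
    · exact (hdisj_lt k j h).symm
  have hbd : ∀ j, ∀ u ∈ E j, (7 / 8 * δ j ≤ 1 - ‖u‖ ∧ 1 - ‖u‖ ≤ 9 / 8 * δ j) ∧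
      (7 / 8 * δ j ≤ ‖1 - starRingEnd ℂ u‖ ∧ ‖1 - starRingEnd ℂ u‖ ≤ 9 / 8 * δ j) := by
    intro j u hu
    have hu' : ‖u - ((1 - δ j : ℝ) : ℂ)‖ < δ j / 8 := by simpa [hE, dist_eq_norm] using hu
    have hc : ‖((1 - δ j : ℝ) : ℂ)‖ = 1 - δ j := by
      rw [Complex.norm_real, Real.norm_of_nonneg (by linarith [hδ1 j])]
    have h1 := abs_le.1 ((abs_norm_sub_norm_le u ((1 - δ j : ℝ) : ℂ)).trans hu'.le)
    have hd : ‖((δ j : ℝ) : ℂ)‖ = δ j := by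
      rw [Complex.norm_real, Real.norm_of_nonneg (hδ0 j).le]
    have he : ‖1 - u - ((δ j : ℝ) : ℂ)‖ = ‖u - ((1 - δ j : ℝ) : ℂ)‖ := by
      rw [← norm_neg]
      congr 1
      push_cast
      ring
    have h2 := abs_le.1 ((abs_norm_sub_norm_le (1 - u) ((δ j : ℝ) : ℂ)).trans (he.trans_lt hu').le)
    have h3 : ‖1 - starRingEnd ℂ u‖ = ‖1 - u‖ := by
      rw [← Complex.norm_conj (1 - u), map_sub, map_one]
    rw [hc] at h1
    rw [hd] at h2
    rw [h3]
    refine ⟨⟨by linarith [h1.2], by linarith [h1.1]⟩, by linarith [h2.1], by linarith [h2.2]⟩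
  have hsub : ⋃ j, E j ⊆ ball (0 : ℂ) 1 := iUnion_subset fun j u hu => by
    have := (hbd j u hu).1.1
    rw [mem_ball_zero_iff]
    linarith [hδ0 j]
  set κ : ℝ≥0∞ := ENNReal.ofReal (8 ^ (-|s|) / 4) * (ENNReal.ofReal (1 / 8) ^ 2 * NNReal.pi) with hκ
  have hpt : ∀ j, ∀ u ∈ E j, ENNReal.ofReal (8 ^ (-|s|) / 4 * (δ j)⁻¹ ^ 2) ≤
      ENNReal.ofReal (psi u ^ s) * ENNReal.ofReal (‖1 - starRingEnd ℂ u‖ ^ (-(2 + s))) := by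
    intro j u hu
    obtain ⟨⟨h1, h2⟩, h3, h4⟩ := hbd j u hu
    set y := ‖1 - starRingEnd ℂ u‖
    have hd := hδ0 j
    have hu0 := norm_nonneg u
    have hx : psi u = (1 - ‖u‖) * (1 + ‖u‖) := by ring
    have hx1 : 7 / 8 * δ j ≤ psi u := by rw [hx]; nlinarith
    have hx2 : psi u ≤ 9 / 4 * δ j := by rw [hx]; nlinarith
    have hx0 : 0 < psi u := by linarith
    have hy0 : 0 < y := by linarith
    rw [← ENNReal.ofReal_mul (by positivity)]
    refine ENNReal.ofReal_le_ofReal ?_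
    have e1 : psi u ^ s * y ^ (-(2 + s)) = (psi u / y) ^ s * y⁻¹ ^ 2 := by
      rw [Real.div_rpow hx0.le hy0.le, neg_add, Real.rpow_add hy0, Real.rpow_neg hy0.le s,
        Real.rpow_neg hy0.le 2, Real.rpow_two, inv_pow]
      ring
    have e2 : (8 : ℝ) ^ (-|s|) ≤ (psi u / y) ^ s := by
      rcases le_total 0 s with hs | hs
      · rw [abs_of_nonneg hs, Real.rpow_neg (by norm_num), ← Real.inv_rpow (by norm_num)]
        refine Real.rpow_le_rpow (by norm_num) ?_ hs
        rw [le_div_iff₀ hy0]; linarith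
      · rw [abs_of_nonpos hs, neg_neg]
        refine Real.rpow_le_rpow_of_nonpos (by positivity) ?_ hs
        rw [div_le_iff₀ hy0]; linarith
    have e3 : (δ j)⁻¹ / 2 ≤ y⁻¹ := by
      rw [← one_div, ← one_div, div_div]
      exact one_div_le_one_div_of_le hy0 (by linarith)
    rw [e1]
    calc (8 : ℝ) ^ (-|s|) / 4 * (δ j)⁻¹ ^ 2 = 8 ^ (-|s|) * ((δ j)⁻¹ / 2) ^ 2 := by ring
      _ ≤ _ := by gcongr
  have hint : ∀ j, κ ≤ ∫⁻ u in E j, ENNReal.ofReal (psi u ^ s) *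
      ENNReal.ofReal (‖1 - starRingEnd ℂ u‖ ^ (-(2 + s))) := fun j => by
    refine le_trans (le_of_eq ?_) (setLIntegral_mono' measurableSet_ball (hpt j))
    have hd := hδ0 j
    rw [setLIntegral_const, Complex.volume_ball, hκ, div_eq_mul_one_div (δ j),
      ENNReal.ofReal_mul hd.le, mul_pow, ENNReal.ofReal_mul (by positivity),
      ENNReal.ofReal_pow (by positivity), ENNReal.ofReal_inv_of_pos hd]
    have h1 : (ENNReal.ofReal (δ j))⁻¹ ^ 2 * ENNReal.ofReal (δ j) ^ 2 = 1 := by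
      rw [← mul_pow, ENNReal.inv_mul_cancel (by simpa using hd) ENNReal.ofReal_ne_top, one_pow]
    calc _ = ENNReal.ofReal (8 ^ (-|s|) / 4) * (1 * (ENNReal.ofReal (1 / 8) ^ 2 * NNReal.pi)) := by
          rw [one_mul]
      _ = _ := by rw [← h1]; ring
  have hκ0 : κ ≠ 0 := by
    have : (0 : ℝ) < 8 ^ (-|s|) / 4 := by positivity
    rw [hκ]
    simp [this, NNReal.pi_pos.ne']
  refine top_unique ?_
  calc ∞ = ∑' _ : ℕ, κ := (ENNReal.tsum_const_eq_top_of_ne_zero hκ0).symm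
    _ ≤ _ := ENNReal.tsum_le_tsum hint
    _ = _ := (lintegral_iUnion (fun j => measurableSet_ball) hdisj _).symm
    _ ≤ _ := lintegral_mono_set hsub

/-- Take a along a coordinate axis, reduce to the disc, and let |a| → 1. By Fatou's lemma a uniform
bound would pass to the divergent limiting integral. -/
theorem not_bounded_lintegral_psi_mul_rpow (hn : 0 < n) {t : ℝ} (ht : -1 < t) {M : ℝ≥0∞}
    (hM : M ≠ ∞) : ¬ ∀ a ∈ unitBall n, ∫⁻ w in unitBall n, ENNReal.ofReal (psi w ^ t) *
      ENNReal.ofReal (‖1 - pairing a w‖ ^ (-(n + 1 + t))) ≤ M := by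
  intro h
  obtain ⟨m, rfl⟩ := Nat.exists_eq_succ_of_ne_zero hn.ne'
  set V := ∫⁻ v in unitBall m, ENNReal.ofReal (psi v ^ t) with hV
  have hVtop : V ≠ ∞ := (lintegral_psi_rpow_lt_top m ht).ne
  have hV0 : V ≠ 0 := by
    refine ((setLIntegral_pos_iff (measurable_psi.pow_const t).ennreal_ofReal).2 ?_).ne'
    refine (isOpen_unitBall.measure_pos volume ⟨0, zero_mem_unitBall⟩).trans_le
      (measure_mono fun v hv => ⟨?_, hv⟩)
    have := psi_pos (mem_unitBall.1 hv)
    have : 0 < psi v ^ t := by positivity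
    simpa using this
  set s : ℝ := m + t with hs
  set F : ℝ → ℂ → ℝ≥0∞ := fun ρ u => ENNReal.ofReal (psi u ^ s) *
      ENNReal.ofReal (‖1 - ρ * starRingEnd ℂ u‖ ^ (-(2 + s))) with hF
  have hbd : ∀ ρ : ℝ, 0 ≤ ρ → ρ < 1 → ∫⁻ u in ball (0 : ℂ) 1, F ρ u ≤ M / V := by
    intro ρ h0 h1
    set a : Cn (m + 1) := EuclideanSpace.single 0 (ρ : ℂ) with ha
    have hna : ‖a‖ = ρ := by simp [ha, abs_of_nonneg h0]
    have h2 := h a (mem_unitBall.2 (hna.trans_lt h1))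
    have h3 := lintegral_psi_mul_comp_pairing t a
      (F := fun x => ENNReal.ofReal (‖1 - x‖ ^ (-(((m + 1 : ℕ) : ℝ) + 1 + t))))
      ((measurable_const.sub measurable_id).norm.pow_const _).ennreal_ofReal
    rw [h3, hna] at h2
    rw [ENNReal.le_div_iff_mul_le (Or.inl hV0) (Or.inl hVtop), mul_comm]
    convert h2 using 5
    rw [hs]; push_cast; ring_nf
  set ρ : ℕ → ℝ := fun k => 1 - 1 / ((k : ℝ) + 1) with hρ
  have hρt : Tendsto ρ atTop (𝓝 1) := by
    simpa only [sub_zero] using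
      (tendsto_one_div_add_atTop_nhds_zero_nat (𝕜 := ℝ)).const_sub (1 : ℝ)
  have hFm : ∀ r, Measurable (F r) := fun r =>
    (measurable_psi.pow_const s).ennreal_ofReal.mul
      (((measurable_const.sub (measurable_const.mul
        Complex.continuous_conj.measurable)).norm.pow_const _).ennreal_ofReal)
  have hlim : ∫⁻ u in ball (0 : ℂ) 1, F 1 u
      = ∫⁻ u in ball (0 : ℂ) 1, liminf (fun k => F (ρ k) u) atTop := by
    refine setLIntegral_congr_fun measurableSet_ball fun u hu => (Tendsto.liminf_eq ?_).symm
    have hne : ‖1 - ((1 : ℝ) : ℂ) * starRingEnd ℂ u‖ ≠ 0 := by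
      rw [norm_ne_zero_iff, sub_ne_zero]
      intro h
      have := congrArg norm h
      rw [norm_mul, Complex.norm_conj] at this
      simp only [norm_one, Complex.ofReal_one, one_mul] at this
      exact absurd (mem_ball_zero_iff.1 hu) (by linarith)
    refine ENNReal.Tendsto.const_mul ?_ (Or.inr ENNReal.ofReal_ne_top)
    refine ENNReal.tendsto_ofReal (Tendsto.rpow_const ?_ (Or.inl hne))
    exact (tendsto_const_nhds.sub (((Complex.continuous_ofReal.tendsto 1).comp hρt).mul_const _)).norm
  have h1 : ∫⁻ u in ball (0 : ℂ) 1, F 1 u ≤ M / V := by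
    rw [hlim]
    refine (lintegral_liminf_le fun k => hFm (ρ k)).trans ?_
    refine (liminf_le_liminf (.of_forall fun k => hbd (ρ k) ?_ ?_)).trans (le_of_eq (liminf_const _))
    · have : 1 / ((k : ℝ) + 1) ≤ 1 := by
        rw [div_le_one (by positivity)]; linarith [Nat.cast_nonneg (α := ℝ) k]
      simp only [hρ]; linarith
    · have : 0 < 1 / ((k : ℝ) + 1) := by positivity
      simp only [hρ]; linarith
  have h2 := lintegral_disc_psi_mul_eq_top s
  simp only [hF, Complex.ofReal_one, one_mul] at h1
  rw [h2, top_le_iff] at h1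
  exact ENNReal.div_ne_top hM hV0 h1

end

section

variable {n : ℕ} {p : ℝ} {f g : Cn n → ℂ}

/-! ### Kernel functions as kernel integrals -/

/-- The kernel is antiholomorphic in w, so after conjugation this is the mean value property over
the largest ball about a inside the unit ball. -/
theorem setIntegral_ball_ker (b : ℂ) {z a : Cn n} (hz : z ∈ unitBall n) (ha : a ∈ unitBall n) :
    ∫ w in ball a (1 - ‖a‖), ker b z w = volume.real (ball a (1 - ‖a‖)) * ker b z a := by
  have hsub : ball a (1 - ‖a‖) ⊆ unitBall n := fun w hw => by
    rw [mem_unitBall]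
    have h1 := mem_ball_iff_norm.1 hw
    have h2 := norm_le_norm_add_norm_sub' w a
    linarith
  have hmem : ∀ v ∈ ball (0 : Cn n) (1 - ‖a‖), a + v ∈ unitBall n := fun v hv =>
    hsub (by simpa using hv)
  have hd : DifferentiableOn ℂ (fun v => ker (starRingEnd ℂ b) (a + v) z)
      (ball (0 : Cn n) (1 - ‖a‖)) := fun v hv =>
    (((hasFDerivAt_ker _ (hmem v hv) hz).comp v
      ((hasFDerivAt_id v).const_add a)).differentiableAt).differentiableWithinAt
  have htr : ∀ F : Cn n → ℂ, ∫ w in ball a (1 - ‖a‖), F w = ∫ v in ball 0 (1 - ‖a‖), F (a + v) := by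
    intro F
    have h := (measurePreserving_add_left volume a).setIntegral_preimage_emb
      (measurableEmbedding_addLeft a) F (ball a (1 - ‖a‖))
    rw [← h, preimage_add_ball, sub_self]
  have hint : IntegrableOn (fun v => ker (starRingEnd ℂ b) (a + v) z * 1)
      (ball (0 : Cn n) (1 - ‖a‖)) := by
    obtain ⟨C, L, hC, hL, h⟩ := norm_ker_le (n := n) b
    refine Measure.integrableOn_of_bounded (M := C * (1 - ‖z‖) ^ (-L)) measure_ball_lt_top.ne ?_ ?_
    · exact (((measurable_ker_left _ z).comp (measurable_const_add a)).mul_const _).aestronglyMeasurable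
    · refine (ae_restrict_iff' measurableSet_ball).2 (.of_forall fun v hv => ?_)
      rw [mul_one, ← conj_ker b hz (hmem v hv), Complex.norm_conj]
      exact h z hz _ (hmem v hv)
  have hmean := setIntegral_mul_radial (volume : Measure (Cn n))
    (fun c hc => measurePreserving_smul c hc) hd (ω := fun _ => 1) measurable_const
    (fun _ _ _ => rfl) hint
  have hconj : ∫ w in ball a (1 - ‖a‖), ker b z w
      = starRingEnd ℂ (∫ w in ball a (1 - ‖a‖), ker (starRingEnd ℂ b) w z) := by
    rw [← integral_conj]
    refine setIntegral_congr_fun measurableSet_ball fun w hw => ?_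
    change _ = starRingEnd ℂ _
    rw [← conj_ker b hz (hsub hw), Complex.conj_conj]
  have hv : volume.real (ball a (1 - ‖a‖)) = volume.real (ball (0 : Cn n) (1 - ‖a‖)) := by
    rw [measureReal_def, measureReal_def, Measure.addHaar_ball_center]
  simp only [mul_one, add_zero, setIntegral_const, Complex.real_smul] at hmean
  rw [hconj, htr, hmean, ← conj_ker b hz ha, map_mul, Complex.conj_conj, Complex.conj_ofReal, hv,
    mul_comm]

/-- A normalized indicator of a ball about a acts on every kernel as the point mass at a, yet it is
an L¹ function of norm at most 1. -/
theorem exists_kerInt_eq_ker {a : Cn n} (ha : a ∈ unitBall n) : ∃ H : Cn n → ℂ,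
    IntegrableOn H (unitBall n) ∧ ∫ w in unitBall n, ‖H w‖ ≤ 1 ∧
      ∀ b : ℂ, ∀ z ∈ unitBall n, kerInt b H z = ker b z a := by
  have hsub : ball a (1 - ‖a‖) ⊆ unitBall n := fun w hw => by
    rw [mem_unitBall]
    have h1 := mem_ball_iff_norm.1 hw
    have h2 := norm_le_norm_add_norm_sub' w a
    linarith
  have hr : 0 < 1 - ‖a‖ := by linarith [mem_unitBall.1 ha]
  set S := ball a (1 - ‖a‖) with hS
  have hV : 0 < volume.real S := ENNReal.toReal_pos (measure_ball_pos _ _ hr).ne' measure_ball_lt_top.ne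
  set V := volume.real S with hVdef
  have hVc : (V : ℂ) ≠ 0 := by exact_mod_cast hV.ne'
  have hinter : S ∩ unitBall n = S := inter_eq_left.2 hsub
  refine ⟨S.indicator fun _ => (V : ℂ)⁻¹, ?_, ?_, fun b z hz => ?_⟩
  · exact ((integrable_indicator_iff measurableSet_ball).2
      (integrableOn_const measure_ball_lt_top.ne)).integrableOn
  · simp only [norm_indicator_eq_indicator_norm]
    rw [integral_indicator measurableSet_ball, Measure.restrict_restrict measurableSet_ball, hinter,
      setIntegral_const, ← hVdef, norm_inv, Complex.norm_real, Real.norm_of_nonneg hV.le, smul_eq_mul,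
      mul_inv_cancel₀ hV.ne']
  · have h1 : ∀ w, S.indicator (fun _ => (V : ℂ)⁻¹) w * ker b z w
        = S.indicator (fun w => (V : ℂ)⁻¹ * ker b z w) w := fun w =>
      (indicator_mul_left S (fun _ => (V : ℂ)⁻¹) (ker b z)).symm
    simp only [kerInt, h1]
    rw [integral_indicator measurableSet_ball, Measure.restrict_restrict measurableSet_ball, hinter,
      integral_const_mul, setIntegral_ball_ker b hz ha, inv_mul_cancel_left₀ hVc]

/-! ### The uniform boundedness principle -/

/-- Banach-Steinhaus for seminorms: in a Banach space a pointwise bounded supremum of continuous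
seminorms is continuous. -/
theorem exists_bound_of_seminorms {E : Type*} [NormedAddCommGroup E] [NormedSpace ℂ E]
    [CompleteSpace E] (q : ℕ → Seminorm ℂ E) (hq : ∀ k, ∃ C : ℝ, ∀ x, q k x ≤ C * ‖x‖)
    (hb : ∀ x, ∃ C : ℝ, ∀ k, q k x ≤ C) : ∃ C : ℝ, 0 < C ∧ ∀ k x, q k x ≤ C * ‖x‖ := by
  have hcont : ∀ k, Continuous (q k) := fun k => by
    obtain ⟨C, hC⟩ := hq k
    refine Seminorm.continuous_of_continuousAt_zero ?_
    rw [ContinuousAt, map_zero]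
    refine squeeze_zero (fun x => apply_nonneg _ _) hC ?_
    have : Continuous fun x : E => C * ‖x‖ := by fun_prop
    simpa using this.tendsto 0
  have hbdd : BddAbove (range q) := Seminorm.bddAbove_range_iff.2 fun x => by
    obtain ⟨C, hC⟩ := hb x
    exact ⟨C, by rintro _ ⟨k, rfl⟩; exact hC k⟩
  have hsup : Continuous (⨆ k, q k : Seminorm ℂ E) := by
    rw [Seminorm.coe_iSup_eq hbdd]
    exact Seminorm.continuous_iSup q hcont hbdd
  obtain ⟨C, hC0, hC⟩ := Seminorm.bound_of_continuous_normedSpace _ hsup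
  refine ⟨C, hC0, fun k x => le_trans ?_ (hC x)⟩
  rw [Seminorm.iSup_apply hbdd]
  exact le_ciSup (Seminorm.bddAbove_range_iff.1 hbdd x) k

theorem integrableOn_psi_mul_norm_of_wlp_one {t : ℝ} (h : WLp 1 t f) :
    IntegrableOn (fun z => psi z ^ t * ‖f z‖) (unitBall n) := by
  rw [WLp, ENNReal.ofReal_one, memLp_one_iff_integrable] at h
  refine h.norm.congr (ae_unitBall_of_forall fun w hw => ?_)
  have := psi_pos (mem_unitBall.1 hw)
  change ‖psi w ^ t • f w‖ = _
  rw [norm_smul, Real.norm_of_nonneg (by positivity)]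

theorem kerInt_congr_ae (b : ℂ) (h : f =ᵐ[volume.restrict (unitBall n)] g) : kerInt b f = kerInt b g := by
  ext z
  exact integral_congr_ae (h.mono fun w hw => by simp only [hw])

/-- On a smaller ball the kernel is bounded, so each truncated integral is a continuous seminorm on
L¹. The full integral, finite by assumption, bounds them pointwise. -/
theorem exists_bound_integral_kerInt {t : ℝ} (ht : -1 < t) {b : ℂ}
    (h : ∀ H : Cn n → ℂ, IntegrableOn H (unitBall n) → WLp 1 t (kerInt b H)) :
    ∃ C : ℝ, ∀ k : ℕ, ∀ H : Cn n → ℂ, IntegrableOn H (unitBall n) →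
      ∫ z in ball 0 (1 - 1 / ((k : ℝ) + 1)), psi z ^ t * ‖kerInt b H z‖
        ≤ C * ∫ w in unitBall n, ‖H w‖ := by
  set μ := volume.restrict (unitBall n) with hμ
  set r : ℕ → ℝ := fun k => 1 - 1 / ((k : ℝ) + 1) with hr
  have hr1 : ∀ k, r k < 1 := fun k => by
    have : 0 < 1 / ((k : ℝ) + 1) := by positivity
    simp only [hr]; linarith
  have hsub : ∀ k, ball (0 : Cn n) (r k) ⊆ unitBall n := fun k => ball_subset_ball (hr1 k).le
  have hI : ∀ H : Cn n → ℂ, IntegrableOn H (unitBall n) → ∀ k,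
      IntegrableOn (fun z => psi z ^ t * ‖kerInt b H z‖) (ball 0 (r k)) := fun H hH k =>
    (integrableOn_psi_mul_norm_of_wlp_one (h H hH)).mono_set (hsub k)
  have hL : ∀ x : Lp ℂ 1 μ, IntegrableOn x (unitBall n) := fun x => L1.integrable_coeFn x
  have hadd : ∀ x y : Lp ℂ 1 μ, ∀ z ∈ unitBall n,
      kerInt b (x + y : Lp ℂ 1 μ) z = kerInt b x z + kerInt b y z := fun x y z hz => by
    rw [kerInt_congr_ae b (Lp.coeFn_add x y), kerInt, kerInt, kerInt,
      ← integral_add (integrableOn_mul_ker b (hL x) hz) (integrableOn_mul_ker b (hL y) hz)]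
    simp only [Pi.add_apply, add_mul]
  have hsmul : ∀ (c : ℂ) (x : Lp ℂ 1 μ) (z : Cn n),
      kerInt b (c • x : Lp ℂ 1 μ) z = c * kerInt b x z := fun c x z => by
    rw [kerInt_congr_ae b (Lp.coeFn_smul c x), kerInt, kerInt, ← integral_const_mul]
    simp only [Pi.smul_apply, smul_eq_mul, mul_assoc]
  let q : ℕ → Seminorm ℂ (Lp ℂ 1 μ) := fun k => Seminorm.of
    (fun x => ∫ z in ball 0 (r k), psi z ^ t * ‖kerInt b x z‖)
    (fun x y => by
      rw [← integral_add (hI x (hL x) k) (hI y (hL y) k)]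
      refine setIntegral_mono_on (hI _ (hL _) k) ((hI x (hL x) k).add (hI y (hL y) k))
        measurableSet_ball fun z hz => ?_
      have := psi_pos (mem_unitBall.1 (hsub k hz))
      rw [hadd x y z (hsub k hz), ← mul_add]
      gcongr
      exact norm_add_le _ _)
    (fun c x => by
      rw [← integral_const_mul]
      refine setIntegral_congr_fun measurableSet_ball fun z _ => ?_
      simp only [hsmul, norm_mul]
      ring)
  have hbound : ∀ k, ∃ C : ℝ, ∀ x, q k x ≤ C * ‖x‖ := fun k => by
    obtain ⟨C, L, hC, hL0, hker⟩ := norm_ker_le (n := n) b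
    set D := C * (1 - r k) ^ (-L) with hD
    have hψ := (integrableOn_psi_rpow n ht).mono_set (hsub k)
    refine ⟨(∫ z in ball (0 : Cn n) (r k), psi z ^ t) * D, fun x => ?_⟩
    have hle : ∀ z ∈ ball (0 : Cn n) (r k), ‖kerInt b x z‖ ≤ D * ‖x‖ := fun z hz => by
      have hz' : ‖z‖ < r k := mem_ball_zero_iff.1 hz
      rw [L1.norm_eq_integral_norm, ← integral_const_mul]
      refine norm_integral_le_of_norm_le ((hL x).norm.const_mul D) (ae_unitBall_of_forall fun w hw => ?_)
      rw [norm_mul, mul_comm]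
      refine mul_le_mul_of_nonneg_right ((hker z (hsub k hz) w hw).trans ?_) (norm_nonneg _)
      refine mul_le_mul_of_nonneg_left ?_ hC.le
      exact Real.rpow_le_rpow_of_nonpos (by linarith [hr1 k]) (by linarith) (by linarith)
    change ∫ z in ball 0 (r k), psi z ^ t * ‖kerInt b x z‖ ≤ _
    rw [mul_assoc, ← integral_mul_const]
    refine setIntegral_mono_on (hI x (hL x) k) (hψ.mul_const _) measurableSet_ball fun z hz => ?_
    have := psi_pos (mem_unitBall.1 (hsub k hz))
    exact mul_le_mul_of_nonneg_left (hle z hz) (by positivity)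
  have hpt : ∀ x, ∃ C : ℝ, ∀ k, q k x ≤ C := fun x =>
    ⟨∫ z in unitBall n, psi z ^ t * ‖kerInt b x z‖, fun k =>
      setIntegral_mono_set (integrableOn_psi_mul_norm_of_wlp_one (h x (hL x)))
        (ae_unitBall_of_forall fun z hz => by
          have := psi_pos (mem_unitBall.1 hz)
          simp only [Pi.zero_apply]
          positivity) (hsub k).eventuallyLE⟩
  obtain ⟨C, -, hC⟩ := exists_bound_of_seminorms q hbound hpt
  refine ⟨C, fun k H hH => ?_⟩
  have h1 := hC k (Integrable.toL1 H hH)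
  have h2 : ⇑(Integrable.toL1 H hH) =ᵐ[μ] H := Integrable.coeFn_toL1 hH
  rw [L1.norm_eq_integral_norm, integral_congr_ae (h2.mono fun w hw => congrArg norm hw)] at h1
  change ∫ z in ball 0 (r k), psi z ^ t * ‖kerInt b _ z‖ ≤ _ at h1
  rwa [kerInt_congr_ae b h2] at h1

theorem not_forall_wlp_one_kerInt (hn : 0 < n) {t : ℝ} (ht : -1 < t) {b : ℂ}
    (hb : b.re = n + 1 + t) :
    ¬ ∀ H : Cn n → ℂ, IntegrableOn H (unitBall n) → WLp 1 t (kerInt b H) := by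
  intro h
  obtain ⟨C, hC⟩ := exists_bound_integral_kerInt ht h
  set κ : ℝ := Real.exp (-(Real.pi * |b.im|)) with hκ
  have hκ0 : 0 < κ := Real.exp_pos _
  set r : ℕ → ℝ := fun k => 1 - 1 / ((k : ℝ) + 1) with hr
  have hr1 : ∀ k, r k < 1 := fun k => by
    have : 0 < 1 / ((k : ℝ) + 1) := by positivity
    simp only [hr]; linarith
  have hsub : ∀ k, ball (0 : Cn n) (r k) ⊆ unitBall n := fun k => ball_subset_ball (hr1 k).le
  have hU : unitBall n = ⋃ k, ball (0 : Cn n) (r k) := by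
    refine subset_antisymm (fun z hz => ?_) (iUnion_subset hsub)
    obtain ⟨k, hk⟩ := exists_nat_one_div_lt (sub_pos.2 (mem_unitBall.1 hz))
    refine mem_iUnion.2 ⟨k, mem_ball_zero_iff.2 ?_⟩
    simp only [hr]
    linarith
  have hmono : Monotone fun k => ball (0 : Cn n) (r k) := fun j k hjk => by
    refine ball_subset_ball ?_
    simp only [hr]
    gcongr
  -- Test the uniform bound on the approximate point mass at a. The lower bound for complex powers
  -- brings in the constant κ, and the truncated balls exhaust the unit ball.
  refine not_bounded_lintegral_psi_mul_rpow hn ht (M := ENNReal.ofReal (κ⁻¹ * (|C| * 1)))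
    ENNReal.ofReal_ne_top fun a ha => ?_
  obtain ⟨H, hH, hH1, hHk⟩ := exists_kerInt_eq_ker ha
  rw [hU, setLIntegral_iUnion_of_directed _ hmono.directed_le]
  refine iSup_le fun k => ?_
  have hle : ∀ z ∈ ball (0 : Cn n) (r k), ENNReal.ofReal (psi z ^ t) *
      ENNReal.ofReal (‖1 - pairing a z‖ ^ (-(n + 1 + t)))
        ≤ ENNReal.ofReal (κ⁻¹ * (psi z ^ t * ‖kerInt b H z‖)) := fun z hz => by
    have hz' := hsub k hz
    have hψ := psi_pos (mem_unitBall.1 hz')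
    rw [← ENNReal.ofReal_mul (by positivity), hHk b z hz']
    refine ENNReal.ofReal_le_ofReal ?_
    have h1 := le_norm_cpow_neg (one_sub_pairing_re_pos hz' ha) b
    have h2 : ‖1 - pairing a z‖ = ‖1 - pairing z a‖ := by
      rw [← conj_pairing, ← Complex.norm_conj]
      simp
    rw [h2, ← hb, mul_left_comm]
    refine mul_le_mul_of_nonneg_left ?_ (by positivity)
    rw [le_inv_mul_iff₀ hκ0]
    exact h1
  have hint := (integrableOn_psi_mul_norm_of_wlp_one (h H hH)).mono_set (hsub k)
  refine (setLIntegral_mono' measurableSet_ball hle).trans ?_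
  rw [← ofReal_integral_eq_lintegral_ofReal (hint.const_mul _)
    ((ae_restrict_iff' measurableSet_ball).2 (.of_forall fun z hz => by
      have hψ := psi_pos (mem_unitBall.1 (hsub k hz))
      simp only [Pi.zero_apply]
      positivity)), integral_const_mul]
  refine ENNReal.ofReal_le_ofReal (mul_le_mul_of_nonneg_left ?_ (by positivity))
  have h0 : 0 ≤ ∫ w in unitBall n, ‖H w‖ := by positivity
  exact (hC k H hH).trans (mul_le_mul (le_abs_self C) hH1 h0 (abs_nonneg C))

end

section

variable {n : ℕ} {p : ℝ} {f g : Cn n → ℂ}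

/-! ### Necessity of the integrability condition -/

theorem wlp_ofReal (hp : 1 ≤ p) {a : ℝ} {F : Cn n → ℝ} (hF : Measurable F)
    (h0 : ∀ w ∈ unitBall n, 0 ≤ F w)
    (h : IntegrableOn (fun w => (psi w ^ a * F w) ^ p) (unitBall n)) :
    WLp p a fun w => (F w : ℂ) := by
  refine (wlp_iff hp).2 ⟨(Complex.measurable_ofReal.comp hF).aestronglyMeasurable, ?_⟩
  refine lt_of_le_of_lt (le_of_eq (setLIntegral_congr_fun measurableSet_unitBall fun w hw => ?_))
    h.lintegral_lt_top
  have hψ := psi_pos (mem_unitBall.1 hw)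
  have hFw := h0 w hw
  have h1 : ‖(F w : ℂ)‖ₑ = ENNReal.ofReal (F w) := by
    rw [← ofReal_norm, Complex.norm_real, Real.norm_of_nonneg hFw]
  change (ENNReal.ofReal (psi w ^ a) * ‖(F w : ℂ)‖ₑ) ^ p = _
  rw [h1, ← ENNReal.ofReal_mul (by positivity), ENNReal.ofReal_rpow_of_nonneg (by positivity)
    (by linarith)]

theorem not_integrableOn_ofReal_mul_psi_cpow (hn : 0 < n) {γ : ℂ} {F : Cn n → ℝ}
    (hF : ∀ w ∈ unitBall n, (psi w * (1 - Real.log (psi w)))⁻¹ ≤ F w * psi w ^ γ.re) :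
    ¬ IntegrableOn (fun w => (F w : ℂ) * (psi w : ℂ) ^ γ) (unitBall n) := fun h => by
  refine not_integrableOn_psi_mul_log hn (Integrable.mono h ?_ (ae_unitBall_of_forall fun w hw => ?_))
  · exact (measurable_psi.mul (measurable_const.sub (Real.measurable_log.comp
      measurable_psi))).inv.aestronglyMeasurable
  · have hψ := psi_pos (mem_unitBall.1 hw)
    have hl := one_le_one_sub_log hψ (psi_le_one w)
    rw [norm_mul, norm_psi_cpow γ hw, Complex.norm_real, Real.norm_of_nonneg
      (inv_nonneg.2 (mul_nonneg hψ.le (by linarith)))]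
    exact (hF w hw).trans (mul_le_mul_of_nonneg_right (le_abs_self _) (by positivity))

/-- For p > 1 a logarithm separates L^p from L¹ at the critical power, so equality is excluded as
well. For p = 1 equality makes gψ^γ integrable for every such g, and the endpoint survives. -/
theorem lt_or_eq_of_forall_integrableOn (hn : 0 < n) (hp : 1 ≤ p) {a : ℝ} {γ : ℂ}
    (h : ∀ g : Cn n → ℂ, WLp p a g → IntegrableOn (fun w => g w * (psi w : ℂ) ^ γ) (unitBall n)) :
    -1 + p⁻¹ < γ.re - a ∨ p = 1 ∧ γ.re = a := by
  by_contra hcon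
  rw [not_or, not_lt, not_and] at hcon
  obtain ⟨h1, h2⟩ := hcon
  rcases hp.eq_or_lt with rfl | hp1
  · have hlt : γ.re < a := by
      rw [inv_one] at h1
      exact lt_of_le_of_ne (by linarith) (h2 rfl)
    -- Here ψ^a F = ψ^{a-1-Re γ} is integrable because a > Re γ, while F ψ^{Re γ} = ψ^{-1} is not.
    refine not_integrableOn_ofReal_mul_psi_cpow hn (F := fun w => psi w ^ (-1 - γ.re))
      (fun w hw => ?_) (h _ (wlp_ofReal le_rfl (measurable_psi.pow_const _) (fun w hw => ?_) ?_))
    · have hψ := psi_pos (mem_unitBall.1 hw)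
      have hl := one_le_one_sub_log hψ (psi_le_one w)
      rw [← Real.rpow_add hψ, sub_add_cancel, Real.rpow_neg_one, mul_inv]
      exact mul_le_of_le_one_right (by positivity) (inv_le_one_of_one_le₀ hl)
    · have hψ := psi_pos (mem_unitBall.1 hw)
      positivity
    · refine (integrableOn_psi_rpow n (t := a + (-1 - γ.re)) (by linarith)).congr_fun
        (fun w hw => ?_) measurableSet_unitBall
      have hψ := psi_pos (mem_unitBall.1 hw)
      simp only [Real.rpow_one, Real.rpow_add hψ]
  · have hp0 : 0 < p := by linarith
    -- Now (ψ^a F)^p = ψ^{-1}(1 - log ψ)^{-p} is integrable, but F ψ^{Re γ} dominates the divergent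
    -- ψ^{-1}(1 - log ψ)^{-1}.
    refine not_integrableOn_ofReal_mul_psi_cpow hn
      (F := fun w => psi w ^ (-p⁻¹ - a) * (1 - Real.log (psi w))⁻¹)
      (fun w hw => ?_) (h _ (wlp_ofReal hp ?_ (fun w hw => ?_) ?_))
    · have hψ := psi_pos (mem_unitBall.1 hw)
      have hl := one_le_one_sub_log hψ (psi_le_one w)
      have hl0 : 0 < 1 - Real.log (psi w) := by linarith
      rw [mul_right_comm, ← Real.rpow_add hψ, mul_inv, ← Real.rpow_neg_one (psi w)]
      refine mul_le_mul_of_nonneg_right ?_ (by positivity)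
      exact Real.rpow_le_rpow_of_exponent_ge hψ (psi_le_one w) (by linarith)
    · exact (measurable_psi.pow_const _).mul
        (measurable_const.sub (Real.measurable_log.comp measurable_psi)).inv
    · have hψ := psi_pos (mem_unitBall.1 hw)
      have hl := one_le_one_sub_log hψ (psi_le_one w)
      have hl0 : 0 < 1 - Real.log (psi w) := by linarith
      positivity
    · refine (integrableOn_psi_mul_log_rpow hn hp1).congr_fun (fun w hw => ?_) measurableSet_unitBall
      have hψ := psi_pos (mem_unitBall.1 hw)
      have hl := one_le_one_sub_log hψ (psi_le_one w)
      have hl0 : 0 < 1 - Real.log (psi w) := by linarith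
      simp only
      rw [← mul_assoc, ← Real.rpow_add hψ, Real.mul_rpow (by positivity) (by positivity),
        ← Real.rpow_mul hψ.le, Real.inv_rpow hl0.le, Real.rpow_neg hl0.le,
        show (a + (-p⁻¹ - a)) * p = -1 by field_simp; ring, Real.rpow_neg_one]

/-! ### Independence of the number of derivatives -/

/-- Membership holds for one k by definition; representing f as a kernel integral transfers it to
every admissible k and to all lower derivatives. -/
theorem MemBergman.wlp_iterate (hn : 0 < n) (hp : 1 ≤ p) {α : ℝ} (hf : MemBergman p α f) {k : ℕ}
    (hk : -1 < p * k + α) : ∀ j ≤ k, WLp p (α / p + k) (radialDeriv^[j] f) := by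
  -- The auxiliary parameters γ = N and λ = 0 are free; N large gives both the integrability
  -- condition and a positive exponent.
  obtain ⟨N, hN⟩ := exists_nat_gt (max 0 (-(n + 1 + α / p)))
  have hN0 : (0 : ℝ) < N := (le_max_left _ _).trans_lt hN
  have hN1 : -(n + 1 + α / p) < N := (le_max_right _ _).trans_lt hN
  have hpi : p⁻¹ ≤ 1 := inv_le_one_of_one_le₀ hp
  have hB : -1 + p⁻¹ < (N : ℂ).re - (0 : ℂ).re / p := by
    simp only [Complex.natCast_re, Complex.zero_re, zero_div]; linarith
  have hcre : (((n + 1 + α / p + N : ℝ)) : ℂ).re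
      = n + 1 + α / p + ((N : ℂ).re - (0 : ℂ).re / p) := by simp
  have hc : ∀ m : ℕ, (((n + 1 + α / p + N : ℝ)) : ℂ) ≠ -m := fun m h => by
    have := congrArg Complex.re h
    simp only [Complex.ofReal_re, Complex.neg_re, Complex.natCast_re] at this
    linarith [Nat.cast_nonneg (α := ℝ) m]
  obtain ⟨g, hg, hrep⟩ := hf.exists_representation hn hp hB hc hcre
  have hd : WLp p (-((N : ℂ).re - (0 : ℂ).re / p)) (density N g) := by
    have := WLp.density (γ := N) hg
    rwa [neg_sub]
  intro j hj
  exact (wlp_congr fun z hz => radialDeriv_iterate_congr hrep j hz).2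
    (wlp_radialDeriv_iterate_kerInt hn hp hB hd hcre hk j hj)

/-- Applying the shift operator k times converts membership in A^1_α into a weighted L¹ bound for
the kernel of exponent c + k with weight exponent α + k > -1, where the endpoint failure applies. -/
theorem not_forall_memBergman_one (hn : 0 < n) {α : ℝ} {c : ℂ} (hc : ∀ m : ℕ, c ≠ -m)
    (hcre : c.re = n + 1 + α) :
    ¬ ∀ H : Cn n → ℂ, IntegrableOn H (unitBall n) → MemBergman 1 α (kerInt c H) := by
  intro h
  obtain ⟨k, hk⟩ := exists_nat_lt_mul_add le_rfl α
  refine not_forall_wlp_one_kerInt hn (t := α / 1 + k) (b := c + k) (by linarith) ?_ fun H hH => ?_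
  · simp only [Complex.add_re, Complex.natCast_re, hcre]
    ring
  · obtain ⟨e, he⟩ := shiftDeriv_eq_sum hn c k
    refine (wlp_congr (shiftDeriv_kerInt hc hH k)).1 ?_
    refine (wlp_congr (he _ (differentiableOn_kerInt c hH))).2 (WLp.sum _ fun i hi => ?_)
    exact ((h H hH).wlp_iterate hn le_rfl hk i
      (Nat.lt_succ_iff.1 (Finset.mem_range.1 hi))).const_mul _

/-- For p = 1 at the endpoint the map from g to its density is onto L¹. -/
theorem exists_kernelIntegral_eq (γ c : ℂ) {H : Cn n → ℂ} (hH : IntegrableOn H (unitBall n)) :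
    ∃ g : Cn n → ℂ, WLp 1 γ.re g ∧ kernelIntegral γ c g = kerInt c H := by
  have hN : (normConst n γ.re : ℂ) ≠ 0 := by exact_mod_cast (normConst_pos n γ.re).ne'
  have h0 : WLp 1 0 H := by
    rw [WLp, ENNReal.ofReal_one, memLp_one_iff_integrable]
    simpa [IntegrableOn] using hH
  refine ⟨fun w => (normConst n γ.re : ℂ)⁻¹ * (H w * (psi w : ℂ) ^ (-γ)), ?_, ?_⟩
  · simpa using (h0.mul_psi_cpow (-γ)).const_mul (normConst n γ.re : ℂ)⁻¹
  · rw [kernelIntegral_eq]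
    refine kerInt_congr_ae c (ae_unitBall_of_forall fun w hw => ?_)
    have hψ : (psi w : ℂ) ≠ 0 := by exact_mod_cast (psi_pos (mem_unitBall.1 hw)).ne'
    rw [density, ← mul_assoc, ← mul_assoc, mul_inv_cancel₀ hN, one_mul, mul_assoc,
      ← Complex.cpow_add _ _ hψ, neg_add_cancel, Complex.cpow_zero, mul_one]

/-! ### The parameters of the representation -/

theorem exponent_re (n : ℕ) (p α : ℝ) (γ lam : ℂ) :
    (n + 1 + γ + (α - lam) / p : ℂ).re = n + 1 + α / p + (γ.re - lam.re / p) := by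
  simp only [Complex.add_re, Complex.natCast_re, Complex.one_re, Complex.div_ofReal_re,
    Complex.sub_re, Complex.ofReal_re]
  ring

theorem isNegInt_sub_one_iff {c : ℂ} : IsNegInt (c - 1) ↔ ∃ m : ℕ, c = -m := by
  constructor
  · rintro ⟨m, hm, h⟩
    obtain ⟨k, hk⟩ := Int.eq_ofNat_of_zero_le (show 0 ≤ -(m + 1) by omega)
    refine ⟨k, ?_⟩
    have : ((-(m + 1) : ℤ) : ℂ) = k := by rw [hk]; simp
    push_cast at this
    linear_combination h - this
  · rintro ⟨m, rfl⟩
    exact ⟨-(m + 1), by omega, by push_cast; ring⟩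

theorem isNegInt_iff (n : ℕ) (p α : ℝ) (γ lam : ℂ) : IsNegInt (n + γ + (α - lam) / p) ↔
    ∃ m : ℕ, (n + 1 + γ + (α - lam) / p : ℂ) = -m := by
  rw [← isNegInt_sub_one_iff]
  ring_nf

theorem add_one_lt_mul_iff (hp : 0 < p) (x y : ℝ) :
    y + 1 < p * (x + 1) ↔ -1 + p⁻¹ < x - y / p := by
  rw [← mul_lt_mul_iff_right₀ hp (b := -1 + p⁻¹)]
  have h1 : p * (-1 + p⁻¹) = -p + 1 := by field_simp
  have h2 : p * (x - y / p) = p * x - y := by field_simp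
  rw [h1, h2]
  constructor <;> intro h <;> linarith

end

end BergmanBall

end

/-! ### The representation theorem and the sharpness of its conditions. -/

open BergmanBall

theorem mainTheorem2 (n : ℕ) (hn : 0 < n) (p : ℝ) (hp : 1 ≤ p) (α : ℝ) (γ lam : ℂ) :
    -- the integral representation, under conditions (a) and (b)
    ((lam.re + 1 < p * (γ.re + 1) ∧ ¬ BergmanBall.IsNegInt (n + γ + (α - lam) / p)) →
      (∀ g : BergmanBall.Cn n → ℂ, BergmanBall.MemLpWeighted p lam g →
        ∀ z ∈ BergmanBall.unitBall n,
          BergmanBall.KernelConverges γ (n + 1 + γ + (α - lam) / p) g z) ∧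
      (∀ f : BergmanBall.Cn n → ℂ, DifferentiableOn ℂ f (BergmanBall.unitBall n) →
        (BergmanBall.MemBergman p α f ↔
          ∃ g : BergmanBall.Cn n → ℂ, BergmanBall.MemLpWeighted p lam g ∧
            BergmanBall.Represents γ (n + 1 + γ + (α - lam) / p) g f))) ∧
    -- condition (b) is sharp
    (BergmanBall.IsNegInt (n + γ + (α - lam) / p) →
      ∃ f : BergmanBall.Cn n → ℂ, BergmanBall.MemBergman p α f ∧
        ¬ ∃ g : BergmanBall.Cn n → ℂ, BergmanBall.MemLpWeighted p lam g ∧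
          BergmanBall.Represents γ (n + 1 + γ + (α - lam) / p) g f) ∧
    -- condition (a) is sharp
    (¬ BergmanBall.IsNegInt (n + γ + (α - lam) / p) →
      (∀ g : BergmanBall.Cn n → ℂ, BergmanBall.MemLpWeighted p lam g →
        (∀ z ∈ BergmanBall.unitBall n,
          BergmanBall.KernelConverges γ (n + 1 + γ + (α - lam) / p) g z) ∧
        BergmanBall.MemBergman p α
          (BergmanBall.kernelIntegral γ (n + 1 + γ + (α - lam) / p) g)) →
      lam.re + 1 < p * (γ.re + 1)) := by
  have hp0 : 0 < p := by linarith
  set c : ℂ := n + 1 + γ + (α - lam) / p with hc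
  have hcre : c.re = n + 1 + α / p + (γ.re - lam.re / p) := exponent_re n p α γ lam
  have hneg : IsNegInt (n + γ + (α - lam) / p) ↔ ∃ m : ℕ, c = -m := isNegInt_iff n p α γ lam
  have hconv : ∀ {f g : Cn n → ℂ}, Represents γ c g f →
      IntegrableOn (fun w => g w * (psi w : ℂ) ^ γ) (unitBall n) := fun h =>
    integrableOn_of_kernelConverges (h 0 zero_mem_unitBall).1
  simp only [memLpWeighted_iff hp]
  rw [add_one_lt_mul_iff hp0, hneg, not_exists]
  have hint : -1 + p⁻¹ < γ.re - lam.re / p → ∀ g : Cn n → ℂ, WLp p (lam.re / p) g →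
      IntegrableOn (fun w => g w * (psi w : ℂ) ^ γ) (unitBall n) := fun hB g hg => by
    have := hg.mul_psi_cpow γ
    rw [← neg_sub] at this
    exact this.integrableOn hp hB
  refine ⟨fun ⟨hB, hcm⟩ => ⟨fun g hg z hz => kernelConverges_of_integrableOn (hint hB g hg) hz,
    fun f _ => ⟨fun hf => ?_, fun ⟨g, hg, hrep⟩ => ?_⟩⟩, fun ⟨m, hm⟩ => ?_, fun hcm h => ?_⟩
  · obtain ⟨g, hg, hfg⟩ := hf.exists_representation hn hp hB hcm hcre
    exact ⟨g, hg, fun z hz => ⟨kernelConverges_of_integrableOn (hint hB g hg) hz, by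
      rw [kernelIntegral_eq, hfg z hz]⟩⟩
  · have hd : WLp p (-(γ.re - lam.re / p)) (density γ g) := by
      rw [neg_sub]
      exact WLp.density hg
    refine (memBergman_kerInt hn hp hB hd hcre).congr (fun z hz => ?_) hp
    rw [(hrep z hz).2, kernelIntegral_eq]
  -- A monomial of degree one more than that of the polynomial kernel (1 - ⟨z,w⟩)^m.
  · refine ⟨fun w => w ⟨0, hn⟩ ^ (m + 1), memBergman_coord_pow hp α _ _, ?_⟩
    rintro ⟨g, -, hrep⟩
    refine one_ne_zero (coord_pow_eq_kerInt_neg ⟨0, hn⟩ m (m + 1) m.lt_succ_self 1 (density γ g)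
      (integrableOn_density (hconv hrep)) fun z hz => ?_)
    rw [one_mul, ← hm, ← kernelIntegral_eq]
    exact (hrep z hz).2
  -- Convergence at z = 0 settles everything but the endpoint p = 1; only there is membership in
  -- A^1_α used.
  · rcases lt_or_eq_of_forall_integrableOn hn hp fun g hg =>
      integrableOn_of_kernelConverges ((h g hg).1 0 zero_mem_unitBall) with hB | ⟨rfl, hγ⟩
    · exact hB
    · rw [div_one] at hγ
      refine absurd (fun H hH => ?_) (not_forall_memBergman_one hn (α := α) hcm ?_)
      · obtain ⟨g, hg, hgH⟩ := exists_kernelIntegral_eq γ c hH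
        rw [← hgH]
        refine (h g ?_).2
        rwa [div_one, ← hγ]
      · rw [hcre, hγ]
        ring
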